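/- **Theorem.** Identify $SU(2)$ with the unit quaternions and let $G=SU(2)\ltimes\mathbb H$ with product $(A,q)(A',q')=(AA',Aq'+q)$. Let $p$ be a prime, $e^{i\beta}$ a primitive $p$-th root of unity, $A_\beta=\cos\beta+i\sin\beta\in SU(2)$, and let $\Lambda\cong\mathbb Z^4$ be a lattice of $\mathbb H$ with $A_\beta\Lambda\subseteq\Lambda$, so that $\Gamma_\beta=\langle A_\beta\rangle\ltimes\Lambda$ is a discrete subgroup of $G$. Let $M_\beta$ be the quotient manifold of $G$ by left multiplication by $\Gamma_\beta$. For a real number $a\neq0$ let $e^1,\dots,e^7$ be the coframe of $M_\beta$ induced by the left-invariant $1$-forms on $G$ determined by $$A^{-1}dA=\tfrac a2\,(e^6\,i+e^4\,j+e^1\,k),\qquad A^{-1}dq=e^2+e^3\,i-e^5\,j+e^7\,k .$$ Put $u(t)=1+\tfrac12at$, $v(t)=1$, and $$\omega(t)=uv\,(e^{12}+e^{34}+e^{56}),\qquad \eta(t)=v^{-3}e^7,$$ $$\psi_+(t)=uv^2(e^{135}-e^{236}-e^{245})-u^3e^{146},\qquad \psi_-(t)=u^2v\,(e^{136}+e^{145}-e^{246})+v^3e^{235}.$$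 Then there is an open interval $(b,c)$ containing $0$ such that: 1. For every $t\in(b,c)$, $(\omega(t),\eta(t),\psi_+(t)+i\psi_-(t))$ is an $SU(3)$-structure on $M_\beta$ (smooth forms which, at each point, can be written in some basis $f^1,\dots,f^7$ of the cotangent space as $\omega=f^{12}+f^{34}+f^{56}$, $\eta=f^7$, $\psi_++i\psi_-=(f^1+if^2)\wedge(f^3+if^4)\wedge(f^5+if^6)$), and $d\omega=0$, $d(\psi_\pm\wedge\eta)=0$. 2. On $(b,c)$ this family satisfies $\partial_t\omega=-d\eta$, $\partial_t(\psi_+\wedge\eta)=d\psi_-$, $\partial_t(\psi_-\wedge\eta)=-d\psi_+$, where $d$ is the exterior derivative of $M_\beta$. 3. There is a smooth Riemannian metric $g$ on $M_\beta\times(b,c)$ which, together with $\tilde\omega=\omega(t)+\eta(t)\wedge dt$ and $\tilde\psi=(\psi_+(t)+i\psi_-(t))\wedge(\eta(t)+i\,dt)$, is an $SU(4)$-structure, with adapted orthonormal coframe $$(E^1,\dots,E^8)=(ue^1,\,ve^2,\,ve^3,\,ue^4,\,ve^5,\,ue^6,\,v^{-3}e^7,\,dt),$$ i.e. $g=\sum_i(E^i)^2$,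 $\tilde\omega=E^{12}+E^{34}+E^{56}+E^{78}$, $\tilde\psi=(E^1+iE^2)\wedge(E^3+iE^4)\wedge(E^5+iE^6)\wedge(E^7+iE^8)$; and this structure is integrable: $d\tilde\omega=0$ and $d\tilde\psi=0$. 4. The Levi-Civita connection of $g$ is flat. At each point the holonomy group of $g$ acts on the tangent space by matrices of $SU(4)$ in the complex coordinates $(E^1+iE^2,E^3+iE^4,E^5+iE^6,E^7+iE^8)$; it is a discrete subgroup of the general linear group of the tangent space, and its Lie algebra is trivial. -/

import Mathlib

open scoped Manifold ContDiff Quaternion Topology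

noncomputable section

namespace MBeta

/-! ### Exterior algebra on a real topological vector space -/

section ExteriorAlgebra

variable {V : Type*} [AddCommGroup V] [Module ℝ V] [TopologicalSpace V]
  {A : Type*} [NormedCommRing A] [NormedAlgebra ℝ A]

/-- The linear map `v ↦ (-1) ^ k θ(v) α`, whose alternatization is `α ∧ θ`. -/
def wedgeAux {k : ℕ} (α : V [⋀^Fin k]→L[ℝ] A) (θ : V →L[ℝ] A) : V →ₗ[ℝ] V [⋀^Fin k]→ₗ[ℝ] A where
  toFun v := (LinearMap.mulLeft ℝ ((-1) ^ k * θ v)).compAlternatingMap α.toAlternatingMap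
  map_add' v w := by ext; simp [mul_add, add_mul, mul_assoc]
  map_smul' c v := by ext; simp [mul_assoc]

theorem alternatize_wedgeAux_apply {k : ℕ} (α : V [⋀^Fin k]→L[ℝ] A) (θ : V →L[ℝ] A)
    (v : Fin (k + 1) → V) :
    AlternatingMap.alternatizeUncurryFin (wedgeAux α θ) v =
      ∑ i : Fin (k + 1), (-1) ^ (k + (i : ℕ)) * θ (v i) * α (i.removeNth v) := by
  rw [AlternatingMap.alternatizeUncurryFin_apply]
  refine Finset.sum_congr rfl fun i _ => ?_
  simp [wedgeAux, pow_add, zsmul_eq_mul]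
  ring

/-- The wedge product `α ∧ θ` of a `k`-form `α` and a `1`-form `θ`, see `wedge_apply`. -/
def wedge {k : ℕ} (α : V [⋀^Fin k]→L[ℝ] A) (θ : V →L[ℝ] A) : V [⋀^Fin (k + 1)]→L[ℝ] A :=
  { AlternatingMap.alternatizeUncurryFin (wedgeAux α θ) with
    cont := by
      have h : Continuous fun v : Fin (k + 1) → V =>
          ∑ i : Fin (k + 1), (-1) ^ (k + (i : ℕ)) * θ (v i) * α (i.removeNth v) := by
        refine continuous_finsetSum Finset.univ fun i _ => ?_
        have h1 : Continuous fun v : Fin (k + 1) → V => θ (v i) :=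
          θ.continuous.comp (continuous_apply i)
        have h2 : Continuous fun v : Fin (k + 1) → V => i.removeNth v :=
          continuous_pi fun j => continuous_apply (i.succAbove j)
        exact (continuous_const.mul h1).mul (α.cont.comp h2)
      exact h.congr fun v => (alternatize_wedgeAux_apply α θ v).symm }

/-- `(α ∧ θ) (v₀, …, v_k) = ∑ i, (-1) ^ (k + i) θ (vᵢ) α (v₀, …, v̂ᵢ, …, v_k)`. -/
theorem wedge_apply {k : ℕ} (α : V [⋀^Fin k]→L[ℝ] A) (θ : V →L[ℝ] A) (v : Fin (k + 1) → V) :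
    wedge α θ v = ∑ i : Fin (k + 1), (-1) ^ (k + (i : ℕ)) * θ (v i) * α (i.removeNth v) := 
  alternatize_wedgeAux_apply α θ v

/-- A covector, seen as an alternating form of degree one. -/
def oneForm (θ : V →L[ℝ] A) : V [⋀^Fin 1]→L[ℝ] A :=
  ContinuousAlternatingMap.ofSubsingleton ℝ V A (0 : Fin 1) θ

/-- `θ₁ ∧ θ₂`. -/
def w2 (θ₁ θ₂ : V →L[ℝ] A) : V [⋀^Fin 2]→L[ℝ] A := wedge (oneForm θ₁) θ₂

/-- `θ₁ ∧ θ₂ ∧ θ₃`. -/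
def w3 (θ₁ θ₂ θ₃ : V →L[ℝ] A) : V [⋀^Fin 3]→L[ℝ] A := wedge (w2 θ₁ θ₂) θ₃

/-- `θ₁ ∧ θ₂ ∧ θ₃ ∧ θ₄`. -/
def w4 (θ₁ θ₂ θ₃ θ₄ : V →L[ℝ] A) : V [⋀^Fin 4]→L[ℝ] A := wedge (w3 θ₁ θ₂ θ₃) θ₄

/-- The complex covector `θ₁ + i θ₂`. -/
def cCovector (θ₁ θ₂ : V →L[ℝ] ℝ) : V →L[ℝ] ℂ :=
  Complex.ofRealCLM.comp θ₁ + Complex.I • Complex.ofRealCLM.comp θ₂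

/-- The complex form `α + i β`. -/
def cForm {k : ℕ} (α β : V [⋀^Fin k]→L[ℝ] ℝ) : V [⋀^Fin k]→L[ℝ] ℂ :=
  Complex.ofRealCLM.compContinuousAlternatingMap α +
    Complex.I • Complex.ofRealCLM.compContinuousAlternatingMap β

/-- The covectors `e` (with indices shifted by one) are a basis of the dual of a `7`-dimensional
space in which `(om, η, ψ)` has the standard form
`om = e¹² + e³⁴ + e⁵⁶`, `η = e⁷`, `ψ = (e¹ + i e²) ∧ (e³ + i e⁴) ∧ (e⁵ + i e⁶)`. -/
structure IsSU3Coframe (om : V [⋀^Fin 2]→L[ℝ] ℝ) (η : V →L[ℝ] ℝ) (ψ : V [⋀^Fin 3]→L[ℝ] ℂ)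
    (e : Fin 7 → V →L[ℝ] ℝ) : Prop where
  linearIndependent : LinearIndependent ℝ e
  omega_eq : om = w2 (e 0) (e 1) + w2 (e 2) (e 3) + w2 (e 4) (e 5)
  eta_eq : η = e 6
  psi_eq : ψ = w3 (cCovector (e 0) (e 1)) (cCovector (e 2) (e 3)) (cCovector (e 4) (e 5))

/-- The complex coordinates `(E¹ + i E², E³ + i E⁴, E⁵ + i E⁶, E⁷ + i E⁸)` (with the indices of `E`
shifted by one). -/
def zCoord (E : Fin 8 → V →L[ℝ] ℝ) : Fin 4 → V →L[ℝ] ℂ :=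
  ![cCovector (E 0) (E 1), cCovector (E 2) (E 3), cCovector (E 4) (E 5), cCovector (E 6) (E 7)]

/-- The covectors `E` are an orthonormal basis of the dual of an `8`-dimensional Euclidean space
with inner product `g`, in which `(om, ψ)` has the standard form
`om = E¹² + E³⁴ + E⁵⁶ + E⁷⁸`, `ψ = (E¹ + i E²) ∧ (E³ + i E⁴) ∧ (E⁵ + i E⁶) ∧ (E⁷ + i E⁸)`. -/
structure IsSU4Coframe (g : V →L[ℝ] V →L[ℝ] ℝ) (om : V [⋀^Fin 2]→L[ℝ] ℝ)
    (ψ : V [⋀^Fin 4]→L[ℝ] ℂ) (E : Fin 8 → V →L[ℝ] ℝ) : Prop where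
  linearIndependent : LinearIndependent ℝ E
  orthonormal : ∀ v w, g v w = ∑ i, E i v * E i w
  omega_eq : om = w2 (E 0) (E 1) + w2 (E 2) (E 3) + w2 (E 4) (E 5) + w2 (E 6) (E 7)
  psi_eq : ψ = w4 (zCoord E 0) (zCoord E 1) (zCoord E 2) (zCoord E 3)

/-- In the complex coordinates attached to the coframe `E`, the endomorphism `P` acts by a matrix
of `SU(4)`. -/
def ActsBySU4 (E : Fin 8 → V →L[ℝ] ℝ) (P : V →L[ℝ] V) : Prop :=
  ∃ U ∈ Matrix.specialUnitaryGroup (Fin 4) ℂ,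
    ∀ (v : V) (j : Fin 4), zCoord E j (P v) = ∑ k, U j k * zCoord E k v

end ExteriorAlgebra

/-! ### Differential forms on a manifold without boundary -/

section Forms

variable {E : Type*} [NormedAddCommGroup E] [NormedSpace ℝ E]
  {H : Type*} [TopologicalSpace H] (I : ModelWithCorners ℝ E H)
  {M : Type*} [TopologicalSpace M] [ChartedSpace H M]
  {A : Type*} [NormedAddCommGroup A] [NormedSpace ℝ A] {k : ℕ}

/-- The expression of a differential form in the preferred chart at `x₀`, i.e. its pullback by the
inverse of the chart. -/
def formInChart (α : (x : M) → TangentSpace I x [⋀^Fin k]→L[ℝ] A) (x₀ : M) :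
    E → E [⋀^Fin k]→L[ℝ] A := fun y =>
  (α ((extChartAt I x₀).symm y)).compContinuousLinearMap
    (mfderiv 𝓘(ℝ, E) I (extChartAt I x₀).symm y)

/-- A differential form is smooth if its expressions in charts are smooth. -/
def IsSmoothForm (α : (x : M) → TangentSpace I x [⋀^Fin k]→L[ℝ] A) : Prop :=
  ∀ x₀ : M, ContDiffOn ℝ ∞ (formInChart I α x₀) (extChartAt I x₀).target

/-- The exterior derivative of a differential form on a manifold without boundary: at the point `x`,
it is the pullback by the preferred chart at `x` of the exterior derivative of the form in this
chart. -/
def dForm [I.Boundaryless] (α : (x : M) → TangentSpace I x [⋀^Fin k]→L[ℝ] A) :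
    (x : M) → TangentSpace I x [⋀^Fin (k + 1)]→L[ℝ] A := fun x =>
  ContinuousAlternatingMap.compContinuousLinearMap
    (extDeriv (formInChart I α x) (extChartAt I x x))
    (mfderiv I 𝓘(ℝ, E) (extChartAt I x) x)

end Forms

/-! ### Levi-Civita connection, curvature, holonomy -/

section Riemannian

open Bundle

variable {E : Type*} [NormedAddCommGroup E] [NormedSpace ℝ E]
  {H : Type*} [TopologicalSpace H] {I : ModelWithCorners ℝ E H}
  {M : Type*} [TopologicalSpace M] [ChartedSpace H M] [IsManifold I ∞ M]

/-- The connection `cov` is the Levi-Civita connection of the Riemannian metric `g`: it is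
torsion-free and metric. Recall that `cov Y x v` is `(∇_v Y) (x)`. -/
structure IsLeviCivita (g : ContMDiffRiemannianMetric I ∞ E (TangentSpace I : M → Type _))
    (cov : CovariantDerivative I E (TangentSpace I : M → Type _)) : Prop where
  torsion_free : ∀ (X Y : (x : M) → TangentSpace I x) (x : M),
    MDiffAt (T% X) x → MDiffAt (T% Y) x →
    cov Y x (X x) - cov X x (Y x) = VectorField.mlieBracket I X Y x
  metric : ∀ (Y Z : (x : M) → TangentSpace I x) (x : M) (v : TangentSpace I x),
    MDiffAt (T% Y) x → MDiffAt (T% Z) x →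
    mfderiv I 𝓘(ℝ, ℝ) (fun y => g.inner y (Y y) (Z y)) x v =
      g.inner x (cov Y x v) (Z x) + g.inner x (Y x) (cov Z x v)

/-- The curvature of the connection `cov` vanishes:
`∇_X ∇_Y Z - ∇_Y ∇_X Z - ∇_[X,Y] Z = 0` at `x`, for all vector fields smooth near `x`. -/
def IsFlat (cov : CovariantDerivative I E (TangentSpace I : M → Type _)) : Prop :=
  ∀ (X Y Z : (x : M) → TangentSpace I x) (x : M),
    CMDiffAt ∞ (T% X) x → CMDiffAt ∞ (T% Y) x → CMDiffAt ∞ (T% Z) x →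
    cov (fun y => cov Z y (Y y)) x (X x) - cov (fun y => cov Z y (X y)) x (Y x)
      - cov Z x (VectorField.mlieBracket I X Y x) = 0

/-- The vector field `V` along the smooth curve `γ` is parallel. At each `s`, in the local
trivialization `e` of the tangent bundle at `γ s`, this says that
`dV̂/ds = - ∑ V̂^k ∇_{γ'(s)} ∂_k`, where `V̂` are the components of `V` and `∂_k` the constant sections
in this trivialization. -/
def IsParallelAlong (cov : CovariantDerivative I E (TangentSpace I : M → Type _)) (γ : ℝ → M)
    (V : (s : ℝ) → TangentSpace I (γ s)) : Prop :=
  ∀ s : ℝ,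
    let e := trivializationAt E (TangentSpace I : M → Type _) (γ s)
    HasDerivAt (fun r => (e ⟨γ r, V r⟩).2)
      (-(e ⟨γ s, cov (fun y => e.symm y (e ⟨γ s, V s⟩).2) (γ s)
        (mfderiv 𝓘(ℝ, ℝ) I γ s (1 : ℝ))⟩).2) s

/-- `IsTransport cov x y P`: the linear map `P : T_x M → T_y M` is the parallel transport along some
piecewise smooth path from `x` to `y`, i.e. along a concatenation of smooth paths. (Every smooth
path on `[0, 1]` extends, after a reparametrization outside `[0, 1]`, to a smooth path defined on
`ℝ`. Inverses correspond to reversed paths.) -/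
inductive IsTransport (cov : CovariantDerivative I E (TangentSpace I : M → Type _)) :
    (x y : M) → (TangentSpace I x →L[ℝ] TangentSpace I y) → Prop
  | path (γ : ℝ → M) (hγ : ContMDiff 𝓘(ℝ, ℝ) I ∞ γ)
      (P : TangentSpace I (γ 0) →L[ℝ] TangentSpace I (γ 1))
      (hP : ∀ v : TangentSpace I (γ 0), ∃ V : (s : ℝ) → TangentSpace I (γ s),
        IsParallelAlong cov γ V ∧ V 0 = v ∧ V 1 = P v) :
      IsTransport cov (γ 0) (γ 1) P
  | refl (x : M) : IsTransport cov x x (ContinuousLinearMap.id ℝ (TangentSpace I x))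
  | symm {x y : M} (P : TangentSpace I x →L[ℝ] TangentSpace I y)
      (Q : TangentSpace I y →L[ℝ] TangentSpace I x) (hPQ : P.comp Q = ContinuousLinearMap.id ℝ _)
      (hQP : Q.comp P = ContinuousLinearMap.id ℝ _) (hP : IsTransport cov x y P) :
      IsTransport cov y x Q
  | trans {x y z : M} (P : TangentSpace I x →L[ℝ] TangentSpace I y)
      (Q : TangentSpace I y →L[ℝ] TangentSpace I z) (hP : IsTransport cov x y P)
      (hQ : IsTransport cov y z Q) : IsTransport cov x z (Q.comp P)

/-- The holonomy group at `x`, as a subgroup of the topological group `GL(T_x M)`. -/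
def holonomy (cov : CovariantDerivative I E (TangentSpace I : M → Type _)) (x : M) :
    Subgroup (TangentSpace I x →L[ℝ] TangentSpace I x)ˣ where
  carrier := {P | IsTransport cov x x (P : TangentSpace I x →L[ℝ] TangentSpace I x)}
  mul_mem' := fun hP hQ => IsTransport.trans _ _ hQ hP
  one_mem' := IsTransport.refl x
  inv_mem' := fun {P} hP => IsTransport.symm _ _ P.mul_inv P.inv_mul hP

/-- The Lie algebra of the holonomy group at `x`: the endomorphisms of `T_x M` which generate a
one-parameter subgroup of the holonomy group (`TangentSpace I x` is by definition the model space `E`). -/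
def holonomyAlgebra (cov : CovariantDerivative I E (TangentSpace I : M → Type _)) (x : M) :
    Set (TangentSpace I x →L[ℝ] TangentSpace I x) :=
  {X | ∀ s : ℝ, ∃ P ∈ holonomy cov x,
    (P : TangentSpace I x →L[ℝ] TangentSpace I x) = (let Y : E →L[ℝ] E := X; NormedSpace.exp (s • Y))}

end Riemannian

/-! ### Quotient manifolds -/

section Quot

open MulAction

/-- The quotient of a smooth manifold by a free, properly discontinuous, smooth action is a smooth
manifold (for the charts obtained by composing charts with local inverses of the projection). -/
theorem isManifold_quotient {M : Type*} [TopologicalSpace M]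
    {Γ : Type*} [Group Γ] [MulAction Γ M]
    [ProperlyDiscontinuousSMul Γ M] [ContinuousConstSMul Γ M] [IsCancelSMul Γ M]
    [T2Space M] [LocallyCompactSpace M]
    {E : Type*} [NormedAddCommGroup E] [NormedSpace ℝ E]
    {H : Type*} [TopologicalSpace H] [ChartedSpace H M] (I : ModelWithCorners ℝ E H)
    [IsManifold I ∞ M] (h : ∀ γ : Γ, ContMDiff I I ∞ (fun x : M => γ • x)) :
    IsManifold I ∞ (orbitRel.Quotient Γ M) := by
  have hl : IsLocalHomeomorph (Quotient.mk (orbitRel Γ M)) :=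
    isQuotientCoveringMap_quotientMk_of_properlyDiscontinuousSMul.isCoveringMap.isLocalHomeomorph
  have key : ∀ x y : M, Quotient.mk (orbitRel Γ M) y ∈ (hl.localInverseAt x).source →
      ContMDiffAt I I ∞ (fun z => hl.localInverseAt x (Quotient.mk (orbitRel Γ M) z)) y := by
    intro x y hy
    have h1 : Quotient.mk (orbitRel Γ M) (hl.localInverseAt x (Quotient.mk _ y))
        = Quotient.mk (orbitRel Γ M) y := hl.apply_localInverseAt_of_mem hy
    obtain ⟨γ, hγ⟩ := Quotient.exact h1
    refine (h γ y).congr_of_eventuallyEq ?_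
    have o1 : ∀ᶠ z in 𝓝 y, Quotient.mk (orbitRel Γ M) z ∈ (hl.localInverseAt x).source :=
      hl.continuous.continuousAt.eventually ((hl.localInverseAt x).open_source.mem_nhds hy)
    have o2 : ∀ᶠ z in 𝓝 y, γ • z ∈ (hl.localInverseAt x).target := by
      refine (continuous_const_smul γ).continuousAt.eventually
        ((hl.localInverseAt x).open_target.mem_nhds ?_)
      have : γ • y = hl.localInverseAt x (Quotient.mk _ y) := hγ
      simp only [this]
      exact (hl.localInverseAt x).map_source hy
    filter_upwards [o1, o2] with z hz1 hz2
    refine hl.injOn_localInverseAt_target ((hl.localInverseAt x).map_source hz1) hz2 ?_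
    rw [hl.apply_localInverseAt_of_mem hz1]
    exact (Quotient.sound ⟨γ, rfl⟩ : Quotient.mk (orbitRel Γ M) (γ • z) = _).symm
  apply isManifold_of_contDiffOn
  rintro e e' he he'
  obtain ⟨x, rfl⟩ : ∃ x : M, e = (hl.localInverseAt x).trans (chartAt H x) := by
    obtain ⟨q, rfl⟩ := he
    exact ⟨_, rfl⟩
  obtain ⟨x', rfl⟩ : ∃ x : M, e' = (hl.localInverseAt x).trans (chartAt H x) := by
    obtain ⟨q, rfl⟩ := he'
    exact ⟨_, rfl⟩
  rintro p ⟨hp, hpr⟩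
  simp only [Set.mem_preimage, OpenPartialHomeomorph.trans_source,
    OpenPartialHomeomorph.trans_symm_eq_symm_trans_symm, Set.mem_inter_iff,
    OpenPartialHomeomorph.symm_source, OpenPartialHomeomorph.coe_trans, Function.comp_apply,
    IsLocalHomeomorph.localInverseAt_symm] at hp
  obtain ⟨⟨hp1, hp2⟩, hp3, hp4⟩ := hp
  have c1 : ContMDiffWithinAt 𝓘(ℝ, E) I ∞ (extChartAt I x).symm (Set.range I) p :=
    contMDiffWithinAt_extChartAt_symm_range x ((extChartAt_target I x).symm ▸ ⟨hp1, hpr⟩)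
  have c2 := (key x' ((chartAt H x).symm (I.symm p)) hp3).contMDiffWithinAt (s := Set.univ)
  have c3 : ContMDiffAt I 𝓘(ℝ, E) ∞ (extChartAt I x') (hl.localInverseAt x'
      (Quotient.mk (orbitRel Γ M) ((chartAt H x).symm (I.symm p)))) :=
    contMDiffAt_extChartAt' hp4
  have c4 := c2.comp p c1 (Set.mapsTo_univ _ _)
  have c5 := (c3.comp_contMDiffWithinAt p c4).contDiffWithinAt
  refine (c5.mono Set.inter_subset_right).congr (fun y _ => ?_) ?_ <;>
  simp [OpenPartialHomeomorph.trans_symm_eq_symm_trans_symm]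
end Quot

/-! ### The group `SU(2) ⋉ ℍ` -/

/-- The Lie group `SU(2) ⋉ ℍ`, where `SU(2)` is the group of unit quaternions. -/
def G : Type := Metric.sphere (0 : ℍ[ℝ]) 1 × ℍ[ℝ]

instance finrank_quaternion : Fact (Module.finrank ℝ ℍ[ℝ] = 3 + 1) :=
  ⟨by rw [Quaternion.finrank_eq_four]⟩

/-- The model with corners of `SU(2) ⋉ ℍ`, with the standard smooth structure of `S³ × ℝ⁴`. -/
abbrev IG := (𝓡 3).prod 𝓘(ℝ, ℍ[ℝ])

/-- The model space of `SU(2) ⋉ ℍ`. -/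
abbrev HG := ModelProd (EuclideanSpace ℝ (Fin 3)) ℍ[ℝ]

/-- The model vector space of `SU(2) ⋉ ℍ`. -/
abbrev EG := EuclideanSpace ℝ (Fin 3) × ℍ[ℝ]

namespace G

/-- The `SU(2)` component. -/
def rot (x : G) : Metric.sphere (0 : ℍ[ℝ]) 1 := Prod.fst x

/-- The `ℍ` component. -/
def trans (x : G) : ℍ[ℝ] := Prod.snd x

/-- The element `(A, q)`. -/
def mk (A : Metric.sphere (0 : ℍ[ℝ]) 1) (q : ℍ[ℝ]) : G := (A, q)

@[simp] theorem rot_mk (A : Metric.sphere (0 : ℍ[ℝ]) 1) (q : ℍ[ℝ]) : (mk A q).rot = A := rfl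

@[simp] theorem trans_mk (A : Metric.sphere (0 : ℍ[ℝ]) 1) (q : ℍ[ℝ]) : (mk A q).trans = q := rfl

@[ext] theorem ext {x y : G} (h : x.rot = y.rot) (h' : x.trans = y.trans) : x = y := Prod.ext h h'

instance : TopologicalSpace G :=
  inferInstanceAs (TopologicalSpace (Metric.sphere (0 : ℍ[ℝ]) 1 × ℍ[ℝ]))

instance : T2Space G := inferInstanceAs (T2Space (Metric.sphere (0 : ℍ[ℝ]) 1 × ℍ[ℝ]))

instance : LocallyCompactSpace G :=
  inferInstanceAs (LocallyCompactSpace (Metric.sphere (0 : ℍ[ℝ]) 1 × ℍ[ℝ]))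

instance : ChartedSpace HG G :=
  inferInstanceAs (ChartedSpace HG (Metric.sphere (0 : ℍ[ℝ]) 1 × ℍ[ℝ]))

instance : IsManifold IG ∞ G :=
  inferInstanceAs (IsManifold IG ∞ (Metric.sphere (0 : ℍ[ℝ]) 1 × ℍ[ℝ]))

/-- `(A, q) * (A', q') = (A A', A q' + q)`. -/
instance : Mul G := ⟨fun x y => mk (x.rot * y.rot) ((x.rot : ℍ[ℝ]) * y.trans + x.trans)⟩

instance : One G := ⟨mk 1 0⟩

instance : Inv G := ⟨fun x => mk x.rot⁻¹ (-((x.rot⁻¹ : Metric.sphere (0 : ℍ[ℝ]) 1) * x.trans))⟩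

@[simp] theorem rot_mul (x y : G) : (x * y).rot = x.rot * y.rot := rfl

@[simp] theorem trans_mul (x y : G) : (x * y).trans = (x.rot : ℍ[ℝ]) * y.trans + x.trans := rfl

@[simp] theorem rot_one : (1 : G).rot = 1 := rfl

@[simp] theorem trans_one : (1 : G).trans = 0 := rfl

@[simp] theorem rot_inv (x : G) : x⁻¹.rot = x.rot⁻¹ := rfl

@[simp] theorem trans_inv (x : G) :
    x⁻¹.trans = -((x.rot⁻¹ : Metric.sphere (0 : ℍ[ℝ]) 1) * x.trans) := rfl

instance : Group G := Group.ofLeftAxioms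
  (fun x y z => by ext1 <;> simp [mul_assoc, mul_add, add_assoc])
  (fun x => by ext1 <;> simp)
  (fun x => by ext1 <;> simp)

theorem continuous_rot : Continuous rot := continuous_fst

theorem continuous_trans : Continuous trans := continuous_snd

instance : IsTopologicalGroup G where
  continuous_mul := by
    have h1 : Continuous fun p : G × G => p.1.rot := continuous_rot.comp continuous_fst
    have h2 : Continuous fun p : G × G => p.1.trans := continuous_trans.comp continuous_fst
    have h3 : Continuous fun p : G × G => p.2.rot := continuous_rot.comp continuous_snd
    have h4 : Continuous fun p : G × G => p.2.trans := continuous_trans.comp continuous_snd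
    exact (h1.mul h3).prodMk (((continuous_subtype_val.comp h1).mul h4).add h2)
  continuous_inv := by
    exact continuous_rot.inv.prodMk
      ((continuous_subtype_val.comp continuous_rot.inv).mul continuous_trans).neg

theorem contMDiff_rot : ContMDiff IG (𝓡 3) ∞ rot := contMDiff_fst

theorem contMDiff_trans : ContMDiff IG 𝓘(ℝ, ℍ[ℝ]) ∞ trans := contMDiff_snd

theorem contMDiff_mul_left (x : G) : ContMDiff IG IG ∞ (fun y : G => x * y) := by
  have hL : ContMDiff 𝓘(ℝ, ℍ[ℝ]) 𝓘(ℝ, ℍ[ℝ]) ∞ (fun q : ℍ[ℝ] => (x.rot : ℍ[ℝ]) * q) :=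
    (ContinuousLinearMap.mul ℝ ℍ[ℝ] (x.rot : ℍ[ℝ])).contDiff.contMDiff
  have h3 : ContMDiff IG (𝓡 3) ∞ (fun p : G => x.rot * p.rot) := by
    have : ContMDiff IG 𝓘(ℝ, ℍ[ℝ]) ∞ (fun p : G => (x.rot : ℍ[ℝ]) * (p.rot : ℍ[ℝ])) :=
      hL.comp (contMDiff_coe_sphere.comp contMDiff_rot)
    exact this.codRestrict_sphere (fun p => by simp)
  have h4 : ContMDiff IG 𝓘(ℝ, ℍ[ℝ]) ∞ (fun p : G => (x.rot : ℍ[ℝ]) * p.trans + x.trans) :=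
    (hL.comp contMDiff_trans).add contMDiff_const
  exact h3.prodMk h4

end G

/-! ### The discrete subgroup and the compact quotient -/

/-- The unit quaternion `e^{iβ} = cos β + i sin β`, corresponding to `diag (e^{iβ}, e^{-iβ})` under
the identification of `SU(2)` with the unit quaternions. -/
def rotA (β : ℝ) : Metric.sphere (0 : ℍ[ℝ]) 1 :=
  ⟨((Complex.exp (β * Complex.I) : ℂ) : ℍ[ℝ]), by
    have h1 := Complex.norm_exp_ofReal_mul_I β
    have h2 : ‖((Complex.exp (β * Complex.I) : ℂ) : ℍ[ℝ])‖ * ‖((Complex.exp (β * Complex.I) : ℂ) : ℍ[ℝ])‖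
        = Complex.normSq (Complex.exp (β * Complex.I)) := by
      rw [← Quaternion.normSq_eq_norm_mul_self, Quaternion.normSq_def', Complex.normSq_apply]
      simp [sq]
    rw [Complex.normSq_eq_norm_sq, h1] at h2
    rw [mem_sphere_zero_iff_norm]
    nlinarith [norm_nonneg ((Complex.exp (β * Complex.I) : ℂ) : ℍ[ℝ])]⟩

/-- The data defining `Γ_β`: an angle `β` such that `e^{iβ}` is a primitive `p`-th root of unity,
`p` prime, and a lattice `Λ ≅ ℤ⁴` of `ℍ`, stable under left multiplication by `e^{iβ}` (so that
`⟨A_β⟩ ⋉ Λ` makes sense). -/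
structure LatticeData where
  /-- The order of `e^{iβ}`. -/
  p : ℕ
  prime : p.Prime
  /-- The angle. -/
  β : ℝ
  primitive : IsPrimitiveRoot (Complex.exp (β * Complex.I)) p
  /-- The lattice of translations. -/
  Λ : Submodule ℤ ℍ[ℝ]
  discrete : DiscreteTopology Λ
  lattice : IsZLattice ℝ Λ
  stable : ∀ q ∈ Λ, (rotA β : ℍ[ℝ]) * q ∈ Λ

namespace LatticeData

variable (D : LatticeData)

theorem rotA_pow : rotA D.β ^ D.p = 1 := by
  apply Subtype.ext
  have := D.primitive.pow_eq_one
  simp only [rotA, Metric.unitSphere.coe_pow, Metric.unitSphere.coe_one]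
  rw [← Quaternion.coeComplex_one, ← this]
  exact (map_pow Quaternion.ofComplex _ _).symm

theorem stable_pow (n : ℕ) {q : ℍ[ℝ]} (hq : q ∈ D.Λ) :
    ((rotA D.β ^ n : Metric.sphere (0 : ℍ[ℝ]) 1) : ℍ[ℝ]) * q ∈ D.Λ := by
  induction n with
  | zero => simpa using hq
  | succ n ih =>
    rw [pow_succ', Metric.unitSphere.coe_mul, mul_assoc]
    exact D.stable _ ih

theorem isOfFinOrder_rotA : IsOfFinOrder (rotA D.β) :=
  isOfFinOrder_iff_pow_eq_one.2 ⟨D.p, D.prime.pos, D.rotA_pow⟩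

theorem stable_of_mem {A : Metric.sphere (0 : ℍ[ℝ]) 1} (hA : A ∈ Subgroup.zpowers (rotA D.β))
    {q : ℍ[ℝ]} (hq : q ∈ D.Λ) : (A : ℍ[ℝ]) * q ∈ D.Λ := by
  obtain ⟨n, rfl⟩ := D.isOfFinOrder_rotA.mem_powers_iff_mem_zpowers.2 hA
  exact D.stable_pow n hq

/-- The discrete subgroup `Γ_β = ⟨A_β⟩ ⋉ Λ` of `SU(2) ⋉ ℍ`. -/
def Γ : Subgroup G where
  carrier := {x | x.rot ∈ Subgroup.zpowers (rotA D.β) ∧ x.trans ∈ D.Λ}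
  mul_mem' := fun hx hy =>
    ⟨mul_mem hx.1 hy.1, add_mem (D.stable_of_mem hx.1 hy.2) hx.2⟩
  one_mem' := ⟨one_mem _, zero_mem _⟩
  inv_mem' := fun hx =>
    ⟨inv_mem hx.1, neg_mem (D.stable_of_mem (inv_mem hx.1) hx.2)⟩

instance : ProperlyDiscontinuousSMul D.Γ G := by
  apply Subgroup.properlyDiscontinuousSMul_of_tendsto_cofinite
  rw [Filter.hasBasis_cocompact.tendsto_right_iff]
  intro K hK
  rw [Filter.eventually_cofinite]
  simp only [Set.mem_compl_iff, not_not]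
  have := D.discrete
  have f1 : (Subgroup.zpowers (rotA D.β) : Set (Metric.sphere (0 : ℍ[ℝ]) 1)).Finite :=
    D.isOfFinOrder_rotA.finite_zpowers
  have hcl : IsClosed (D.Λ : Set ℍ[ℝ]) :=
    AddSubgroup.isClosed_of_discrete (H := D.Λ.toAddSubgroup)
  have f2 : (G.trans '' K ∩ D.Λ : Set ℍ[ℝ]).Finite :=
    Metric.finite_isBounded_inter_isClosed DiscreteTopology.isDiscrete (hK.image G.continuous_trans).isBounded hcl
  refine Set.Finite.of_finite_image (f := fun x : D.Γ => ((x : G).rot, (x : G).trans))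
    ((f1.prod f2).subset ?_) ?_
  · rintro _ ⟨x, hx, rfl⟩
    exact ⟨x.2.1, ⟨x, hx, rfl⟩, x.2.2⟩
  · intro x _ y _ hxy
    simp only [Prod.mk.injEq] at hxy
    exact Subtype.ext (G.ext hxy.1 hxy.2)

/-- The quotient `M_β` of `SU(2) ⋉ ℍ` by the left action of `Γ_β`; the points are the classes
`Γ_β · (A', q')`. -/
abbrev M : Type := MulAction.orbitRel.Quotient D.Γ G

/-- The projection `SU(2) ⋉ ℍ → M_β`. -/
def proj (x : G) : D.M := Quotient.mk _ x

instance : IsManifold IG ∞ D.M :=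
  isManifold_quotient IG (fun γ => G.contMDiff_mul_left (γ : G))


end LatticeData

/-! ### Left-invariant coframe -/

/-- The left-invariant coframe `(e¹, …, e⁷)` on `SU(2) ⋉ ℍ` (with indices shifted by one),
determined by
`A⁻¹ dA = (a / 2) (e⁶ i + e⁴ j + e¹ k)` and `A⁻¹ dq = e² + e³ i - e⁵ j + e⁷ k`.
It is dual to the basis of the Lie algebra satisfying
`de¹ = a e⁴⁶`, `de⁴ = -a e¹⁶`, `de⁶ = a e¹⁴`, `de² = (a/2) (-e³⁶ - e⁴⁵ + e¹⁷)`,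
`de³ = (a/2) (-e¹⁵ + e²⁶ - e⁴⁷)`, `de⁵ = (a/2) (e¹³ - e²⁴ - e⁶⁷)`,
`de⁷ = -(a/2) (e¹² + e³⁴ + e⁵⁶)`. -/
def leftCoframe (a : ℝ) (i : Fin 7) (x : G) : TangentSpace IG x →L[ℝ] ℝ :=
  -- the left-invariant forms `⟨ε, A⁻¹ dA⟩` and `⟨ε, A⁻¹ dq⟩`
  let dA (ε : ℍ[ℝ]) : TangentSpace IG x →L[ℝ] ℝ :=
    (innerSL ℝ ε).comp ((ContinuousLinearMap.mul ℝ ℍ[ℝ] (x.rot : ℍ[ℝ])⁻¹).comp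
      (mfderiv IG 𝓘(ℝ, ℍ[ℝ]) (fun y : G => (y.rot : ℍ[ℝ])) x))
  let dq (ε : ℍ[ℝ]) : TangentSpace IG x →L[ℝ] ℝ :=
    (innerSL ℝ ε).comp ((ContinuousLinearMap.mul ℝ ℍ[ℝ] (x.rot : ℍ[ℝ])⁻¹).comp
      (mfderiv IG 𝓘(ℝ, ℍ[ℝ]) (fun y : G => y.trans) x))
  ![(2 / a) • dA ⟨0, 0, 0, 1⟩, dq ⟨1, 0, 0, 0⟩, dq ⟨0, 1, 0, 0⟩, (2 / a) • dA ⟨0, 0, 1, 0⟩,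
    -dq ⟨0, 0, 1, 0⟩, (2 / a) • dA ⟨0, 1, 0, 0⟩, dq ⟨0, 0, 0, 1⟩] i

/-- `e` is the coframe on `M_β` induced by the left-invariant coframe: its pullback by the
projection is the left-invariant coframe. -/
def IsInducedCoframe (D : LatticeData) (a : ℝ)
    (e : Fin 7 → (y : D.M) → TangentSpace IG y →L[ℝ] ℝ) : Prop :=
  ∀ (i : Fin 7) (x : G), (e i (D.proj x)).comp (mfderiv IG IG D.proj x) = leftCoframe a i x

/-! ### The families of forms on `M_β` -/

section Families

variable {V : Type*} [AddCommGroup V] [Module ℝ V] [TopologicalSpace V]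

/-- `ω = u v (e¹² + e³⁴ + e⁵⁶)`. -/
def omegaForm (u v : ℝ) (e : Fin 7 → V →L[ℝ] ℝ) : V [⋀^Fin 2]→L[ℝ] ℝ :=
  (u * v) • (w2 (e 0) (e 1) + w2 (e 2) (e 3) + w2 (e 4) (e 5))

/-- `ψ₊ = u v² (e¹³⁵ - e²³⁶ - e²⁴⁵) - u³ e¹⁴⁶`. -/
def psiPlus (u v : ℝ) (e : Fin 7 → V →L[ℝ] ℝ) : V [⋀^Fin 3]→L[ℝ] ℝ :=
  (u * v ^ 2) • (w3 (e 0) (e 2) (e 4) - w3 (e 1) (e 2) (e 5) - w3 (e 1) (e 3) (e 4))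
    - u ^ 3 • w3 (e 0) (e 3) (e 5)

/-- `ψ₋ = u² v (e¹³⁶ + e¹⁴⁵ - e²⁴⁶) + v³ e²³⁵`. -/
def psiMinus (u v : ℝ) (e : Fin 7 → V →L[ℝ] ℝ) : V [⋀^Fin 3]→L[ℝ] ℝ :=
  (u ^ 2 * v) • (w3 (e 0) (e 2) (e 5) + w3 (e 0) (e 3) (e 4) - w3 (e 1) (e 3) (e 5))
    + v ^ 3 • w3 (e 1) (e 2) (e 4)

/-- `η = v⁻³ e⁷`. -/
def etaForm (v : ℝ) (e : Fin 7 → V →L[ℝ] ℝ) : V →L[ℝ] ℝ := (1 / v ^ 3) • e 6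

end Families

section Structures

variable {E : Type*} [NormedAddCommGroup E] [NormedSpace ℝ E]
  {H : Type*} [TopologicalSpace H] (I : ModelWithCorners ℝ E H) [I.Boundaryless]
  {M : Type*} [TopologicalSpace M] [ChartedSpace H M]

/-- `(ω, η, ψ₊ + i ψ₋)` is an `SU(3)`-structure on a `7`-manifold. -/
structure IsSU3Structure (om : (x : M) → TangentSpace I x [⋀^Fin 2]→L[ℝ] ℝ)
    (η : (x : M) → TangentSpace I x →L[ℝ] ℝ)
    (ψp ψm : (x : M) → TangentSpace I x [⋀^Fin 3]→L[ℝ] ℝ) : Prop where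
  smooth_omega : IsSmoothForm I om
  smooth_eta : IsSmoothForm I (fun x => oneForm (η x))
  smooth_psiPlus : IsSmoothForm I ψp
  smooth_psiMinus : IsSmoothForm I ψm
  exists_coframe : ∀ x : M, ∃ e : Fin 7 → TangentSpace I x →L[ℝ] ℝ,
    IsSU3Coframe (om x) (η x) (cForm (ψp x) (ψm x)) e

/-- The `SU(3)`-structure satisfies `dω = 0` and `d(ψ± ∧ η) = 0`. -/
structure IsHypo (om : (x : M) → TangentSpace I x [⋀^Fin 2]→L[ℝ] ℝ)
    (η : (x : M) → TangentSpace I x →L[ℝ] ℝ)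
    (ψp ψm : (x : M) → TangentSpace I x [⋀^Fin 3]→L[ℝ] ℝ) : Prop where
  d_omega : dForm I om = 0
  d_psiPlus_eta : dForm I (fun x => wedge (ψp x) (η x)) = 0
  d_psiMinus_eta : dForm I (fun x => wedge (ψm x) (η x)) = 0

/-- The evolution equations, for a family depending on `t ∈ J`:
`∂ₜ ω = -dη`, `∂ₜ (ψ₊ ∧ η) = dψ₋`, `∂ₜ (ψ₋ ∧ η) = -dψ₊`. -/
structure SolvesEvolution (J : Set ℝ) (om : ℝ → (x : M) → TangentSpace I x [⋀^Fin 2]→L[ℝ] ℝ)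
    (η : ℝ → (x : M) → TangentSpace I x →L[ℝ] ℝ)
    (ψp ψm : ℝ → (x : M) → TangentSpace I x [⋀^Fin 3]→L[ℝ] ℝ) : Prop where
  deriv_omega : ∀ t ∈ J, ∀ (x : M) (v : Fin 2 → TangentSpace I x),
    HasDerivAt (fun s => om s x v) (-dForm I (fun y => oneForm (η t y)) x v) t
  deriv_psiPlus_eta : ∀ t ∈ J, ∀ (x : M) (v : Fin 4 → TangentSpace I x),
    HasDerivAt (fun s => wedge (ψp s x) (η s x) v) (dForm I (ψm t) x v) t
  deriv_psiMinus_eta : ∀ t ∈ J, ∀ (x : M) (v : Fin 4 → TangentSpace I x),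
    HasDerivAt (fun s => wedge (ψm s x) (η s x) v) (-dForm I (ψp t) x v) t

/-- `(g, ω, ψ)` is an `SU(4)`-structure on an `8`-manifold. -/
structure IsSU4Structure [IsManifold I ∞ M]
    (g : Bundle.ContMDiffRiemannianMetric I ∞ E (TangentSpace I : M → Type _))
    (om : (x : M) → TangentSpace I x [⋀^Fin 2]→L[ℝ] ℝ)
    (ψ : (x : M) → TangentSpace I x [⋀^Fin 4]→L[ℝ] ℂ) : Prop where
  smooth_omega : IsSmoothForm I om
  smooth_psi : IsSmoothForm I ψ
  exists_coframe : ∀ x : M, ∃ E : Fin 8 → TangentSpace I x →L[ℝ] ℝ,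
    IsSU4Coframe (g.inner x) (om x) (ψ x) E

end Structures

/-! ### The product with an open interval -/

section Product

variable {E : Type*} [NormedAddCommGroup E] [NormedSpace ℝ E]
  {H : Type*} [TopologicalSpace H] (I : ModelWithCorners ℝ E H)
  {M : Type*} [TopologicalSpace M] [ChartedSpace H M] {b c : ℝ}

/-- The open interval `(b, c)`, as an open submanifold of `ℝ`. -/
def interval (b c : ℝ) : TopologicalSpace.Opens ℝ := ⟨Set.Ioo b c, isOpen_Ioo⟩

/-- The differential of the projection `M × (b, c) → M`. -/
def dpr (p : M × interval b c) : TangentSpace (I.prod 𝓘(ℝ, ℝ)) p →L[ℝ] TangentSpace I p.1 :=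
  mfderiv (I.prod 𝓘(ℝ, ℝ)) I Prod.fst p

/-- The `1`-form `dt` on `M × (b, c)`. -/
def dt (p : M × interval b c) : TangentSpace (I.prod 𝓘(ℝ, ℝ)) p →L[ℝ] ℝ :=
  mfderiv (I.prod 𝓘(ℝ, ℝ)) 𝓘(ℝ, ℝ) (fun q : M × interval b c => (q.2 : ℝ)) p

/-- The `2`-form `ω(t) + η(t) ∧ dt` on `M × (b, c)`. -/
def tildeOmega (om : ℝ → (x : M) → TangentSpace I x [⋀^Fin 2]→L[ℝ] ℝ)
    (η : ℝ → (x : M) → TangentSpace I x →L[ℝ] ℝ) (p : M × interval b c) :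
    TangentSpace (I.prod 𝓘(ℝ, ℝ)) p [⋀^Fin 2]→L[ℝ] ℝ :=
  (om p.2 p.1).compContinuousLinearMap (dpr I p) + w2 ((η p.2 p.1).comp (dpr I p)) (dt I p)

/-- The complex `4`-form `(ψ₊(t) + i ψ₋(t)) ∧ (η(t) + i dt)` on `M × (b, c)`. -/
def tildePsi (ψp ψm : ℝ → (x : M) → TangentSpace I x [⋀^Fin 3]→L[ℝ] ℝ)
    (η : ℝ → (x : M) → TangentSpace I x →L[ℝ] ℝ) (p : M × interval b c) :
    TangentSpace (I.prod 𝓘(ℝ, ℝ)) p [⋀^Fin 4]→L[ℝ] ℂ :=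
  wedge ((cForm (ψp p.2 p.1) (ψm p.2 p.1)).compContinuousLinearMap (dpr I p))
    (cCovector ((η p.2 p.1).comp (dpr I p)) (dt I p))

/-- The coframe `(u e¹, v e², v e³, u e⁴, v e⁵, u e⁶, v⁻³ e⁷, dt)` on `M × (b, c)`, where `u` and `v`
are functions of `t`. -/
def prodCoframe (u v : ℝ → ℝ) (e : Fin 7 → (y : M) → TangentSpace I y →L[ℝ] ℝ)
    (p : M × interval b c) : Fin 8 → TangentSpace (I.prod 𝓘(ℝ, ℝ)) p →L[ℝ] ℝ :=
  ![u p.2 • (e 0 p.1).comp (dpr I p), v p.2 • (e 1 p.1).comp (dpr I p),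
    v p.2 • (e 2 p.1).comp (dpr I p), u p.2 • (e 3 p.1).comp (dpr I p),
    v p.2 • (e 4 p.1).comp (dpr I p), u p.2 • (e 5 p.1).comp (dpr I p),
    (1 / v p.2 ^ 3) • (e 6 p.1).comp (dpr I p), dt I p]

end Product

section CoframeFamilies

variable {E : Type*} [NormedAddCommGroup E] [NormedSpace ℝ E]
  {H : Type*} [TopologicalSpace H] {I : ModelWithCorners ℝ E H}
  {M : Type*} [TopologicalSpace M] [ChartedSpace H M]

/-- The family `ω(t)` attached to a coframe `e` and two functions `u`, `v` of `t`. -/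
def omegaFam (u v : ℝ → ℝ) (e : Fin 7 → (y : M) → TangentSpace I y →L[ℝ] ℝ) (t : ℝ) (y : M) :
    TangentSpace I y [⋀^Fin 2]→L[ℝ] ℝ := omegaForm (u t) (v t) (fun i => e i y)

/-- The family `ψ₊(t)`. -/
def psiPlusFam (u v : ℝ → ℝ) (e : Fin 7 → (y : M) → TangentSpace I y →L[ℝ] ℝ) (t : ℝ) (y : M) :
    TangentSpace I y [⋀^Fin 3]→L[ℝ] ℝ := psiPlus (u t) (v t) (fun i => e i y)

/-- The family `ψ₋(t)`. -/
def psiMinusFam (u v : ℝ → ℝ) (e : Fin 7 → (y : M) → TangentSpace I y →L[ℝ] ℝ) (t : ℝ) (y : M) :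
    TangentSpace I y [⋀^Fin 3]→L[ℝ] ℝ := psiMinus (u t) (v t) (fun i => e i y)

/-- The family `η(t)`. -/
def etaFam (v : ℝ → ℝ) (e : Fin 7 → (y : M) → TangentSpace I y →L[ℝ] ℝ) (t : ℝ) (y : M) :
    TangentSpace I y →L[ℝ] ℝ := etaForm (v t) (fun i => e i y)

/-- The form `ω(t) + η(t) ∧ dt` on `M × (b, c)` attached to a coframe of `M`. -/
def omegaProd (u v : ℝ → ℝ) (e : Fin 7 → (y : M) → TangentSpace I y →L[ℝ] ℝ) {b c : ℝ} :
    (p : M × interval b c) → TangentSpace (I.prod 𝓘(ℝ, ℝ)) p [⋀^Fin 2]→L[ℝ] ℝ :=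
  tildeOmega I (omegaFam u v e) (etaFam v e)

/-- The form `(ψ₊(t) + i ψ₋(t)) ∧ (η(t) + i dt)` on `M × (b, c)` attached to a coframe of `M`. -/
def psiProd (u v : ℝ → ℝ) (e : Fin 7 → (y : M) → TangentSpace I y →L[ℝ] ℝ) {b c : ℝ} :
    (p : M × interval b c) → TangentSpace (I.prod 𝓘(ℝ, ℝ)) p [⋀^Fin 4]→L[ℝ] ℂ :=
  tildePsi I (psiPlusFam u v e) (psiMinusFam u v e) (etaFam v e)

end CoframeFamilies

/-- The model with corners of `M_β × (b, c)`. -/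
abbrev IN := IG.prod 𝓘(ℝ, ℝ)

end MBeta

end

noncomputable section

namespace MBeta

/-! ### Exterior products of covectors -/

section Wedge

variable {V : Type*} [AddCommGroup V] [Module ℝ V] [TopologicalSpace V]
  {V' : Type*} [AddCommGroup V'] [Module ℝ V'] [TopologicalSpace V']
  {A : Type*} [NormedCommRing A] [NormedAlgebra ℝ A]

/-! Everything is pulled back from the flat space `ℍ × ℍ`, viewed as `ℂ⁴`. Let `F((A, q), t) = (r A,
q)` with `r = 2/a + t`. Through `F`, left translation by `(B, l)` becomes the affine map `w ↦ B w +
(0, l)`. Its linear part is left multiplication by a unit quaternion, which lies in `SU(4)` for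
suitable complex coordinates. The standard metric, Kähler form and complex volume form (`flatInner`,
`flatOmega`, `flatPsi`) therefore pull back to invariant tensors and descend to `M_β × (b, c)`. As
`F` is a local diffeomorphism where `r ≠ 0`, the descended structure is flat and integrable. To
recognize it, multiply `dF` by `A⁻¹`, which changes none of these tensors: the result is `(r A⁻¹dA +
dt, A⁻¹dq)`. Here `A⁻¹dA` is purely imaginary because `⟨A, dA⟩ = 0`, and `r a/2 = u`, so the
components are exactly the adapted coframe (`flatCoframe_prodMaurerCartan`).

On a slice of constant `t`, put `S_t(x, q) = (r x, q)`. The forms `ω(t)` and `(ψ₊ + iψ₋) ∧ η` are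
pullbacks by `S_t` of constant forms, hence closed. Contracting the same constant forms with `X = ∂ₜ
S_t` gives `η` and `ψ±`, up to signs and a factor `i`. The evolution equations are then Cartan's
formula `∂ₜ (S_t^* β) = d(S_t^* ι_X β)` for constant `β` (`hasDerivAt_compContinuousLinearMap`).

On the quotient, `F` exists only locally: composing it with local sections of `G → M_β` gives
developing maps, whose transitions have linear parts in the finite group `⟨A_β⟩`
(`LatticeData.flatAtlas`). Differentiating the components of a vector field in a developing map does
not depend on the map chosen. This defines a torsion-free, metric and flat connection
(`FlatAtlas.isLeviCivita_cov`, `FlatAtlas.isFlat_cov`). Parallel fields are constant in developing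
maps up to `⟨A_β⟩`, so the holonomy embeds in a finite group. It is thus discrete, has trivial Lie
algebra, and acts through left multiplications by unit quaternions. -/

theorem oneForm_apply (θ : V →L[ℝ] A) (v : Fin 1 → V) : oneForm θ v = θ (v 0) := rfl

theorem w2_apply (a b : V →L[ℝ] A) (v : Fin 2 → V) :
    w2 a b v = a (v 0) * b (v 1) - a (v 1) * b (v 0) := by
  simp [w2, wedge_apply, oneForm_apply, Fin.sum_univ_succ, Fin.removeNth, Fin.succAbove]
  ring

theorem w3_apply (a b c : V →L[ℝ] A) (v : Fin 3 → V) :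
    w3 a b c v = a (v 0) * b (v 1) * c (v 2) - a (v 1) * b (v 0) * c (v 2)
      - a (v 0) * b (v 2) * c (v 1) + a (v 2) * b (v 0) * c (v 1)
      + a (v 1) * b (v 2) * c (v 0) - a (v 2) * b (v 1) * c (v 0) := by
  simp [w3, wedge_apply, w2_apply, Fin.sum_univ_succ, Fin.removeNth, Fin.succAbove]
  ring

theorem w4_apply (a b c d : V →L[ℝ] A) (v : Fin 4 → V) :
    w4 a b c d v = d (v 3) * w3 a b c ![v 0, v 1, v 2] - d (v 2) * w3 a b c ![v 0, v 1, v 3]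
      + d (v 1) * w3 a b c ![v 0, v 2, v 3] - d (v 0) * w3 a b c ![v 1, v 2, v 3] := by
  simp [w4, wedge_apply, w3_apply, Fin.sum_univ_succ, Fin.removeNth, Fin.succAbove]
  ring

/-- As a determinant, the top exterior product changes under a linear substitution by
multiplicativity of `det`. -/
theorem w4_apply_eq_det (z : Fin 4 → V →L[ℝ] A) (v : Fin 4 → V) :
    w4 (z 0) (z 1) (z 2) (z 3) v = (Matrix.of fun i j => z i (v j)).det := by
  rw [Matrix.det_succ_column_zero]
  simp [w4_apply, w3_apply, Fin.sum_univ_succ, Matrix.det_fin_three, Fin.succAbove]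
  ring

/-- A linear change of the covectors multiplies the top exterior product by the determinant. -/
theorem w4_eq_det_smul (U : Matrix (Fin 4) (Fin 4) A) (z z' : Fin 4 → V →L[ℝ] A)
    (h : ∀ j v, z' j v = ∑ k, U j k * z k v) :
    w4 (z' 0) (z' 1) (z' 2) (z' 3) = U.det • w4 (z 0) (z 1) (z 2) (z 3) := by
  ext v
  rw [w4_apply_eq_det, ContinuousAlternatingMap.smul_apply, w4_apply_eq_det, smul_eq_mul,
    ← Matrix.det_mul]
  congr 1
  ext i j
  simp [Matrix.mul_apply, h]

theorem wedge_comp {k : ℕ} (α : V [⋀^Fin k]→L[ℝ] A) (θ : V →L[ℝ] A) (L : V' →L[ℝ] V) :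
    (wedge α θ).compContinuousLinearMap L =
      wedge (α.compContinuousLinearMap L) (θ.comp L) := by
  ext v
  simp only [ContinuousAlternatingMap.compContinuousLinearMap_apply, wedge_apply]
  rfl

theorem oneForm_comp (θ : V →L[ℝ] A) (L : V' →L[ℝ] V) :
    (oneForm θ).compContinuousLinearMap L = oneForm (θ.comp L) := rfl

theorem w2_comp (a b : V →L[ℝ] A) (L : V' →L[ℝ] V) :
    (w2 a b).compContinuousLinearMap L = w2 (a.comp L) (b.comp L) := by
  simp only [w2, wedge_comp, oneForm_comp]

theorem w3_comp (a b c : V →L[ℝ] A) (L : V' →L[ℝ] V) :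
    (w3 a b c).compContinuousLinearMap L = w3 (a.comp L) (b.comp L) (c.comp L) := by
  simp only [w3, wedge_comp, w2_comp]

theorem w4_comp (a b c d : V →L[ℝ] A) (L : V' →L[ℝ] V) :
    (w4 a b c d).compContinuousLinearMap L =
      w4 (a.comp L) (b.comp L) (c.comp L) (d.comp L) := by
  simp only [w4, wedge_comp, w3_comp]

theorem cCovector_apply (a b : V →L[ℝ] ℝ) (v : V) :
    cCovector a b v = (a v : ℂ) + Complex.I * (b v : ℂ) := rfl

theorem cForm_apply {k : ℕ} (α β : V [⋀^Fin k]→L[ℝ] ℝ) (v : Fin k → V) :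
    cForm α β v = (α v : ℂ) + Complex.I * (β v : ℂ) := rfl

/-- The scaled coframe `(u e¹, v e², v e³, u e⁴, v e⁵, u e⁶, v⁻³ e⁷)`. -/
def scaledCoframe (u v : ℝ) (e : Fin 7 → V →L[ℝ] ℝ) : Fin 7 → V →L[ℝ] ℝ :=
  ![u • e 0, v • e 1, v • e 2, u • e 3, v • e 4, u • e 5, (1 / v ^ 3) • e 6]

/-- Each of the pairs `(1,2)`, `(3,4)`, `(5,6)` has one covector scaled by `u` and one by `v`,
whence the common factor `u v`. -/
theorem omegaForm_eq (u v : ℝ) (e : Fin 7 → V →L[ℝ] ℝ) :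
    omegaForm u v e =
      w2 (scaledCoframe u v e 0) (scaledCoframe u v e 1) +
      w2 (scaledCoframe u v e 2) (scaledCoframe u v e 3) +
      w2 (scaledCoframe u v e 4) (scaledCoframe u v e 5) := by
  ext x
  simp [omegaForm, scaledCoframe, w2_apply]
  ring

/-- Expand the product of the three complex covectors. Indices 1, 4, 6 carry `u` and 2, 3, 5 carry
`v`; terms with an even number of factors `i` form `ψ₊`, the others `ψ₋`. -/
theorem cForm_psi_eq (u v : ℝ) (e : Fin 7 → V →L[ℝ] ℝ) :
    cForm (psiPlus u v e) (psiMinus u v e) =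
      w3 (cCovector (scaledCoframe u v e 0) (scaledCoframe u v e 1))
        (cCovector (scaledCoframe u v e 2) (scaledCoframe u v e 3))
        (cCovector (scaledCoframe u v e 4) (scaledCoframe u v e 5)) := by
  ext x
  apply Complex.ext <;>
  · simp [psiPlus, psiMinus, scaledCoframe, w3_apply, cForm_apply, cCovector_apply, pow_succ]
    ring

theorem isSU3Coframe_scaledCoframe {u v : ℝ} (hu : u ≠ 0) (hv : v ≠ 0) {e : Fin 7 → V →L[ℝ] ℝ}
    (he : LinearIndependent ℝ e) :
    IsSU3Coframe (omegaForm u v e) (etaForm v e) (cForm (psiPlus u v e) (psiMinus u v e))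
      (scaledCoframe u v e) where
  linearIndependent := by
    have h := he.units_smul
      ![Units.mk0 u hu, Units.mk0 v hv, Units.mk0 v hv, Units.mk0 u hu, Units.mk0 v hv,
        Units.mk0 u hu, (Units.mk0 v hv ^ 3)⁻¹]
    convert h using 1
    funext i
    fin_cases i <;> simp [scaledCoframe, Units.smul_def]
  omega_eq := omegaForm_eq u v e
  eta_eq := rfl
  psi_eq := cForm_psi_eq u v e

end Wedge

end MBeta

namespace MBeta

/-! ### Smoothness of pullbacks of alternating forms -/

section ContDiffPullback

variable {E F G X : Type*} [NormedAddCommGroup E] [NormedSpace ℝ E] [NormedAddCommGroup F]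
  [NormedSpace ℝ F] [NormedAddCommGroup G] [NormedSpace ℝ G] [NormedAddCommGroup X]
  [NormedSpace ℝ X] {k : ℕ}

/-- Normalized alternatization, a continuous left inverse of the inclusion of alternating maps into
multilinear maps. -/
def alternatizationCLM (k : ℕ) (E G : Type*) [NormedAddCommGroup E] [NormedSpace ℝ E]
    [NormedAddCommGroup G] [NormedSpace ℝ G] :
    ContinuousMultilinearMap ℝ (fun _ : Fin k => E) G →L[ℝ] E [⋀^Fin k]→L[ℝ] G :=
  LinearMap.mkContinuous
    { toFun := fun f => ((k.factorial : ℝ)⁻¹) • ContinuousMultilinearMap.alternatization f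
      map_add' := fun f g => by simp
      map_smul' := fun c f => by
        ext v
        simp [ContinuousMultilinearMap.alternatization_apply_apply, Finset.smul_sum, smul_comm c] }
    1 fun f => by
      refine ContinuousAlternatingMap.opNorm_le_bound _ (by positivity) fun v => ?_
      have h : ∀ σ : Equiv.Perm (Fin k), ‖Equiv.Perm.sign σ • f (v ∘ σ)‖ ≤ ‖f‖ * ∏ i, ‖v i‖ := by
        intro σ
        have h1 : ‖Equiv.Perm.sign σ • f (v ∘ σ)‖ = ‖f (v ∘ σ)‖ := by
          rcases Int.units_eq_one_or (Equiv.Perm.sign σ) with h | h <;> simp [h]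
        rw [h1]
        refine (f.le_opNorm _).trans_eq ?_
        congr 1
        exact Equiv.prod_comp σ fun i => ‖v i‖
      have h2 := norm_sum_le_of_le Finset.univ fun σ _ => h σ
      simp only [Finset.sum_const, Finset.card_univ, Fintype.card_perm, Fintype.card_fin,
        nsmul_eq_mul] at h2
      have hk : (0 : ℝ) < k.factorial := by positivity
      simp only [LinearMap.coe_mk, AddHom.coe_mk, ContinuousAlternatingMap.smul_apply,
        ContinuousMultilinearMap.alternatization_apply_apply, norm_smul, norm_inv,
        Real.norm_natCast, one_mul]
      rwa [inv_mul_le_iff₀ hk]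

/-- On an alternating map all `k!` summands agree, since the sign of a permutation appears twice. -/
theorem alternatizationCLM_coe (f : E [⋀^Fin k]→L[ℝ] G) :
    alternatizationCLM k E G f.toContinuousMultilinearMap = f := by
  ext v
  have h : ∀ σ : Equiv.Perm (Fin k), Equiv.Perm.sign σ • f (v ∘ σ) = f v := by
    intro σ
    have := f.toAlternatingMap.map_perm v σ
    simp only [ContinuousAlternatingMap.coe_toAlternatingMap] at this
    rw [this, smul_smul, Int.units_mul_self, one_smul]
  have hk : (k.factorial : ℝ) ≠ 0 := by positivity
  change (k.factorial : ℝ)⁻¹ •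
    ContinuousMultilinearMap.alternatization f.toContinuousMultilinearMap v = _
  rw [ContinuousMultilinearMap.alternatization_apply_apply]
  change (k.factorial : ℝ)⁻¹ • (∑ σ : Equiv.Perm (Fin k), Equiv.Perm.sign σ • f (v ∘ σ)) = _
  simp only [h, Finset.sum_const, Finset.card_univ, Fintype.card_perm, Fintype.card_fin]
  rw [← Nat.cast_smul_eq_nsmul ℝ, smul_smul, inv_mul_cancel₀ hk, one_smul]

/-- For multilinear maps, pullback is linear in the form and continuous multilinear in the linear
map, hence smooth. The alternating case passes through multilinear maps and comes back by
`alternatizationCLM`. -/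
theorem _root_.ContDiffAt.compContinuousLinearMap_alternating {n : ℕ∞ω} {x : X}
    {β : X → F [⋀^Fin k]→L[ℝ] G} {L : X → E →L[ℝ] F} (hβ : ContDiffAt ℝ n β x)
    (hL : ContDiffAt ℝ n L x) :
    ContDiffAt ℝ n (fun y => (β y).compContinuousLinearMap (L y)) x := by
  have h1 : ContDiffAt ℝ n (fun y =>
      ContinuousMultilinearMap.compContinuousLinearMapContinuousMultilinear ℝ
        (fun _ : Fin k => E) (fun _ => F) G (fun _ => L y)) x :=
    (ContinuousMultilinearMap.contDiff _).contDiffAt.comp x (contDiffAt_pi.2 fun _ => hL)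
  have h2 : ContDiffAt ℝ n (fun y => (β y).toContinuousMultilinearMap) x :=
    (ContinuousAlternatingMap.toContinuousMultilinearMapCLM ℝ :
      (F [⋀^Fin k]→L[ℝ] G) →L[ℝ] _).contDiff.contDiffAt.comp x hβ
  have h3 := (alternatizationCLM k E G).contDiff.contDiffAt.comp x (h1.clm_apply h2)
  refine h3.congr_of_eventuallyEq (Filter.Eventually.of_forall fun y => ?_)
  exact (alternatizationCLM_coe _).symm

end ContDiffPullback

/-! ### Forms which are locally pulled back from a vector space -/

section LocalPullback

variable {E : Type*} [NormedAddCommGroup E] [NormedSpace ℝ E]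
  {H : Type*} [TopologicalSpace H] {I : ModelWithCorners ℝ E H} [I.Boundaryless]
  {M : Type*} [TopologicalSpace M] [ChartedSpace H M] [IsManifold I ∞ M]
  {W : Type*} [NormedAddCommGroup W] [NormedSpace ℝ W]
  {A : Type*} [NormedAddCommGroup A] [NormedSpace ℝ A] {k : ℕ}

theorem mdifferentiableAt_extChartAt_symm_of_mem {x₀ : M} {y : E}
    (hy : y ∈ (extChartAt I x₀).target) :
    MDifferentiableAt 𝓘(ℝ, E) I (extChartAt I x₀).symm y :=
  ((contMDiffOn_extChartAt_symm (n := ∞) x₀).contMDiffAt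
    ((isOpen_extChartAt_target x₀).mem_nhds hy)).mdifferentiableAt (by simp)

theorem contDiffAt_comp_extChartAt_symm {U : Set M} (hU : IsOpen U) {f : M → W}
    (hf : ContMDiffOn I 𝓘(ℝ, W) ∞ f U) {x₀ : M} {y : E} (hy : y ∈ (extChartAt I x₀).target)
    (hyU : (extChartAt I x₀).symm y ∈ U) :
    ContDiffAt ℝ ∞ (f ∘ (extChartAt I x₀).symm) y :=
  contMDiffAt_iff_contDiffAt.1 (((hf.contMDiffAt (hU.mem_nhds hyU))).comp y
    ((contMDiffOn_extChartAt_symm x₀).contMDiffAt ((isOpen_extChartAt_target x₀).mem_nhds hy)))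

/-- By the chain rule, the chart expression is itself a pullback between vector spaces, by `f` read
in the chart. -/
theorem formInChart_eq_pullback {U : Set M} (hU : IsOpen U) {f : M → W}
    (hf : ContMDiffOn I 𝓘(ℝ, W) ∞ f U) {α : (x : M) → TangentSpace I x [⋀^Fin k]→L[ℝ] A}
    {β : W → W [⋀^Fin k]→L[ℝ] A}
    (hα : ∀ y ∈ U, α y = (β (f y)).compContinuousLinearMap (mfderiv I 𝓘(ℝ, W) f y))
    {x₀ : M} {y : E} (hy : y ∈ (extChartAt I x₀).target)
    (hyU : (extChartAt I x₀).symm y ∈ U) :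
    formInChart I α x₀ y = (β ((f ∘ (extChartAt I x₀).symm) y)).compContinuousLinearMap
      (fderiv ℝ (f ∘ (extChartAt I x₀).symm) y) := by
  have h := mfderiv_comp y ((hf.contMDiffAt (hU.mem_nhds hyU)).mdifferentiableAt (by simp))
    (mdifferentiableAt_extChartAt_symm_of_mem hy)
  rw [mfderiv_eq_fderiv] at h
  rw [h, formInChart, hα _ hyU]
  rfl

theorem eventually_mem_extChartAt_symm {U : Set M} (hU : IsOpen U) {x₀ : M} {y : E}
    (hy : y ∈ (extChartAt I x₀).target) (hyU : (extChartAt I x₀).symm y ∈ U) :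
    ∀ᶠ z in 𝓝 y, z ∈ (extChartAt I x₀).target ∧ (extChartAt I x₀).symm z ∈ U :=
  Filter.Eventually.and ((isOpen_extChartAt_target x₀).mem_nhds hy)
    ((mdifferentiableAt_extChartAt_symm_of_mem hy).continuousAt.eventually_mem (hU.mem_nhds hyU))

theorem isSmoothForm_of_forall_pullback {α : (x : M) → TangentSpace I x [⋀^Fin k]→L[ℝ] A}
    (h : ∀ x : M, ∃ U : Set M, IsOpen U ∧ x ∈ U ∧ ∃ f : M → W, ContMDiffOn I 𝓘(ℝ, W) ∞ f U ∧
      ∃ β : W → W [⋀^Fin k]→L[ℝ] A, ContDiff ℝ ∞ β ∧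
        ∀ y ∈ U, α y = (β (f y)).compContinuousLinearMap (mfderiv I 𝓘(ℝ, W) f y)) :
    IsSmoothForm I α := by
  intro x₀ y hy
  obtain ⟨U, hU, hyU, f, hf, β, hβ, hα⟩ := h ((extChartAt I x₀).symm y)
  have h1 := contDiffAt_comp_extChartAt_symm hU hf hy hyU
  have h2 := ContDiffAt.compContinuousLinearMap_alternating
    (hβ.contDiffAt.comp y h1) (h1.fderiv_right (m := ∞) (by simp))
  refine (h2.congr_of_eventuallyEq ?_).contDiffWithinAt
  filter_upwards [eventually_mem_extChartAt_symm hU hy hyU] with z hz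
  exact formInChart_eq_pullback hU hf hα hz.1 hz.2

/-- Naturality of `d`: in the chart this is `extDeriv_pullback`, and the chain rule removes the
chart. The map `f` need not be a local diffeomorphism; it is used for `M_β`, of dimension 7, with
values in the 8-dimensional `ℍ × ℍ`. -/
theorem dForm_eq_of_pullback {U : Set M} (hU : IsOpen U) {f : M → W}
    (hf : ContMDiffOn I 𝓘(ℝ, W) ∞ f U) {α : (x : M) → TangentSpace I x [⋀^Fin k]→L[ℝ] A}
    {β : W → W [⋀^Fin k]→L[ℝ] A} (hβ : Differentiable ℝ β)
    (hα : ∀ y ∈ U, α y = (β (f y)).compContinuousLinearMap (mfderiv I 𝓘(ℝ, W) f y))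
    {x : M} (hx : x ∈ U) :
    dForm I α x = (extDeriv β (f x)).compContinuousLinearMap (mfderiv I 𝓘(ℝ, W) f x) := by
  have hy : extChartAt I x x ∈ (extChartAt I x).target := mem_extChartAt_target x
  have hs : (extChartAt I x).symm (extChartAt I x x) = x := extChartAt_to_inv x
  have hyU : (extChartAt I x).symm (extChartAt I x x) ∈ U := by rwa [hs]
  have h1 := contDiffAt_comp_extChartAt_symm hU hf hy hyU
  have h2 : formInChart I α x =ᶠ[𝓝 (extChartAt I x x)] fun z =>
      (β ((f ∘ (extChartAt I x).symm) z)).compContinuousLinearMap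
        (fderiv ℝ (f ∘ (extChartAt I x).symm) z) := by
    filter_upwards [eventually_mem_extChartAt_symm hU hy hyU] with z hz
    exact formInChart_eq_pullback hU hf hα hz.1 hz.2
  have h3 : mfderiv I 𝓘(ℝ, W) f x =
      (fderiv ℝ (f ∘ (extChartAt I x).symm) (extChartAt I x x)).comp
        (mfderiv I 𝓘(ℝ, E) (extChartAt I x) x) := by
    have h4 := mfderiv_comp x (h1.differentiableAt (by simp)).mdifferentiableAt
      (mdifferentiableAt_extChartAt (I := I) (mem_chart_source H x))
    rw [mfderiv_eq_fderiv] at h4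
    have h5 : f =ᶠ[𝓝 x] (f ∘ (extChartAt I x).symm) ∘ extChartAt I x := by
      filter_upwards [extChartAt_source_mem_nhds (I := I) x] with z hz
      exact congrArg f ((extChartAt I x).left_inv hz).symm
    have h6 : (mfderiv I 𝓘(ℝ, W) f x : E →L[ℝ] W) =
        mfderiv I 𝓘(ℝ, W) ((f ∘ (extChartAt I x).symm) ∘ extChartAt I x) x := h5.mfderiv_eq
    exact h6.trans h4
  have h2inf : minSmoothness ℝ 2 ≤ (∞ : ℕ∞ω) := by
    rw [minSmoothness_of_isRCLikeNormedField]; exact WithTop.coe_le_coe.2 (le_top : (2 : ℕ∞) ≤ ⊤)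
  rw [dForm, h2.extDeriv_eq, extDeriv_pullback hβ.differentiableAt h1 h2inf, h3]
  simp only [Function.comp_apply, hs]
  rfl

theorem dForm_eq_zero_of_pullback_const {U : Set M} (hU : IsOpen U) {f : M → W}
    (hf : ContMDiffOn I 𝓘(ℝ, W) ∞ f U) {α : (x : M) → TangentSpace I x [⋀^Fin k]→L[ℝ] A}
    {β : W [⋀^Fin k]→L[ℝ] A}
    (hα : ∀ y ∈ U, α y = β.compContinuousLinearMap (mfderiv I 𝓘(ℝ, W) f y))
    {x : M} (hx : x ∈ U) : dForm I α x = 0 := by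
  rw [dForm_eq_of_pullback hU hf (differentiable_const β) hα hx]
  have h : extDeriv (fun _ : W => β) (f x) = 0 := by
    ext v
    rw [extDeriv, ContinuousAlternatingMap.alternatizeUncurryFin_apply]
    simp
  rw [h]
  rfl

end LocalPullback

/-! ### Contraction of a constant form with a linear vector field -/

section Contraction

variable {W : Type*} [NormedAddCommGroup W] [NormedSpace ℝ W]
  {A : Type*} [NormedAddCommGroup A] [NormedSpace ℝ A] {k : ℕ}

/-- The form `S^* (ι_X β)`, for a constant form `β`, a linear map `S` and a linear vector field
`X`. -/
def contraction (β : W [⋀^Fin (k + 1)]→L[ℝ] A) (X S : W →L[ℝ] W) :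
    W →L[ℝ] W [⋀^Fin k]→L[ℝ] A :=
  (ContinuousAlternatingMap.compContinuousLinearMapCLM S).comp (β.curryLeft.comp X)

theorem contraction_apply (β : W [⋀^Fin (k + 1)]→L[ℝ] A) (X S : W →L[ℝ] W) (w : W)
    (v : Fin k → W) : contraction β X S w v = β (Matrix.vecCons (X w) (S ∘ v)) := rfl

/-- The contraction is linear in the base point, so it is its own derivative. Alternatization then
inserts `X (v i)` in front, and the sign `(-1)^i` moves it to slot `i`. -/
theorem extDeriv_contraction_apply (β : W [⋀^Fin (k + 1)]→L[ℝ] A) (X S : W →L[ℝ] W) (w : W)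
    (v : Fin (k + 1) → W) :
    extDeriv (contraction β X S) w v = ∑ i, β (Function.update (S ∘ v) i (X (v i))) := by
  rw [extDeriv, ContinuousLinearMap.fderiv, ContinuousAlternatingMap.alternatizeUncurryFin_apply]
  refine Finset.sum_congr rfl fun i _ => ?_
  rw [contraction_apply]
  have h : S ∘ i.removeNth v = i.removeNth (S ∘ v) := rfl
  rw [h]
  have := β.toAlternatingMap.map_insertNth i (X (v i)) (i.removeNth (S ∘ v))
  simp only [ContinuousAlternatingMap.coe_toAlternatingMap] at this
  rw [← this, Fin.insertNth_removeNth]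

/-- If `S s` depends differentiably on `s` with derivative `X`, then
`∂ₛ (S s)^* β = d ((S s)^* ι_X β)`. -/
theorem hasDerivAt_compContinuousLinearMap (β : W [⋀^Fin (k + 1)]→L[ℝ] A) {S : ℝ → W →L[ℝ] W}
    {X : W →L[ℝ] W} {t : ℝ} (hS : HasDerivAt S X t) (w : W) (v : Fin (k + 1) → W) :
    HasDerivAt (fun s => β.compContinuousLinearMap (S s) v)
      (extDeriv (contraction β X (S t)) w v) t := by
  rw [extDeriv_contraction_apply]
  have h1 : HasDerivAt (fun s => fun i => S s (v i)) (fun i => X (v i)) t :=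
    hasDerivAt_pi.2 fun i => by simpa using hS.clm_apply (hasDerivAt_const t (v i))
  -- The Leibniz rule for the multilinear map `β` produces the same sum over slots as
  -- `extDeriv_contraction_apply`.
  have h2 := (β.hasFDerivAt (fun i => S t (v i))).comp_hasDerivAt t h1
  convert! h2 using 1
  rw [ContinuousMultilinearMap.linearDeriv_apply]
  rfl

end Contraction

end MBeta

namespace MBeta

open Bundle VectorField

/-! ### Directional derivatives of vector-valued functions and Lie brackets. -/

section DerivativeAlongFields

variable {E : Type*} [NormedAddCommGroup E] [NormedSpace ℝ E]
  {H : Type*} [TopologicalSpace H] {I : ModelWithCorners ℝ E H}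
  {M : Type*} [TopologicalSpace M] [ChartedSpace H M] [IsManifold I ∞ M]
  {W : Type*} [NormedAddCommGroup W] [NormedSpace ℝ W]

/-- The derivative of `f` in the direction of the vector field `X`. -/
def dirDeriv (I : ModelWithCorners ℝ E H) (f : M → W) (X : (x : M) → TangentSpace I x) (y : M) :
    W :=
  mfderiv I 𝓘(ℝ, W) f y (X y)

/-- The derivative of `f`, read in the trivialization of the tangent bundle at `x₀`. -/
def coordDeriv (I : ModelWithCorners ℝ E H) [IsManifold I ∞ M] (f : M → W) (x₀ y : M) : E →L[ℝ] W :=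
  (mfderiv I 𝓘(ℝ, W) f y : E →L[ℝ] W).comp
    ((trivializationAt E (TangentSpace I : M → Type _) x₀).symmL ℝ y : E →L[ℝ] E)

theorem contMDiffAt_coordDeriv {f : M → W} {x₀ : M} (hf : ContMDiffAt I 𝓘(ℝ, W) ∞ f x₀) :
    ContMDiffAt I 𝓘(ℝ, E →L[ℝ] W) ∞ (coordDeriv I f x₀) x₀ := by
  have h := hf.mfderiv_const (m := ∞) (by simp)
  have he : coordDeriv I f x₀ = inTangentCoordinates I 𝓘(ℝ, W) id f (mfderiv I 𝓘(ℝ, W) f) x₀ := by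
    funext y
    ext v
    simp [inTangentCoordinates, ContinuousLinearMap.inCoordinates, coordDeriv]
    rfl
  rw [he]
  exact h

theorem coordDeriv_trivialization {f : M → W} {x₀ y : M}
    (hy : y ∈ (trivializationAt E (TangentSpace I : M → Type _) x₀).baseSet)
    (v : TangentSpace I y) :
    coordDeriv I f x₀ y (trivializationAt E (TangentSpace I : M → Type _) x₀ ⟨y, v⟩).2 =
      mfderiv I 𝓘(ℝ, W) f y v := by
  have := (trivializationAt E (TangentSpace I : M → Type _) x₀).symm_apply_apply_mk hy v
  exact congrArg (mfderiv I 𝓘(ℝ, W) f y) ((Trivialization.symmL_apply _ hy _).trans this)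

/-- Near `x`, the directional derivative is the smooth operator-valued function `coordDeriv` applied
to the components of `X` in the trivialization. -/
theorem mdifferentiableAt_dirDeriv {f : M → W} {x : M} (hf : ContMDiffAt I 𝓘(ℝ, W) ∞ f x)
    {X : (x : M) → TangentSpace I x} (hX : MDiffAt (T% X) x) :
    MDifferentiableAt I 𝓘(ℝ, W) (dirDeriv I f X) x := by
  have h1 := (contMDiffAt_coordDeriv hf).mdifferentiableAt (by simp)
  rw [mdifferentiableAt_totalSpace] at hX
  refine (h1.clm_apply hX.2).congr_of_eventuallyEq ?_
  filter_upwards [(trivializationAt E (TangentSpace I : M → Type _) x).open_baseSet.mem_nhds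
    (mem_baseSet_trivializationAt E _ x)] with y hy
  exact (coordDeriv_trivialization hy _).symm

theorem contMDiffAt_dirDeriv {f : M → W} {x : M} (hf : ContMDiffAt I 𝓘(ℝ, W) ∞ f x)
    {X : (x : M) → TangentSpace I x} (hX : CMDiffAt ∞ (T% X) x) :
    ContMDiffAt I 𝓘(ℝ, W) ∞ (dirDeriv I f X) x := by
  have h1 := contMDiffAt_coordDeriv hf
  rw [contMDiffAt_totalSpace] at hX
  refine (h1.clm_apply hX.2).congr_of_eventuallyEq ?_
  filter_upwards [(trivializationAt E (TangentSpace I : M → Type _) x).open_baseSet.mem_nhds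
    (mem_baseSet_trivializationAt E _ x)] with y hy
  exact (coordDeriv_trivialization hy _).symm

variable [I.Boundaryless] [CompleteSpace E]

/-- The Lie bracket is the commutator of directional derivatives. -/
theorem dirDeriv_mlieBracket {f : M → W} {x : M} (hf : ContMDiffAt I 𝓘(ℝ, W) ∞ f x)
    {X Y : (x : M) → TangentSpace I x} (hX : MDiffAt (T% X) x) (hY : MDiffAt (T% Y) x) :
    dirDeriv I f (mlieBracket I X Y) x =
      dirDeriv I (dirDeriv I f Y) X x - dirDeriv I (dirDeriv I f X) Y x := by
  have : IsManifold I 2 M := IsManifold.of_le (n := ∞) (WithTop.coe_le_coe.2 le_top)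
  set φ := extChartAt I x with hφ
  set F : E → W := f ∘ φ.symm with hF
  have hx : φ x ∈ φ.target := mem_extChartAt_target x
  have hφx : φ.symm (φ x) = x := extChartAt_to_inv x
  have hF2 : ContDiffAt ℝ ∞ F (φ x) := by
    refine contMDiffAt_iff_contDiffAt.1 (ContMDiffAt.comp (φ x) (by rwa [hφx]) ?_)
    exact (contMDiffOn_extChartAt_symm x).contMDiffAt ((isOpen_extChartAt_target x).mem_nhds hx)
  -- the expression of a vector field in the chart
  let c (Z : (x : M) → TangentSpace I x) : E → E :=
    mpullbackWithin 𝓘(ℝ, E) I φ.symm Z (Set.range I)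
  have hdiff : ∀ Z : (x : M) → TangentSpace I x, MDiffAt (T% Z) x →
      DifferentiableAt ℝ (c Z) (φ x) := by
    intro Z hZ
    have h := MDifferentiableWithinAt.differentiableWithinAt_mpullbackWithin_vectorField
      (s := Set.univ) hZ.mdifferentiableWithinAt
    rw [Set.preimage_univ, Set.univ_inter, I.range_eq_univ] at h
    simp only [c, I.range_eq_univ]
    exact differentiableWithinAt_univ.1 h
  have hinv : ∀ z ∈ φ.target, (mfderiv 𝓘(ℝ, E) I φ.symm z).IsInvertible := by
    intro z hz
    have := isInvertible_mfderivWithin_extChartAt_symm hz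
    rwa [I.range_eq_univ, mfderivWithin_univ] at this
  have hc : ∀ (Z : (x : M) → TangentSpace I x), ∀ z ∈ φ.target,
      (mfderiv 𝓘(ℝ, E) I φ.symm z (c Z z) : E) = Z (φ.symm z) := by
    intro Z z hz
    obtain ⟨e, he⟩ := hinv z hz
    simp only [c, mpullbackWithin_apply, I.range_eq_univ, mfderivWithin_univ]
    rw [← he, ContinuousLinearMap.inverse_equiv]
    exact e.apply_symm_apply _
  have hev : ∀ᶠ z in 𝓝 (φ x), z ∈ φ.target ∧ ContMDiffAt I 𝓘(ℝ, W) 1 f (φ.symm z) := by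
    refine Filter.Eventually.and ((isOpen_extChartAt_target x).mem_nhds hx) ?_
    have h1 : ∀ᶠ y in 𝓝 (φ.symm (φ x)), ContMDiffAt I 𝓘(ℝ, W) 1 f y := by
      rw [hφx]
      exact (contMDiffAt_iff_contMDiffAt_nhds (by simp)).1
        (hf.of_le (n := ∞) (WithTop.coe_le_coe.2 le_top))
    exact (continuousAt_extChartAt_symm x).eventually h1
  have hdir : ∀ (Z : (x : M) → TangentSpace I x),
      (dirDeriv I f Z ∘ φ.symm) =ᶠ[𝓝 (φ x)] fun z => fderiv ℝ F z (c Z z) := by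
    intro Z
    filter_upwards [hev] with z hz
    have h1 := mfderiv_comp_apply z (hz.2.mdifferentiableAt (by simp))
      (mdifferentiableAt_extChartAt_symm_of_mem hz.1) (c Z z)
    rw [mfderiv_eq_fderiv] at h1
    refine Eq.trans ?_ h1.symm
    exact congrArg (mfderiv I 𝓘(ℝ, W) f (φ.symm z)) (hc Z z hz.1).symm
  have hd2 : DifferentiableAt ℝ (fderiv ℝ F) (φ x) :=
    (hF2.fderiv_right (m := 1) (WithTop.coe_le_coe.2 le_top)).differentiableAt (by simp)
  -- Symmetry of the second derivative makes the second-order terms cancel in the commutator.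
  have hsymm : IsSymmSndFDerivAt ℝ F (φ x) :=
    hF2.isSymmSndFDerivAt (by
      rw [minSmoothness_of_isRCLikeNormedField]; exact WithTop.coe_le_coe.2 le_top)
  have hcx : ∀ (Z : (x : M) → TangentSpace I x),
      (mfderiv 𝓘(ℝ, E) I φ.symm (φ x) (c Z (φ x)) : E) = Z x := by
    intro Z
    rw [hc Z _ hx]
    exact congrArg Z hφx
  -- In the chart the iterated derivative splits, by the product rule, into a Hessian term and a
  -- term differentiating the components of `Z`.
  have hsec : ∀ (Z Z' : (x : M) → TangentSpace I x), MDiffAt (T% Z) x →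
      dirDeriv I (dirDeriv I f Z) Z' x =
        fderiv ℝ (fderiv ℝ F) (φ x) (c Z' (φ x)) (c Z (φ x)) +
          fderiv ℝ F (φ x) (fderiv ℝ (c Z) (φ x) (c Z' (φ x))) := by
    intro Z Z' hZ
    have h1 := mdifferentiableAt_dirDeriv hf hZ
    have h2 := mfderiv_comp_apply_of_eq (f := φ.symm) (φ x) h1
      (mdifferentiableAt_extChartAt_symm_of_mem hx) hφx (c Z' (φ x))
    rw [mfderiv_eq_fderiv, (hdir Z).fderiv_eq] at h2
    have h3 : dirDeriv I (dirDeriv I f Z) Z' x =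
        mfderiv I 𝓘(ℝ, W) (dirDeriv I f Z) x (mfderiv 𝓘(ℝ, E) I φ.symm (φ x) (c Z' (φ x))) :=
      congrArg (mfderiv I 𝓘(ℝ, W) (dirDeriv I f Z) x) (hcx Z').symm
    refine (h3.trans h2.symm).trans ?_
    rw [fderiv_clm_apply hd2 (hdiff Z hZ)]
    exact add_comm _ _
  rw [hsec Y X hY, hsec X Y hX, hsymm.eq (c X (φ x)) (c Y (φ x)), add_sub_add_left_eq_sub,
    ← map_sub]
  have h1 := mfderiv_comp_apply_of_eq (f := φ.symm) (φ x) (hf.mdifferentiableAt (by simp))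
      (mdifferentiableAt_extChartAt_symm_of_mem hx) hφx (lieBracket ℝ (E := E) (c X) (c Y) (φ x))
  rw [mfderiv_eq_fderiv] at h1
  have h2 : mlieBracket I X Y x = (mfderiv I 𝓘(ℝ, E) φ x).inverse
      (lieBracket ℝ (E := E) (c X) (c Y) (φ x)) := by
    simp only [mlieBracket, mlieBracketWithin, mpullback, c, Set.preimage_univ, Set.univ_inter,
      I.range_eq_univ, ← hφ]
    exact congrArg (mfderiv I 𝓘(ℝ, E) φ x).inverse (congrFun (lieBracketWithin_univ (E := E)) _)
  -- The bracket is carried back by the inverse of the differential of the chart, which is the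
  -- differential of the inverse chart.
  have h3 : (mlieBracket I X Y x : E) =
      mfderiv 𝓘(ℝ, E) I φ.symm (φ x) (lieBracket ℝ (E := E) (c X) (c Y) (φ x)) := by
    have h4 := mfderivWithin_extChartAt_symm_comp_mfderiv_extChartAt' (I := I)
      (mem_extChartAt_source x)
    have h5 := mfderiv_extChartAt_comp_mfderivWithin_extChartAt_symm' (I := I)
      (mem_extChartAt_source x)
    rw [I.range_eq_univ, mfderivWithin_univ] at h4 h5
    rw [h2, ContinuousLinearMap.inverse_eq h5 h4]
    rfl
  rw [dirDeriv]
  exact (congrArg (mfderiv I 𝓘(ℝ, W) f x) h3).trans h1.symm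

end DerivativeAlongFields

end MBeta

namespace MBeta

open Bundle VectorField

/-! ### Flat atlases and their connections. -/

section FlatAtlas

variable {E : Type*} [NormedAddCommGroup E] [NormedSpace ℝ E]
  {H : Type*} [TopologicalSpace H] (I : ModelWithCorners ℝ E H)
  (M : Type*) [TopologicalSpace M] [ChartedSpace H M]
  {W : Type*} [NormedAddCommGroup W] [NormedSpace ℝ W]

/-- A manifold locally modelled on the vector space `W`, by local diffeomorphisms whose transition
maps have their differentials in `K`. -/
structure FlatAtlas (K : Subgroup (W ≃L[ℝ] W)) where
  /-- The domain of the developing map around `x`. -/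
  dom : M → Set M
  /-- The developing map around `x`. -/
  dev : M → M → W
  isOpen_dom : ∀ x, IsOpen (dom x)
  mem_dom : ∀ x, x ∈ dom x
  contMDiffOn_dev : ∀ x, ContMDiffOn I 𝓘(ℝ, W) ∞ (dev x) (dom x)
  isInvertible_mfderiv : ∀ x, ∀ y ∈ dom x, (mfderiv I 𝓘(ℝ, W) (dev x) y).IsInvertible
  transition : ∀ x x' y, y ∈ dom x → y ∈ dom x' → ∃ k ∈ K, ∀ᶠ z in 𝓝 y,
    ∀ v : TangentSpace I z, mfderiv I 𝓘(ℝ, W) (dev x') z v = k (mfderiv I 𝓘(ℝ, W) (dev x) z v)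

variable {I M}

/-- Differentiability of `h` is not needed: as `k` is invertible, `h` and `k ∘ h` fail to be
differentiable together, and then both derivatives take the default value `0`. This allows `covFun`
to be compared on arbitrary vector fields. -/
theorem mfderiv_continuousLinearEquiv_comp (k : W ≃L[ℝ] W) (h : M → W) (y : M)
    (v : TangentSpace I y) :
    mfderiv I 𝓘(ℝ, W) (fun z => k (h z)) y v = k (mfderiv I 𝓘(ℝ, W) h y v) := by
  by_cases hd : MDifferentiableAt I 𝓘(ℝ, W) h y
  · have h1 := mfderiv_comp_apply (g := k) y k.differentiableAt.mdifferentiableAt hd v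
    rw [mfderiv_eq_fderiv] at h1
    refine h1.trans ?_
    rw [k.fderiv]
    rfl
  · have hd' : ¬ MDifferentiableAt I 𝓘(ℝ, W) (fun z => k (h z)) y := by
      intro hk
      have := k.symm.differentiableAt.mdifferentiableAt.comp y hk
      exact hd (this.congr_of_eventuallyEq (Filter.Eventually.of_forall fun z => by simp))
    rw [mfderiv_zero_of_not_mdifferentiableAt hd, mfderiv_zero_of_not_mdifferentiableAt hd']
    exact (map_zero k).symm

theorem mfderiv_bilinear {V₁ V₂ : Type*} [NormedAddCommGroup V₁] [NormedSpace ℝ V₁]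
    [NormedAddCommGroup V₂] [NormedSpace ℝ V₂] (B : V₁ →L[ℝ] V₂ →L[ℝ] W) {f : M → V₁} {h : M → V₂}
    {y : M} (hf : MDifferentiableAt I 𝓘(ℝ, V₁) f y) (hh : MDifferentiableAt I 𝓘(ℝ, V₂) h y)
    (v : TangentSpace I y) :
    mfderiv I 𝓘(ℝ, W) (fun z => B (f z) (h z)) y v =
      B (f y) (mfderiv I 𝓘(ℝ, V₂) h y v) + B (mfderiv I 𝓘(ℝ, V₁) f y v) (h y) := by
  have h0 : HasMFDerivAt I 𝓘(ℝ, V₁ × V₂) (fun z => (f z, h z)) y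
      ((mfderiv I 𝓘(ℝ, V₁) f y : E →L[ℝ] V₁).prod (mfderiv I 𝓘(ℝ, V₂) h y : E →L[ℝ] V₂)) :=
    ⟨hf.continuousAt.prodMk hh.continuousAt, hf.hasMFDerivAt.2.prodMk hh.hasMFDerivAt.2⟩
  have h1 := HasMFDerivAt.comp (f := fun z => (f z, h z)) y
    (B.isBoundedBilinearMap.hasFDerivAt (f y, h y)).hasMFDerivAt h0
  exact DFunLike.congr_fun h1.mfderiv v

namespace FlatAtlas

variable {K : Subgroup (W ≃L[ℝ] W)} (Φ : FlatAtlas I M K)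

/-- The differential of the developing map around `x`. -/
def dDev (x y : M) : TangentSpace I y →L[ℝ] W := mfderiv I 𝓘(ℝ, W) (Φ.dev x) y

/-- The inverse of the differential of the developing map. -/
def dDevInv (x y : M) : W →L[ℝ] TangentSpace I y := (Φ.dDev x y).inverse

variable {Φ}

theorem dDev_dDevInv {x y : M} (hy : y ∈ Φ.dom x) (w : W) : Φ.dDev x y (Φ.dDevInv x y w) = w := by
  obtain ⟨e, he⟩ : (Φ.dDev x y).IsInvertible := Φ.isInvertible_mfderiv x y hy
  rw [dDevInv, ← he, ContinuousLinearMap.inverse_equiv]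
  exact e.apply_symm_apply w

theorem dDevInv_dDev {x y : M} (hy : y ∈ Φ.dom x) (v : TangentSpace I y) :
    Φ.dDevInv x y (Φ.dDev x y v) = v := by
  obtain ⟨e, he⟩ : (Φ.dDev x y).IsInvertible := Φ.isInvertible_mfderiv x y hy
  rw [dDevInv, ← he, ContinuousLinearMap.inverse_equiv]
  exact e.symm_apply_apply v

theorem dDev_injective {x y : M} (hy : y ∈ Φ.dom x) : Function.Injective (Φ.dDev x y) :=
  Function.LeftInverse.injective (dDevInv_dDev hy)

theorem eventually_mem_dom {x y : M} (hy : y ∈ Φ.dom x) : ∀ᶠ z in 𝓝 y, z ∈ Φ.dom x :=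
  (Φ.isOpen_dom x).mem_nhds hy

theorem contMDiffAt_dev {x y : M} (hy : y ∈ Φ.dom x) : ContMDiffAt I 𝓘(ℝ, W) ∞ (Φ.dev x) y :=
  (Φ.contMDiffOn_dev x).contMDiffAt ((Φ.isOpen_dom x).mem_nhds hy)

theorem exists_transition {x x' y : M} (hy : y ∈ Φ.dom x) (hy' : y ∈ Φ.dom x') :
    ∃ k ∈ K, ∀ᶠ z in 𝓝 y, ∀ v : TangentSpace I z, Φ.dDev x' z v = k (Φ.dDev x z v) :=
  Φ.transition x x' y hy hy'

/-- The flat connection of the atlas. -/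
def covFun (Φ : FlatAtlas I M K) (Y : (x : M) → TangentSpace I x) (x : M) :
    TangentSpace I x →L[ℝ] TangentSpace I x :=
  (Φ.dDevInv x x).comp (mfderiv I 𝓘(ℝ, W) (dirDeriv I (Φ.dev x) Y) x : TangentSpace I x →L[ℝ] W)

/-- `covFun` at `y` uses the developing map around `y` itself. Any other one differs from it near
`y` by a constant linear map at the level of differentials, and a constant map passes through the
derivative. -/
theorem dDev_covFun {x y : M} (hy : y ∈ Φ.dom x) (Y : (x : M) → TangentSpace I x)
    (v : TangentSpace I y) :
    Φ.dDev x y (Φ.covFun Y y v) = mfderiv I 𝓘(ℝ, W) (dirDeriv I (Φ.dev x) Y) y v := by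
  obtain ⟨k, -, hk⟩ := exists_transition (Φ.mem_dom y) hy
  have h1 : dirDeriv I (Φ.dev x) Y =ᶠ[𝓝 y] fun z => k (dirDeriv I (Φ.dev y) Y z) := by
    filter_upwards [hk] with z hz using hz (Y z)
  have h2 : (mfderiv I 𝓘(ℝ, W) (dirDeriv I (Φ.dev x) Y) y : E →L[ℝ] W) =
      mfderiv I 𝓘(ℝ, W) (fun z => k (dirDeriv I (Φ.dev y) Y z)) y := h1.mfderiv_eq
  have h3 : (mfderiv I 𝓘(ℝ, W) (dirDeriv I (Φ.dev x) Y) y v : W) =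
      mfderiv I 𝓘(ℝ, W) (fun z => k (dirDeriv I (Φ.dev y) Y z)) y v := DFunLike.congr_fun h2 v
  rw [h3, mfderiv_continuousLinearEquiv_comp, hk.self_of_nhds, covFun]
  exact congrArg k (dDev_dDevInv (Φ.mem_dom y) _)

theorem dirDeriv_covFun {x y : M} (hy : y ∈ Φ.dom x) (X Y : (x : M) → TangentSpace I x) :
    dirDeriv I (Φ.dev x) (fun z => Φ.covFun Y z (X z)) y =
      dirDeriv I (dirDeriv I (Φ.dev x) Y) X y := dDev_covFun hy Y (X y)

variable [IsManifold I ∞ M]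

/-- The flat connection of the atlas, as a covariant derivative. -/
def cov (Φ : FlatAtlas I M K) : CovariantDerivative I E (TangentSpace I : M → Type _) where
  toFun := Φ.covFun
  isCovariantDerivativeOnUniv :=
    { add := fun {σ σ' x} hσ hσ' _ => by
        ext v
        apply dDev_injective (Φ.mem_dom x)
        have h1 := (mdifferentiableAt_dirDeriv (contMDiffAt_dev (Φ.mem_dom x)) hσ).hasMFDerivAt.add
          (mdifferentiableAt_dirDeriv (contMDiffAt_dev (Φ.mem_dom x)) hσ').hasMFDerivAt
        have h2 : dirDeriv I (Φ.dev x) (σ + σ') =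
            dirDeriv I (Φ.dev x) σ + dirDeriv I (Φ.dev x) σ' := by
          funext y
          exact map_add (Φ.dDev x y) (σ y) (σ' y)
        rw [add_apply, map_add, dDev_covFun (Φ.mem_dom x),
          dDev_covFun (Φ.mem_dom x), dDev_covFun (Φ.mem_dom x), h2]
        exact DFunLike.congr_fun h1.mfderiv v
      leibniz := fun {σ g x} hσ hg _ => by
        ext v
        apply dDev_injective (Φ.mem_dom x)
        have h1 := mfderiv_bilinear (ContinuousLinearMap.lsmul ℝ ℝ) hg
          (mdifferentiableAt_dirDeriv (contMDiffAt_dev (Φ.mem_dom x)) hσ) v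
        have h2 : dirDeriv I (Φ.dev x) (g • σ) = g • dirDeriv I (Φ.dev x) σ := by
          funext y
          exact map_smul (Φ.dDev x y) (g y) (σ y)
        rw [add_apply, map_add, dDev_covFun (Φ.mem_dom x), h2,
          smul_apply, map_smul, dDev_covFun (Φ.mem_dom x),
          ContinuousLinearMap.smulRight_apply, map_smul]
        exact h1 }

theorem cov_apply (Y : (x : M) → TangentSpace I x) (x : M) : Φ.cov Y x = Φ.covFun Y x := rfl

variable [I.Boundaryless] [CompleteSpace E]

/-- In a developing map, `∇_X Y` is the iterated derivative of the map along `Y` and then `X`, so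
the torsion identity is `dirDeriv_mlieBracket` applied to that map. -/
theorem cov_torsion_free (X Y : (x : M) → TangentSpace I x) (x : M)
    (hX : MDiffAt (T% X) x) (hY : MDiffAt (T% Y) x) :
    Φ.cov Y x (X x) - Φ.cov X x (Y x) = mlieBracket I X Y x := by
  apply dDev_injective (Φ.mem_dom x)
  rw [map_sub, cov_apply, cov_apply, dDev_covFun (Φ.mem_dom x), dDev_covFun (Φ.mem_dom x)]
  exact (dirDeriv_mlieBracket (contMDiffAt_dev (Φ.mem_dom x)) hX hY).symm

/-- The components of `Z` form a vector-valued function on which the connection acts by plain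
differentiation. Vanishing curvature is `dirDeriv_mlieBracket` applied to this function. -/
theorem isFlat_cov : IsFlat Φ.cov := by
  intro X Y Z x hX hY hZ
  apply dDev_injective (Φ.mem_dom x)
  have hZ' := contMDiffAt_dirDeriv (contMDiffAt_dev (Φ.mem_dom x)) hZ
  have key : ∀ X Y : (x : M) → TangentSpace I x,
      Φ.dDev x x (Φ.cov (fun y => Φ.cov Z y (Y y)) x (X x)) =
        dirDeriv I (dirDeriv I (dirDeriv I (Φ.dev x) Z) Y) X x := by
    intro X Y
    rw [cov_apply, dDev_covFun (Φ.mem_dom x)]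
    have h : dirDeriv I (Φ.dev x) (fun y => Φ.cov Z y (Y y)) =ᶠ[𝓝 x]
        dirDeriv I (dirDeriv I (Φ.dev x) Z) Y := by
      filter_upwards [eventually_mem_dom (Φ.mem_dom x)] with y hy
      exact dirDeriv_covFun hy Y Z
    exact DFunLike.congr_fun h.mfderiv_eq (X x)
  rw [map_sub, map_sub, map_zero, key, key, cov_apply, dDev_covFun (Φ.mem_dom x)]
  refine sub_eq_zero.2 ?_
  exact (dirDeriv_mlieBracket hZ' (hX.mdifferentiableAt (by simp))
    (hY.mdifferentiableAt (by simp))).symm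

/-- A metric which is constant in the developing maps is preserved by the flat connection. -/
theorem isLeviCivita_cov {g : ContMDiffRiemannianMetric I ∞ E (TangentSpace I : M → Type _)}
    {B : W →L[ℝ] W →L[ℝ] ℝ} (hB : ∀ k ∈ K, ∀ v w, B (k v) (k w) = B v w)
    (hg : ∀ x v w, g.inner x v w = B (Φ.dDev x x v) (Φ.dDev x x w)) : IsLeviCivita g Φ.cov where
  torsion_free := cov_torsion_free
  metric := fun Y Z x v hY hZ => by
    -- The metric at `y` is given through the developing map around `y`. To differentiate, it must
    -- be rewritten with the fixed map around `x`, at the cost of an element of `K`, which preserves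
    -- `B`.
    have h1 : (fun y => g.inner y (Y y) (Z y)) =ᶠ[𝓝 x]
        fun y => B (dirDeriv I (Φ.dev x) Y y) (dirDeriv I (Φ.dev x) Z y) := by
      filter_upwards [eventually_mem_dom (Φ.mem_dom x)] with y hy
      obtain ⟨k, hkK, hk⟩ := exists_transition hy (Φ.mem_dom y)
      rw [hg, hk.self_of_nhds, hk.self_of_nhds, hB k hkK]
      rfl
    have hY' := mdifferentiableAt_dirDeriv (contMDiffAt_dev (Φ.mem_dom x)) hY
    have hZ' := mdifferentiableAt_dirDeriv (contMDiffAt_dev (Φ.mem_dom x)) hZ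
    have h2 : (mfderiv I 𝓘(ℝ, ℝ) (fun y => g.inner y (Y y) (Z y)) x : E →L[ℝ] ℝ) =
      mfderiv I 𝓘(ℝ, ℝ) (fun y => B (dirDeriv I (Φ.dev x) Y y) (dirDeriv I (Φ.dev x) Z y)) x :=
      h1.mfderiv_eq
    refine (DFunLike.congr_fun h2 v).trans ((mfderiv_bilinear B hY' hZ' v).trans ?_)
    rw [hg, hg, cov_apply, cov_apply, dDev_covFun (Φ.mem_dom x), dDev_covFun (Φ.mem_dom x),
      add_comm]
    rfl

end FlatAtlas

end FlatAtlas

end MBeta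

namespace MBeta

open Bundle VectorField

theorem contDiff_bilinearComp {E W : Type*} [NormedAddCommGroup E] [NormedSpace ℝ E]
    [NormedAddCommGroup W] [NormedSpace ℝ W] (B : W →L[ℝ] W →L[ℝ] ℝ) :
    ContDiff ℝ ∞ (fun L : E →L[ℝ] W => B.bilinearComp L L) := by
  have h (L : E →L[ℝ] W) :
      B.bilinearComp L L = ((ContinuousLinearMap.compL ℝ E W ℝ).flip L).comp (B.comp L) := rfl
  simp only [h]
  fun_prop

namespace FlatAtlas

/-! ### The Riemannian metric of a flat atlas. -/

section Metric

variable {E : Type*} [NormedAddCommGroup E] [NormedSpace ℝ E]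
  {H : Type*} [TopologicalSpace H] {I : ModelWithCorners ℝ E H}
  {M : Type*} [TopologicalSpace M] [ChartedSpace H M]
  {W : Type*} [NormedAddCommGroup W] [NormedSpace ℝ W]
  {K : Subgroup (W ≃L[ℝ] W)} {Φ : FlatAtlas I M K}

/-- The metric which is given by the bilinear form `B` in the developing maps. -/
def metricFun (Φ : FlatAtlas I M K) (B : W →L[ℝ] W →L[ℝ] ℝ) (x : M) :
    TangentSpace I x →L[ℝ] TangentSpace I x →L[ℝ] ℝ :=
  (B.bilinearComp (Φ.dDev x x : E →L[ℝ] W) (Φ.dDev x x : E →L[ℝ] W) : E →L[ℝ] E →L[ℝ] ℝ)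

theorem metricFun_apply (B : W →L[ℝ] W →L[ℝ] ℝ) (x : M) (v w : TangentSpace I x) :
    Φ.metricFun B x v w = B (Φ.dDev x x v) (Φ.dDev x x w) := rfl

/-- Invariance of `B` under `K` makes the metric independent of the developing map; one fixed map
thus serves on a whole neighbourhood, as smoothness requires. -/
theorem metricFun_eq {B : W →L[ℝ] W →L[ℝ] ℝ} (hB : ∀ k ∈ K, ∀ v w, B (k v) (k w) = B v w)
    {x y : M} (hy : y ∈ Φ.dom x) (v w : TangentSpace I y) :
    Φ.metricFun B y v w = B (Φ.dDev x y v) (Φ.dDev x y w) := by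
  obtain ⟨k, hkK, hk⟩ := exists_transition hy (Φ.mem_dom y)
  rw [metricFun_apply, hk.self_of_nhds, hk.self_of_nhds, hB k hkK]

variable [IsManifold I ∞ M]

/-- The metric of a flat atlas whose transition maps preserve the inner product `B`. -/
def metric (Φ : FlatAtlas I M K) (B : W →L[ℝ] W →L[ℝ] ℝ) (hs : ∀ v w, B v w = B w v)
    (hp : ∀ v, ‖v‖ ^ 2 ≤ B v v) (hB : ∀ k ∈ K, ∀ v w, B (k v) (k w) = B v w) :
    ContMDiffRiemannianMetric I ∞ E (TangentSpace I : M → Type _) where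
  inner := Φ.metricFun B
  symm x v w := hs _ _
  pos x v hv := by
    have h : Φ.dDev x x v ≠ 0 := fun h => hv (dDev_injective (Φ.mem_dom x) (by rw [h, map_zero]))
    exact lt_of_lt_of_le (pow_pos (norm_pos_iff.2 h) 2) (hp (Φ.dDev x x v))
  -- By `hp`, the unit ball of the metric lies in the image, under the inverse differential, of the
  -- unit ball of the norm of `W`.
  isVonNBounded x := by
    have h : Bornology.IsVonNBounded ℝ (Metric.ball (0 : W) 1) := NormedSpace.isVonNBounded_ball ..
    have h1 : {v : TangentSpace I x | Φ.metricFun B x v v < 1} ⊆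
        Φ.dDevInv x x '' Metric.ball (0 : W) 1 := by
      intro v hv
      have h2 : ‖Φ.dDev x x v‖ ^ 2 < 1 := (hp (Φ.dDev x x v)).trans_lt hv
      refine ⟨Φ.dDev x x v, ?_, dDevInv_dDev (Φ.mem_dom x) v⟩
      rw [mem_ball_zero_iff]
      nlinarith [norm_nonneg (Φ.dDev x x v)]
    exact (h.image (Φ.dDevInv x x)).subset h1
  contMDiff x := by
    refine (contMDiffAt_hom_bundle _).2 ⟨contMDiffAt_id, ?_⟩
    have h1 := contMDiffAt_coordDeriv (contMDiffAt_dev (Φ.mem_dom x))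
    have h4 := (contDiff_bilinearComp B).contMDiff.contMDiffAt.comp x h1
    refine h4.congr_of_eventuallyEq ?_
    filter_upwards [eventually_mem_dom (Φ.mem_dom x),
      (trivializationAt E (TangentSpace I : M → Type _) x).open_baseSet.mem_nhds
        (mem_baseSet_trivializationAt E _ x)] with y hy hy'
    ext v w
    refine (inCoordinates_apply_eq₂ hy' hy' (Set.mem_univ _)).trans ?_
    have h6 : ∀ c : ℝ, (trivializationAt ℝ (fun _ : M => ℝ) x).linearMapAt ℝ y c = c :=
      fun c => by simp
    refine (h6 _).trans ((metricFun_eq hB hy _ _).trans ?_)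
    have h5 : ∀ v, Φ.dDev x y ((trivializationAt E (TangentSpace I : M → Type _) x).symm y v) =
        coordDeriv I (Φ.dev x) x y v := fun v =>
      congrArg (Φ.dDev x y) (Trivialization.symmL_apply _ hy' v).symm
    exact congrArg₂ (fun a b => B a b) (h5 v) (h5 w)

end Metric

end FlatAtlas

end MBeta

namespace MBeta

open Bundle VectorField

namespace FlatAtlas

/-! ### Parallel transport and holonomy of a flat atlas. -/

section Transport

variable {E : Type*} [NormedAddCommGroup E] [NormedSpace ℝ E]
  {H : Type*} [TopologicalSpace H] {I : ModelWithCorners ℝ E H}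
  {M : Type*} [TopologicalSpace M] [ChartedSpace H M]
  {W : Type*} [NormedAddCommGroup W] [NormedSpace ℝ W]
  {K : Subgroup (W ≃L[ℝ] W)} {Φ : FlatAtlas I M K} [IsManifold I ∞ M]

/-- Parallel vector fields along curves are constant in the developing maps. -/
theorem hasDerivAt_dDev_of_isParallelAlong {γ : ℝ → M} (hγ : ContMDiff 𝓘(ℝ, ℝ) I ∞ γ)
    {V : (s : ℝ) → TangentSpace I (γ s)} (hV : IsParallelAlong Φ.cov γ V) {x : M} {s : ℝ}
    (hs : γ s ∈ Φ.dom x) : HasDerivAt (fun r => Φ.dDev x (γ r) (V r)) 0 s := by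
  set e := trivializationAt E (TangentSpace I : M → Type _) (γ s) with he
  set L : M → E →L[ℝ] W := coordDeriv I (Φ.dev x) (γ s) with hL
  have hbase : ∀ᶠ y in 𝓝 (γ s), y ∈ e.baseSet :=
    e.open_baseSet.mem_nhds (mem_baseSet_trivializationAt E _ _)
  have h1 : ContMDiffAt I 𝓘(ℝ, E →L[ℝ] W) ∞ L (γ s) := contMDiffAt_coordDeriv (contMDiffAt_dev hs)
  have h2 : DifferentiableAt ℝ (fun r => L (γ r)) s :=
    (contMDiffAt_iff_contDiffAt.1 (h1.comp s hγ.contMDiffAt)).differentiableAt (by simp)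
  have h3 := h2.hasDerivAt.clm_apply (hV s)
  set w : E := (e ⟨γ s, V s⟩).2 with hw
  -- With the components frozen at `w`, the derivative of `L (γ r) w` is computed twice: by
  -- differentiating `L ∘ γ`, and by the chain rule through `γ`. The latter is the connection term
  -- of the parallel transport equation, so the two contributions in `h3` cancel.
  have h4 : HasDerivAt (fun r => L (γ r) w) (deriv (fun r => L (γ r)) s w) s := by
    simpa using h2.hasDerivAt.clm_apply (hasDerivAt_const s w)
  have h5 : MDifferentiableAt I 𝓘(ℝ, W) (fun y => L y w) (γ s) :=
    (h1.mdifferentiableAt (by simp)).clm_apply mdifferentiableAt_const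
  have h6 : HasDerivAt (F := W) (fun r => L (γ r) w)
      (mfderiv I 𝓘(ℝ, W) (fun y => L y w) (γ s) (mfderiv 𝓘(ℝ, ℝ) I γ s (1 : ℝ))) s := by
    have := h5.hasMFDerivAt.comp s (hγ.mdifferentiableAt (by simp) (x := s)).hasMFDerivAt
    let D : ℝ →L[ℝ] W := (mfderiv I 𝓘(ℝ, W) (fun y => L y w) (γ s) : E →L[ℝ] W).comp
      (mfderiv 𝓘(ℝ, ℝ) I γ s : ℝ →L[ℝ] E)
    have h : HasFDerivAt (fun r => L (γ r) w) D s := this.hasFDerivAt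
    have h' : HasDerivAt (fun r => L (γ r) w) (D 1) s := h.hasDerivAt
    exact h'
  have h7 : dirDeriv I (Φ.dev x) (fun y => e.symm y w) =ᶠ[𝓝 (γ s)] fun y => L y w := by
    filter_upwards [hbase] with y hy
    exact congrArg (mfderiv I 𝓘(ℝ, W) (Φ.dev x) y) (Trivialization.symmL_apply _ hy w).symm
  have h8 : ∀ v : TangentSpace I (γ s), Φ.dDev x (γ s) (Φ.cov (fun y => e.symm y w) (γ s) v) =
      mfderiv I 𝓘(ℝ, W) (fun y => L y w) (γ s) v := fun v =>
    (dDev_covFun hs _ v).trans (DFunLike.congr_fun h7.mfderiv_eq v)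
  have h9 : ∀ v : TangentSpace I (γ s), L (γ s) (e ⟨γ s, v⟩).2 = Φ.dDev x (γ s) v := fun v =>
    coordDeriv_trivialization hbase.self_of_nhds v
  have h10 : HasDerivAt (fun r => L (γ r) (e ⟨γ r, V r⟩).2) 0 s := by
    convert! h3 using 1
    rw [map_neg, h9, h8, h4.unique h6]
    exact (add_neg_cancel _).symm
  refine h10.congr_of_eventuallyEq ?_
  filter_upwards [hγ.continuous.continuousAt.eventually hbase] with r hr
  exact (coordDeriv_trivialization hr _).symm

/-- Parallel transport along a curve is given by an element of `K` in the developing maps. -/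
theorem exists_dDev_eq_of_isParallelAlong {γ : ℝ → M} (hγ : ContMDiff 𝓘(ℝ, ℝ) I ∞ γ)
    {ι : Type*} {V : ι → (s : ℝ) → TangentSpace I (γ s)} (hV : ∀ i, IsParallelAlong Φ.cov γ (V i))
    (s t : ℝ) : ∃ k ∈ K, ∀ i, Φ.dDev (γ t) (γ t) (V i t) = k (Φ.dDev (γ s) (γ s) (V i s)) := by
  -- The `K`-orbit of the family of developed vectors at time `s`. Working modulo `K` removes the
  -- dependence on the developing map, and all `V i` are treated together so that a single `k`
  -- serves for the whole family.
  let F : ℝ → Set (ι → W) := fun s =>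
    {g | ∃ k ∈ K, ∀ i, g i = k (Φ.dDev (γ s) (γ s) (V i s))}
  have hF : IsLocallyConstant F := by
    refine (IsLocallyConstant.iff_eventually_eq F).2 fun s => ?_
    have h1 : ∀ᶠ r in 𝓝 s, γ r ∈ Φ.dom (γ s) :=
      hγ.continuous.continuousAt.eventually (eventually_mem_dom (Φ.mem_dom _))
    obtain ⟨ε, hε, hball⟩ := Metric.eventually_nhds_iff_ball.1 h1
    filter_upwards [Metric.ball_mem_nhds s hε] with r hr
    have h2 : ∀ i, Φ.dDev (γ s) (γ r) (V i r) = Φ.dDev (γ s) (γ s) (V i s) := by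
      intro i
      have hd : ∀ q ∈ Metric.ball s ε,
          HasDerivAt (fun q => Φ.dDev (γ s) (γ q) (V i q)) 0 q := fun q hq =>
        hasDerivAt_dDev_of_isParallelAlong hγ (hV i) (hball q hq)
      refine (Metric.isOpen_ball).is_const_of_deriv_eq_zero (convex_ball s ε).isPreconnected
        (fun q hq => (hd q hq).differentiableAt.differentiableWithinAt)
        (fun q hq => (hd q hq).deriv) hr (Metric.mem_ball_self hε)
    -- The developed vectors are constant in the map around `γ s`; passing to the map around `γ r`
    -- costs `k`.
    obtain ⟨k, hk, hkr⟩ := exists_transition (Φ.mem_dom (γ r)) (hball r hr)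
    have h3 : ∀ i, k (Φ.dDev (γ r) (γ r) (V i r)) = Φ.dDev (γ s) (γ s) (V i s) := fun i => by
      rw [← hkr.self_of_nhds, h2]
    ext g
    constructor
    · rintro ⟨l, hl, hg⟩
      refine ⟨l * k⁻¹, mul_mem hl (inv_mem hk), fun i => ?_⟩
      rw [hg, ← h3]
      exact congrArg l (k.symm_apply_apply _).symm
    · rintro ⟨l, hl, hg⟩
      refine ⟨l * k, mul_mem hl hk, fun i => ?_⟩
      rw [hg, ← h3]
      rfl
  have h1 : (fun i => Φ.dDev (γ t) (γ t) (V i t)) ∈ F t := ⟨1, one_mem K, fun i => rfl⟩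
  rw [hF.apply_eq_of_preconnectedSpace t s] at h1
  exact h1

theorem exists_dDev_eq_of_isTransport {x y : M} {P : TangentSpace I x →L[ℝ] TangentSpace I y}
    (hP : IsTransport Φ.cov x y P) :
    ∃ k ∈ K, ∀ v, Φ.dDev y y (P v) = k (Φ.dDev x x v) := by
  induction hP with
  | path γ hγ P hP =>
    choose V hV h0 h1 using hP
    obtain ⟨k, hk, h⟩ := exists_dDev_eq_of_isParallelAlong hγ hV 0 1
    refine ⟨k, hk, fun v => ?_⟩
    rw [← h1, h, h0]
  | refl x => exact ⟨1, one_mem K, fun v => rfl⟩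
  | symm P Q hPQ hQP _ ih =>
    obtain ⟨k, hk, h⟩ := ih
    refine ⟨k⁻¹, inv_mem hk, fun v => ?_⟩
    have h1 : P (Q v) = v := DFunLike.congr_fun hPQ v
    have h2 := h (Q v)
    rw [h1] at h2
    rw [h2]
    exact (k.symm_apply_apply _).symm
  | trans P Q _ _ ih ih' =>
    obtain ⟨k, hk, h⟩ := ih
    obtain ⟨l, hl, h'⟩ := ih'
    refine ⟨l * k, mul_mem hl hk, fun v => ?_⟩
    exact (h' (P v)).trans (congrArg l (h v))

theorem exists_dDev_eq_of_mem_holonomy {x : M} {P : (TangentSpace I x →L[ℝ] TangentSpace I x)ˣ}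
    (hP : P ∈ holonomy Φ.cov x) :
    ∃ k ∈ K, ∀ v, Φ.dDev x x ((P : TangentSpace I x →L[ℝ] TangentSpace I x) v) =
      k (Φ.dDev x x v) := exists_dDev_eq_of_isTransport hP

/-- A holonomy transformation is determined by the element of `K` that represents it, because the
differential of the developing map is injective. -/
theorem finite_holonomy [Finite K] (x : M) : Finite (holonomy Φ.cov x) := by
  choose f hf hfP using fun P : holonomy Φ.cov x => exists_dDev_eq_of_mem_holonomy P.2
  refine Finite.of_injective (fun P => (⟨f P, hf P⟩ : K)) fun P Q hPQ => ?_
  have h : f P = f Q := congrArg Subtype.val hPQ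
  refine Subtype.ext (Units.ext (ContinuousLinearMap.ext fun v => ?_))
  refine dDev_injective (Φ.mem_dom x) ?_
  rw [hfP, hfP, h]

theorem discreteTopology_holonomy [Finite K] (x : M) :
    DiscreteTopology (holonomy Φ.cov x) := by
  have := finite_holonomy (Φ := Φ) x
  have : T2Space (TangentSpace I x →L[ℝ] TangentSpace I x)ˣ :=
    inferInstanceAs (T2Space (E →L[ℝ] E)ˣ)
  infer_instance

/-- A one-parameter group inside a finite set is continuous with connected range, hence constant;
its derivative at `0` is the generator, which must vanish. -/
theorem holonomyAlgebra_eq [Finite K] [CompleteSpace E] (x : M) :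
    holonomyAlgebra Φ.cov x = {0} := by
  refine Set.eq_singleton_iff_unique_mem.2 ⟨fun s => ⟨1, one_mem _, ?_⟩, fun X hX => ?_⟩
  · have : NormedSpace.exp (s • (0 : E →L[ℝ] E)) = 1 := by rw [smul_zero, NormedSpace.exp_zero]
    exact this.symm
  · let Y : E →L[ℝ] E := X
    have := finite_holonomy (Φ := Φ) x
    let T : Set (E →L[ℝ] E) := Set.range fun P : holonomy Φ.cov x =>
      ((P : (TangentSpace I x →L[ℝ] TangentSpace I x)ˣ) : TangentSpace I x →L[ℝ] TangentSpace I x)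
    have hT : T.Finite := Set.finite_range _
    have hd : ∀ s : ℝ, HasDerivAt (fun s : ℝ => NormedSpace.exp (s • Y))
        (NormedSpace.exp (s • Y) * Y) s := fun s => hasDerivAt_exp_smul_const Y s
    have hc : Continuous fun s : ℝ => NormedSpace.exp (s • Y) :=
      continuous_iff_continuousAt.2 fun s => (hd s).continuousAt
    have hmem : ∀ s : ℝ, NormedSpace.exp (s • Y) ∈ T := fun s => by
      obtain ⟨P, hP, h⟩ := hX s
      exact ⟨⟨P, hP⟩, h⟩
    have hsub : (Set.range fun s : ℝ => NormedSpace.exp (s • Y)).Subsingleton :=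
      Set.not_nontrivial_iff.1 fun h => (isPreconnected_range hc).infinite_of_nontrivial h
        (hT.subset (Set.range_subset_iff.2 hmem))
    have hconst : (fun s : ℝ => NormedSpace.exp (s • Y)) = fun _ => 1 := by
      funext s
      have := hsub ⟨s, rfl⟩ ⟨0, rfl⟩
      simpa using this
    have h0 := hd 0
    rw [hconst] at h0
    have := h0.unique (hasDerivAt_const (0 : ℝ) (1 : E →L[ℝ] E))
    have hY : Y = 0 := by simpa using this
    exact hY

end Transport

end FlatAtlas

end MBeta

namespace MBeta

/-! ### Local sections of the quotient by a properly discontinuous action. -/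

section QuotientProjection

open MulAction

variable {M : Type*} [TopologicalSpace M]
    {Γ : Type*} [Group Γ] [MulAction Γ M]
    [ProperlyDiscontinuousSMul Γ M] [ContinuousConstSMul Γ M] [IsCancelSMul Γ M]
    [T2Space M] [LocallyCompactSpace M]
    {E : Type*} [NormedAddCommGroup E] [NormedSpace ℝ E]
    {H : Type*} [TopologicalSpace H] [ChartedSpace H M] {I : ModelWithCorners ℝ E H}

variable (M Γ) in
theorem isLocalHomeomorph_mk_orbitRel : IsLocalHomeomorph (Quotient.mk (orbitRel Γ M)) :=
  isQuotientCoveringMap_quotientMk_of_properlyDiscontinuousSMul.isCoveringMap.isLocalHomeomorph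

variable (Γ) in
/-- The local section through `x` of the quotient by a free, properly discontinuous action. -/
def localSection (x : M) :
    OpenPartialHomeomorph (orbitRel.Quotient Γ M) M :=
  (isLocalHomeomorph_mk_orbitRel M Γ).localInverseAt x

theorem mk_mem_localSection_source (x : M) :
    Quotient.mk (orbitRel Γ M) x ∈ (localSection Γ x).source :=
  (isLocalHomeomorph_mk_orbitRel M Γ).apply_self_mem_localInverseAt_source

theorem localSection_mk (x : M) : localSection Γ x (Quotient.mk (orbitRel Γ M) x) = x :=
  (isLocalHomeomorph_mk_orbitRel M Γ).localInverseAt_apply_self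

theorem mk_localSection {x : M} {y : orbitRel.Quotient Γ M} (hy : y ∈ (localSection Γ x).source) :
    Quotient.mk (orbitRel Γ M) (localSection Γ x y) = y :=
  (isLocalHomeomorph_mk_orbitRel M Γ).apply_localInverseAt_of_mem hy

theorem eventually_mem_localSection_source {x : M} {y : orbitRel.Quotient Γ M}
    (hy : y ∈ (localSection Γ x).source) : ∀ᶠ z in 𝓝 y, z ∈ (localSection Γ x).source :=
  (localSection Γ x).open_source.mem_nhds hy

/-- Two local sections differ locally by an element of the group. -/
theorem exists_localSection_eq_smul {x x' : M} {y : orbitRel.Quotient Γ M}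
    (hy : y ∈ (localSection Γ x).source) (hy' : y ∈ (localSection Γ x').source) :
    ∃ γ : Γ, ∀ᶠ z in 𝓝 y, localSection Γ x' z = γ • localSection Γ x z := by
  obtain ⟨γ, hγ⟩ := Quotient.exact ((mk_localSection hy').trans (mk_localSection hy).symm)
  refine ⟨γ, ?_⟩
  -- Near `y` both candidates lie in the target of the section through `x'`, where the projection is
  -- injective, so agreement of their classes suffices.
  have o2 : ∀ᶠ z in 𝓝 y, γ • localSection Γ x z ∈ (localSection Γ x').target := by
    refine ((continuous_const_smul γ).continuousAt.comp
      ((localSection Γ x).continuousAt hy)).eventually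
        ((localSection Γ x').open_target.mem_nhds ?_)
    have : γ • localSection Γ x y = localSection Γ x' y := hγ
    simp only [Function.comp_apply, this]
    exact (localSection Γ x').map_source hy'
  filter_upwards [eventually_mem_localSection_source hy, eventually_mem_localSection_source hy', o2]
    with z hz hz' hz2
  refine (isLocalHomeomorph_mk_orbitRel M Γ).injOn_localInverseAt_target
    ((localSection Γ x').map_source hz') hz2 ?_
  refine (mk_localSection hz').trans ?_
  exact (mk_localSection hz).symm.trans
    (Quotient.sound ⟨γ, rfl⟩ : Quotient.mk (orbitRel Γ M) (γ • localSection Γ x z) = _).symm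

theorem eventually_localSection_mk (x : M) :
    ∀ᶠ z in 𝓝 x, localSection Γ x (Quotient.mk (orbitRel Γ M) z) = z := by
  have h : ∀ᶠ z in 𝓝 x, z ∈ (localSection Γ x).target :=
    (localSection Γ x).open_target.mem_nhds
      ((isLocalHomeomorph_mk_orbitRel M Γ).self_mem_localInverseAt_target)
  filter_upwards [h] with z hz
  have := (localSection Γ x).right_inv hz
  rwa [localSection, (isLocalHomeomorph_mk_orbitRel M Γ).localInverseAt_symm] at this

theorem exists_chartAt_quotient_eq (q : orbitRel.Quotient Γ M) :
    ∃ x : M, Quotient.mk (orbitRel Γ M) x = q ∧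
      chartAt H q = (localSection Γ x).trans (chartAt H x) :=
  ⟨_, Quotient.mk_surjective.hasRightInverse.choose_spec q, rfl⟩

/-- A chart of the quotient is a chart of `M` composed with a section. For the representative used
in that chart, the section read in the chart of `M` is the chart of the quotient. -/
theorem exists_contMDiffAt_localSection (q : orbitRel.Quotient Γ M) :
    ∃ x : M, Quotient.mk (orbitRel Γ M) x = q ∧
      ContMDiffAt I I ∞ (localSection Γ x) q := by
  obtain ⟨x, rfl, hx⟩ := exists_chartAt_quotient_eq (H := H) q
  refine ⟨x, rfl, ?_⟩
  rw [contMDiffAt_iff_target]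
  refine ⟨(localSection Γ x).continuousAt (mk_mem_localSection_source x), ?_⟩
  rw [localSection_mk]
  have h : extChartAt I x ∘ localSection Γ x = extChartAt I (Quotient.mk (orbitRel Γ M) x) := by
    funext z
    simp only [extChartAt, hx]
    rfl
  rw [h]
  exact contMDiffAt_extChartAt

/-- Near `y` an arbitrary section is a smooth translate of the one defining the chart at `y`. -/
theorem contMDiffAt_localSection (h : ∀ γ : Γ, ContMDiff I I ∞ (fun x : M => γ • x)) {x : M}
    {y : orbitRel.Quotient Γ M} (hy : y ∈ (localSection Γ x).source) :
    ContMDiffAt I I ∞ (localSection Γ x) y := by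
  obtain ⟨x₀, rfl, hx₀⟩ := exists_contMDiffAt_localSection (I := I) y
  obtain ⟨γ, hγ⟩ := exists_localSection_eq_smul (mk_mem_localSection_source x₀) hy
  exact ((h γ _).comp _ hx₀).congr_of_eventuallyEq hγ

/-- In the chart defined by the representative `x₀`, the projection near `x` reads as the action of
the `γ` with `γ • x = x₀`, followed by the chart of `M` at `x₀`. -/
theorem contMDiff_quotientMk (h : ∀ γ : Γ, ContMDiff I I ∞ (fun x : M => γ • x)) :
    ContMDiff I I ∞ (Quotient.mk (orbitRel Γ M)) := by
  intro x
  obtain ⟨x₀, hq, hx₀⟩ := exists_chartAt_quotient_eq (H := H) (Quotient.mk (orbitRel Γ M) x)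
  rw [contMDiffAt_iff_target]
  refine ⟨(isLocalHomeomorph_mk_orbitRel M Γ).continuous.continuousAt, ?_⟩
  have hsrc : Quotient.mk (orbitRel Γ M) x ∈ (localSection Γ x₀).source := by
    rw [← hq]; exact mk_mem_localSection_source x₀
  obtain ⟨γ, hγ⟩ := exists_localSection_eq_smul (mk_mem_localSection_source x) hsrc
  have h1 : extChartAt I (Quotient.mk (orbitRel Γ M) x) ∘ Quotient.mk (orbitRel Γ M) =ᶠ[𝓝 x]
      fun z => extChartAt I x₀ (γ • z) := by
    filter_upwards [eventually_localSection_mk (Γ := Γ) x,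
      (isLocalHomeomorph_mk_orbitRel M Γ).continuous.continuousAt.eventually hγ] with z hz hz'
    simp only [Function.comp_apply, extChartAt, hx₀]
    rw [hz] at hz'
    exact congrArg (fun m => I (chartAt H x₀ m)) hz'
  have h2 : γ • x = x₀ := by
    have := hγ.self_of_nhds
    rw [localSection_mk, ← hq, localSection_mk] at this
    exact this.symm
  refine ContMDiffAt.congr_of_eventuallyEq ?_ h1
  refine ContMDiffAt.comp (g := extChartAt I x₀) x ?_ (h γ x)
  rw [h2]
  exact contMDiffAt_extChartAt

end QuotientProjection

end MBeta

namespace MBeta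

/-! ### The flat `SU(4)`-structure of `ℍ × ℍ` -/

/-- Left multiplication by a quaternion on `ℍ × ℍ`. -/
def leftMul (A : ℍ[ℝ]) : ℍ[ℝ] × ℍ[ℝ] →L[ℝ] ℍ[ℝ] × ℍ[ℝ] :=
  ((ContinuousLinearMap.mul ℝ ℍ[ℝ] A).comp (ContinuousLinearMap.fst ℝ ℍ[ℝ] ℍ[ℝ])).prod
    ((ContinuousLinearMap.mul ℝ ℍ[ℝ] A).comp (ContinuousLinearMap.snd ℝ ℍ[ℝ] ℍ[ℝ]))

theorem leftMul_apply (A : ℍ[ℝ]) (w : ℍ[ℝ] × ℍ[ℝ]) : leftMul A w = (A * w.1, A * w.2) := rfl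

theorem leftMul_leftMul (A B : ℍ[ℝ]) (w : ℍ[ℝ] × ℍ[ℝ]) :
    leftMul A (leftMul B w) = leftMul (A * B) w := by
  simp [leftMul_apply, mul_assoc]

/-- The coordinate `w ↦ ⟨ε, w₁⟩`. -/
def coordFst (ε : ℍ[ℝ]) : ℍ[ℝ] × ℍ[ℝ] →L[ℝ] ℝ :=
  (innerSL ℝ ε).comp (ContinuousLinearMap.fst ℝ ℍ[ℝ] ℍ[ℝ])

/-- The coordinate `w ↦ ⟨ε, w₂⟩`. -/
def coordSnd (ε : ℍ[ℝ]) : ℍ[ℝ] × ℍ[ℝ] →L[ℝ] ℝ :=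
  (innerSL ℝ ε).comp (ContinuousLinearMap.snd ℝ ℍ[ℝ] ℍ[ℝ])

theorem coordFst_apply (ε : ℍ[ℝ]) (w : ℍ[ℝ] × ℍ[ℝ]) : coordFst ε w =
    ε.re * w.1.re + ε.imI * w.1.imI + ε.imJ * w.1.imJ + ε.imK * w.1.imK := by
  simp [coordFst, Quaternion.inner_def]

theorem coordSnd_apply (ε : ℍ[ℝ]) (w : ℍ[ℝ] × ℍ[ℝ]) : coordSnd ε w =
    ε.re * w.2.re + ε.imI * w.2.imI + ε.imJ * w.2.imJ + ε.imK * w.2.imK := by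
  simp [coordSnd, Quaternion.inner_def]

/-- The standard coframe of `ℍ × ℍ`. -/
def flatCoframe : Fin 8 → ℍ[ℝ] × ℍ[ℝ] →L[ℝ] ℝ :=
  ![coordFst ⟨0, 0, 0, 1⟩, coordSnd ⟨1, 0, 0, 0⟩, coordSnd ⟨0, 1, 0, 0⟩, coordFst ⟨0, 0, 1, 0⟩,
    -coordSnd ⟨0, 0, 1, 0⟩, coordFst ⟨0, 1, 0, 0⟩, coordSnd ⟨0, 0, 0, 1⟩, coordFst ⟨1, 0, 0, 0⟩]

theorem flatCoframe_apply (w : ℍ[ℝ] × ℍ[ℝ]) : (fun i => flatCoframe i w) =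
    ![w.1.imK, w.2.re, w.2.imI, w.1.imJ, -w.2.imJ, w.1.imI, w.2.imK, w.1.re] := by
  funext i
  fin_cases i
  · exact (coordFst_apply _ _).trans (by simp)
  · exact (coordSnd_apply _ _).trans (by simp)
  · exact (coordSnd_apply _ _).trans (by simp)
  · exact (coordFst_apply _ _).trans (by simp)
  · exact (congrArg Neg.neg (coordSnd_apply _ _)).trans (by simp)
  · exact (coordFst_apply _ _).trans (by simp)
  · exact (coordSnd_apply _ _).trans (by simp)
  · exact (coordFst_apply _ _).trans (by simp)

theorem zCoord_apply {V : Type*} [AddCommGroup V] [Module ℝ V] [TopologicalSpace V]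
    (E : Fin 8 → V →L[ℝ] ℝ) (v : V) : (fun j => zCoord E j v) =
      ![E 0 v + Complex.I * E 1 v, E 2 v + Complex.I * E 3 v, E 4 v + Complex.I * E 5 v,
        E 6 v + Complex.I * E 7 v] := by
  funext j
  fin_cases j <;> simp [zCoord, cCovector_apply]

theorem zCoord_flatCoframe (w : ℍ[ℝ] × ℍ[ℝ]) : (fun j => zCoord flatCoframe j w) =
    ![w.1.imK + Complex.I * w.2.re, w.2.imI + Complex.I * w.1.imJ, -w.2.imJ + Complex.I * w.1.imI,
      w.2.imK + Complex.I * w.1.re] := by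
  have h := fun i => congrFun (flatCoframe_apply w) i
  rw [zCoord_apply, h, h, h, h, h, h, h, h]
  simp

/-- The matrix of the left multiplication by a quaternion, in the complex coordinates of `ℍ × ℍ`. -/
def leftMulMatrix (A : ℍ[ℝ]) : Matrix (Fin 4) (Fin 4) ℂ :=
  !![(A.re : ℂ), -(Complex.I * A.imI), Complex.I * A.imJ, -(Complex.I * A.imK);
    -(Complex.I * A.imI), A.re, A.imK, A.imJ;
    Complex.I * A.imJ, -A.imK, A.re, A.imI;
    -(Complex.I * A.imK), -A.imJ, -A.imI, A.re]

/-- In these coordinates multiplication by `i` is `(w₁, w₂) ↦ (-w₂ k, -w₁ k)`, which uses only right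
multiplications and a swap. Left multiplications commute with it, so they are complex linear. -/
theorem zCoord_leftMul (A : ℍ[ℝ]) (j : Fin 4) (w : ℍ[ℝ] × ℍ[ℝ]) :
    zCoord flatCoframe j (leftMul A w) =
      ∑ k, leftMulMatrix A j k * zCoord flatCoframe k w := by
  have h1 := congrFun (zCoord_flatCoframe (leftMul A w)) j
  have h2 := fun k => congrFun (zCoord_flatCoframe w) k
  simp only [h1, h2, Fin.sum_univ_four]
  fin_cases j <;> simp [leftMulMatrix, leftMul_apply]
  · linear_combination (A.imI * w.1.imJ - A.imJ * w.1.imI + A.imK * w.1.re : ℂ) * Complex.I_sq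
  · linear_combination (A.imI * w.2.re : ℂ) * Complex.I_sq
  · linear_combination (-(A.imJ * w.2.re) : ℂ) * Complex.I_sq
  · linear_combination (A.imK * w.2.re : ℂ) * Complex.I_sq

/-- The determinant is `|A|⁴`, so a unit quaternion gives a special unitary matrix. -/
theorem det_leftMulMatrix (A : ℍ[ℝ]) :
    (leftMulMatrix A).det = ((Quaternion.normSq A : ℝ) : ℂ) ^ 2 := by
  rw [Quaternion.normSq_def']
  simp [leftMulMatrix, Matrix.det_succ_row_zero, Fin.sum_univ_succ, Fin.succAbove]
  ring_nf
  simp [Complex.I_sq]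
  ring

theorem leftMulMatrix_mem_specialUnitaryGroup {A : ℍ[ℝ]} (hA : Quaternion.normSq A = 1) :
    leftMulMatrix A ∈ Matrix.specialUnitaryGroup (Fin 4) ℂ := by
  rw [Matrix.mem_specialUnitaryGroup_iff]
  refine ⟨?_, by rw [det_leftMulMatrix, hA]; simp⟩
  rw [Quaternion.normSq_def'] at hA
  have h : (A.re : ℂ) ^ 2 + A.imI ^ 2 + A.imJ ^ 2 + A.imK ^ 2 = 1 := by exact_mod_cast hA
  have hI : Complex.I ^ 2 = -1 := Complex.I_sq
  rw [Matrix.mem_unitaryGroup_iff]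
  ext i j
  rw [Matrix.mul_apply, Fin.sum_univ_four]
  fin_cases i <;> fin_cases j <;> simp [leftMulMatrix, Matrix.star_apply] <;> ring_nf <;>
    simp only [hI] <;> first | ring1 | linear_combination h

/-- The standard Kähler form of `ℍ × ℍ`. -/
def flatOmega : (ℍ[ℝ] × ℍ[ℝ]) [⋀^Fin 2]→L[ℝ] ℝ :=
  w2 (flatCoframe 0) (flatCoframe 1) + w2 (flatCoframe 2) (flatCoframe 3) +
    w2 (flatCoframe 4) (flatCoframe 5) + w2 (flatCoframe 6) (flatCoframe 7)

/-- The standard complex volume form of `ℍ × ℍ`. -/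
def flatPsi : (ℍ[ℝ] × ℍ[ℝ]) [⋀^Fin 4]→L[ℝ] ℂ :=
  w4 (zCoord flatCoframe 0) (zCoord flatCoframe 1) (zCoord flatCoframe 2) (zCoord flatCoframe 3)

/-- The standard inner product of `ℍ × ℍ`. -/
def flatInner : ℍ[ℝ] × ℍ[ℝ] →L[ℝ] ℍ[ℝ] × ℍ[ℝ] →L[ℝ] ℝ :=
  (innerSL ℝ).bilinearComp (ContinuousLinearMap.fst ℝ ℍ[ℝ] ℍ[ℝ])
      (ContinuousLinearMap.fst ℝ ℍ[ℝ] ℍ[ℝ]) +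
    (innerSL ℝ).bilinearComp (ContinuousLinearMap.snd ℝ ℍ[ℝ] ℍ[ℝ])
      (ContinuousLinearMap.snd ℝ ℍ[ℝ] ℍ[ℝ])

theorem flatInner_apply (v w : ℍ[ℝ] × ℍ[ℝ]) :
    flatInner v w = inner ℝ v.1 w.1 + inner ℝ v.2 w.2 := rfl

theorem flatInner_comm (v w : ℍ[ℝ] × ℍ[ℝ]) : flatInner v w = flatInner w v := by
  rw [flatInner_apply, flatInner_apply, real_inner_comm, real_inner_comm w.2]

/-- The norm of the product is the maximum of the two norms, hence an inequality; it is the bound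
required by `FlatAtlas.metric`. -/
theorem norm_sq_le_flatInner (v : ℍ[ℝ] × ℍ[ℝ]) : ‖v‖ ^ 2 ≤ flatInner v v := by
  rw [flatInner_apply, real_inner_self_eq_norm_sq, real_inner_self_eq_norm_sq, Prod.norm_def]
  rcases max_cases ‖v.1‖ ‖v.2‖ with h | h <;> rw [h.1] <;>
    nlinarith [sq_nonneg ‖v.1‖, sq_nonneg ‖v.2‖]

theorem flatInner_eq_sum (v w : ℍ[ℝ] × ℍ[ℝ]) :
    flatInner v w = ∑ i, flatCoframe i v * flatCoframe i w := by
  have hv := fun i => congrFun (flatCoframe_apply v) i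
  have hw := fun i => congrFun (flatCoframe_apply w) i
  simp only [Fin.sum_univ_eight, hv, hw, flatInner_apply, Quaternion.inner_def]
  simp
  ring

theorem flatInner_leftMul {A : ℍ[ℝ]} (hA : Quaternion.normSq A = 1) (v w : ℍ[ℝ] × ℍ[ℝ]) :
    flatInner (leftMul A v) (leftMul A w) = flatInner v w := by
  rw [Quaternion.normSq_def'] at hA
  simp only [flatInner_apply, Quaternion.inner_def, leftMul_apply]
  simp
  linear_combination (v.1.re * w.1.re + v.1.imI * w.1.imI + v.1.imJ * w.1.imJ + v.1.imK * w.1.imK +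
    v.2.re * w.2.re + v.2.imI * w.2.imI + v.2.imJ * w.2.imJ + v.2.imK * w.2.imK) * hA

theorem flatOmega_apply (v : Fin 2 → ℍ[ℝ] × ℍ[ℝ]) : flatOmega v =
    ((v 0).1.imK * (v 1).2.re - (v 1).1.imK * (v 0).2.re) +
    ((v 0).2.imI * (v 1).1.imJ - (v 1).2.imI * (v 0).1.imJ) +
    ((v 1).2.imJ * (v 0).1.imI - (v 0).2.imJ * (v 1).1.imI) +
    ((v 0).2.imK * (v 1).1.re - (v 1).2.imK * (v 0).1.re) := by
  have h := fun w i => congrFun (flatCoframe_apply w) i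
  simp only [flatOmega, ContinuousAlternatingMap.add_apply, w2_apply, h]
  simp
  ring

theorem flatOmega_leftMul {A : ℍ[ℝ]} (hA : Quaternion.normSq A = 1) :
    flatOmega.compContinuousLinearMap (leftMul A) = flatOmega := by
  rw [Quaternion.normSq_def'] at hA
  ext v
  have h := flatOmega_apply v
  rw [ContinuousAlternatingMap.compContinuousLinearMap_apply, h, flatOmega_apply]
  simp [leftMul_apply]
  -- The expanded left side is `|A|²` times the explicit value of `flatOmega v`. The hypothesis `h`
  -- trades that value for the symbol `flatOmega v`, and `hA` removes the factor.
  linear_combination (flatOmega v) * hA - (A.re ^ 2 + A.imI ^ 2 + A.imJ ^ 2 + A.imK ^ 2 - 1) * h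

theorem flatPsi_leftMul {A : ℍ[ℝ]} (hA : Quaternion.normSq A = 1) :
    flatPsi.compContinuousLinearMap (leftMul A) = flatPsi := by
  rw [flatPsi, w4_comp]
  have h := w4_eq_det_smul (leftMulMatrix A) (zCoord flatCoframe)
    (fun j => (zCoord flatCoframe j).comp (leftMul A)) (zCoord_leftMul A)
  rwa [det_leftMulMatrix, hA, Complex.ofReal_one, one_pow, one_smul] at h

end MBeta

namespace MBeta

/-! ### The group inside `ℍ × ℍ`. -/

namespace G

/-- The inclusion of `SU(2) ⋉ ℍ` in `ℍ × ℍ`. -/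
def coord (g : G) : ℍ[ℝ] × ℍ[ℝ] := (g.rot, g.trans)

theorem contMDiff_coe_rot : ContMDiff IG 𝓘(ℝ, ℍ[ℝ]) ∞ (fun g : G => (g.rot : ℍ[ℝ])) :=
  contMDiff_coe_sphere.comp contMDiff_rot

theorem contMDiff_coord : ContMDiff IG 𝓘(ℝ, ℍ[ℝ] × ℍ[ℝ]) ∞ coord :=
  contMDiff_coe_rot.prodMk_space contMDiff_trans

theorem normSq_rot (g : G) : Quaternion.normSq (g.rot : ℍ[ℝ]) = 1 := by
  rw [Quaternion.normSq_eq_norm_mul_self, norm_eq_of_mem_sphere, one_mul]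

theorem rot_ne_zero (g : G) : (g.rot : ℍ[ℝ]) ≠ 0 := by
  intro h
  have := normSq_rot g
  rw [h, map_zero] at this
  exact zero_ne_one this

theorem mfderiv_coord_apply (g : G) (v : TangentSpace IG g) :
    mfderiv IG 𝓘(ℝ, ℍ[ℝ] × ℍ[ℝ]) coord g v =
      (mfderiv IG 𝓘(ℝ, ℍ[ℝ]) (fun g : G => (g.rot : ℍ[ℝ])) g v,
        mfderiv IG 𝓘(ℝ, ℍ[ℝ]) (fun g : G => g.trans) g v) := by
  have h0 : HasMFDerivAt IG 𝓘(ℝ, ℍ[ℝ] × ℍ[ℝ]) coord g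
      ((mfderiv IG 𝓘(ℝ, ℍ[ℝ]) (fun g : G => (g.rot : ℍ[ℝ])) g : EG →L[ℝ] ℍ[ℝ]).prod
        (mfderiv IG 𝓘(ℝ, ℍ[ℝ]) (fun g : G => g.trans) g : EG →L[ℝ] ℍ[ℝ])) :=
    have h1 := (contMDiff_coe_rot.mdifferentiableAt (by simp) (x := g)).hasMFDerivAt
    have h2 := (contMDiff_trans.mdifferentiableAt (by simp) (x := g)).hasMFDerivAt
    ⟨h1.1.prodMk h2.1, h1.2.prodMk h2.2⟩
  exact DFunLike.congr_fun h0.mfderiv v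

theorem mfderiv_coe_rot_apply (g : G) (v : TangentSpace IG g) :
    mfderiv IG 𝓘(ℝ, ℍ[ℝ]) (fun g : G => (g.rot : ℍ[ℝ])) g v =
      mfderiv (𝓡 3) 𝓘(ℝ, ℍ[ℝ]) ((↑) : Metric.sphere (0 : ℍ[ℝ]) 1 → ℍ[ℝ]) g.rot v.1 := by
  have h : HasMFDerivAt IG (𝓡 3) rot g
      (ContinuousLinearMap.fst ℝ (EuclideanSpace ℝ (Fin 3)) ℍ[ℝ] : EG →L[ℝ] _) :=
    hasMFDerivAt_fst g
  have h1 := (contMDiff_coe_sphere (m := ∞) (E := ℍ[ℝ]) (n := 3)).mdifferentiableAt (by simp)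
    (x := g.rot)
  exact DFunLike.congr_fun (h1.hasMFDerivAt.comp g h).mfderiv v

theorem mfderiv_trans_apply (g : G) (v : TangentSpace IG g) :
    mfderiv IG 𝓘(ℝ, ℍ[ℝ]) (fun g : G => g.trans) g v = v.2 := by
  have h : HasMFDerivAt IG 𝓘(ℝ, ℍ[ℝ]) trans g
      (ContinuousLinearMap.snd ℝ (EuclideanSpace ℝ (Fin 3)) ℍ[ℝ] : EG →L[ℝ] _) :=
    hasMFDerivAt_snd g
  exact DFunLike.congr_fun h.mfderiv v

/-- The inclusion of the sphere is an immersion, and the translation component is the identity. -/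
theorem mfderiv_coord_injective (g : G) :
    Function.Injective (mfderiv IG 𝓘(ℝ, ℍ[ℝ] × ℍ[ℝ]) coord g) := by
  intro v w h
  rw [mfderiv_coord_apply, mfderiv_coord_apply, mfderiv_coe_rot_apply, mfderiv_coe_rot_apply,
    mfderiv_trans_apply, mfderiv_trans_apply] at h
  have h' := Prod.mk.inj h
  exact Prod.ext (injective_mvfderiv_subtypeVal_sphere g.rot h'.1) h'.2

/-- Differentiate `⟨A, A⟩ = 1`. This is what makes `A⁻¹ dA` purely imaginary. -/
theorem inner_rot_mfderiv_coord (g : G) (v : TangentSpace IG g) :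
    inner ℝ (g.rot : ℍ[ℝ]) (mfderiv IG 𝓘(ℝ, ℍ[ℝ] × ℍ[ℝ]) coord g v).1 = 0 := by
  have h := contMDiff_coe_rot.mdifferentiableAt (by simp) (x := g)
  have h1 := mfderiv_bilinear (innerSL ℝ) h h v
  have h2 : (fun z : G => innerSL ℝ (z.rot : ℍ[ℝ]) (z.rot : ℍ[ℝ])) = fun _ => 1 := by
    funext z
    rw [innerSL_apply_apply, real_inner_self_eq_norm_sq, norm_eq_of_mem_sphere, one_pow]
  rw [h2, mfderiv_const] at h1
  let d : ℍ[ℝ] := mfderiv IG 𝓘(ℝ, ℍ[ℝ]) (fun g : G => (g.rot : ℍ[ℝ])) g v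
  have h3 : (0 : ℝ) = inner ℝ (g.rot : ℍ[ℝ]) d + inner ℝ d (g.rot : ℍ[ℝ]) := h1
  rw [real_inner_comm (g.rot : ℍ[ℝ])] at h3
  have h4 : inner ℝ (g.rot : ℍ[ℝ]) d = 0 := by linarith
  rw [mfderiv_coord_apply]
  exact h4

/-- Left translations are restrictions of affine maps of `ℍ × ℍ`, which is why the quotient inherits
an affine structure. -/
theorem coord_mul (g h : G) : coord (g * h) = leftMul g.rot (coord h) + (0, g.trans) :=
  Prod.ext (add_zero _).symm rfl

end G

/-- The components of the Maurer-Cartan form which define the left-invariant coframe. -/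
def groupCoframe (a : ℝ) : Fin 7 → ℍ[ℝ] × ℍ[ℝ] →L[ℝ] ℝ :=
  ![(2 / a) • flatCoframe 0, flatCoframe 1, flatCoframe 2, (2 / a) • flatCoframe 3, flatCoframe 4,
    (2 / a) • flatCoframe 5, flatCoframe 6]

theorem leftCoframe_apply (a : ℝ) (i : Fin 7) (g : G) (v : TangentSpace IG g) :
    leftCoframe a i g v = groupCoframe a i
      (leftMul (g.rot : ℍ[ℝ])⁻¹ (mfderiv IG 𝓘(ℝ, ℍ[ℝ] × ℍ[ℝ]) G.coord g v)) := by
  have h := G.mfderiv_coord_apply g v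
  have h' : ∀ θ : ℍ[ℝ] × ℍ[ℝ] →L[ℝ] ℝ, θ (leftMul (g.rot : ℍ[ℝ])⁻¹
      (mfderiv IG 𝓘(ℝ, ℍ[ℝ] × ℍ[ℝ]) G.coord g v)) = θ (leftMul (g.rot : ℍ[ℝ])⁻¹
      (mfderiv IG 𝓘(ℝ, ℍ[ℝ]) (fun g : G => (g.rot : ℍ[ℝ])) g v,
        mfderiv IG 𝓘(ℝ, ℍ[ℝ]) (fun g : G => g.trans) g v)) := fun θ =>
    congrArg (fun w => θ (leftMul (g.rot : ℍ[ℝ])⁻¹ w)) h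
  refine Eq.trans ?_ (h' _).symm
  fin_cases i <;> rfl

/-! ### Developing maps and the Maurer–Cartan form of `M_β`. -/

namespace LatticeData

variable (D : LatticeData)

theorem contMDiff_smul (γ : D.Γ) : ContMDiff IG IG ∞ (fun x : G => γ • x) :=
  G.contMDiff_mul_left (γ : G)

theorem contMDiff_proj : ContMDiff IG IG ∞ D.proj := contMDiff_quotientMk D.contMDiff_smul

/-- The developing map of `M_β` with values in `S³ × ℍ`, defined by the local section through
`x`. -/
def devel (x : G) (y : D.M) : ℍ[ℝ] × ℍ[ℝ] := G.coord (localSection D.Γ x y)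

/-- The differential of the developing map. -/
def dDevel (x : G) (y : D.M) : TangentSpace IG y →L[ℝ] ℍ[ℝ] × ℍ[ℝ] :=
  mfderiv IG 𝓘(ℝ, ℍ[ℝ] × ℍ[ℝ]) (D.devel x) y

variable {D}

theorem contMDiffAt_devel {x : G} {y : D.M} (hy : y ∈ (localSection D.Γ x).source) :
    ContMDiffAt IG 𝓘(ℝ, ℍ[ℝ] × ℍ[ℝ]) ∞ (D.devel x) y :=
  (G.contMDiff_coord _).comp y (contMDiffAt_localSection D.contMDiff_smul hy)

theorem contMDiffOn_devel (x : G) :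
    ContMDiffOn IG 𝓘(ℝ, ℍ[ℝ] × ℍ[ℝ]) ∞ (D.devel x) (localSection D.Γ x).source :=
  fun _ hy => (contMDiffAt_devel hy).contMDiffWithinAt

theorem dDevel_apply {x : G} {y : D.M} (hy : y ∈ (localSection D.Γ x).source)
    (v : TangentSpace IG y) : D.dDevel x y v =
      mfderiv IG 𝓘(ℝ, ℍ[ℝ] × ℍ[ℝ]) G.coord (localSection D.Γ x y)
        (mfderiv IG IG (localSection D.Γ x) y v) :=
  mfderiv_comp_apply y (G.contMDiff_coord.mdifferentiableAt (by simp))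
    ((contMDiffAt_localSection D.contMDiff_smul hy).mdifferentiableAt (by simp)) v

theorem dDevel_proj {x : G} (v : TangentSpace IG x) :
    D.dDevel x (D.proj x) (mfderiv IG IG D.proj x v) =
      mfderiv IG 𝓘(ℝ, ℍ[ℝ] × ℍ[ℝ]) G.coord x v := by
  have hx : D.proj x ∈ (localSection D.Γ x).source := mk_mem_localSection_source x
  have h1 := mfderiv_comp_apply x ((contMDiffAt_devel hx).mdifferentiableAt (by simp))
    (D.contMDiff_proj.mdifferentiableAt (by simp)) v
  have h2 : D.devel x ∘ D.proj =ᶠ[𝓝 x] G.coord := by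
    filter_upwards [eventually_localSection_mk (Γ := D.Γ) x] with z hz
    exact congrArg G.coord hz
  exact h1.symm.trans (DFunLike.congr_fun h2.mfderiv_eq v)

theorem mfderiv_localSection_injective {x : G} {y : D.M}
    (hy : y ∈ (localSection D.Γ x).source) :
    Function.Injective (mfderiv IG IG (localSection D.Γ x) y) := by
  have h1 : D.proj ∘ localSection D.Γ x =ᶠ[𝓝 y] id := by
    filter_upwards [eventually_mem_localSection_source hy] with z hz
    exact mk_localSection hz
  have h2 : ∀ v : TangentSpace IG y, mfderiv IG IG D.proj (localSection D.Γ x y)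
      (mfderiv IG IG (localSection D.Γ x) y v) = v := fun v => by
    have h3 := mfderiv_comp_apply y (D.contMDiff_proj.mdifferentiableAt (by simp))
      ((contMDiffAt_localSection D.contMDiff_smul hy).mdifferentiableAt (by simp)) v
    refine h3.symm.trans ((DFunLike.congr_fun h1.mfderiv_eq v).trans ?_)
    exact DFunLike.congr_fun mfderiv_id v
  exact Function.LeftInverse.injective
    (g := fun w => mfderiv IG IG D.proj (localSection D.Γ x y) w) h2

theorem dDevel_injective {x : G} {y : D.M} (hy : y ∈ (localSection D.Γ x).source) :
    Function.Injective (D.dDevel x y) := by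
  intro v w h
  rw [dDevel_apply hy, dDevel_apply hy] at h
  exact mfderiv_localSection_injective hy (G.mfderiv_coord_injective _ h)

theorem inner_devel_dDevel {x : G} {y : D.M} (hy : y ∈ (localSection D.Γ x).source)
    (v : TangentSpace IG y) : inner ℝ (D.devel x y).1 (D.dDevel x y v).1 = 0 := by
  rw [dDevel_apply hy]
  exact G.inner_rot_mfderiv_coord _ _

theorem normSq_devel (x : G) (y : D.M) : Quaternion.normSq (D.devel x y).1 = 1 := G.normSq_rot _

theorem devel_ne_zero (x : G) (y : D.M) : (D.devel x y).1 ≠ 0 := G.rot_ne_zero _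

/-- Two developing maps differ locally by an affine map with linear part in `⟨A_β⟩`. -/
theorem exists_devel_eq {x x' : G} {y : D.M} (hy : y ∈ (localSection D.Γ x).source)
    (hy' : y ∈ (localSection D.Γ x').source) :
    ∃ A ∈ Subgroup.zpowers (rotA D.β), ∃ q : ℍ[ℝ],
      ∀ᶠ z in 𝓝 y, D.devel x' z = leftMul (A : ℍ[ℝ]) (D.devel x z) + (0, q) := by
  obtain ⟨γ, hγ⟩ := exists_localSection_eq_smul hy hy'
  refine ⟨(γ : G).rot, γ.2.1, (γ : G).trans, ?_⟩
  filter_upwards [hγ] with z hz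
  exact (congrArg G.coord hz).trans (G.coord_mul _ _)

theorem dDevel_eq_of_eventually_eq {x x' : G} {y : D.M} (hy : y ∈ (localSection D.Γ x).source)
    {A q : ℍ[ℝ]} (h : ∀ᶠ z in 𝓝 y, D.devel x' z = leftMul A (D.devel x z) + (0, q))
    (v : TangentSpace IG y) : D.dDevel x' y v = leftMul A (D.dDevel x y v) := by
  have h1 : HasFDerivAt (fun w => leftMul A w + (0, q)) (leftMul A) (D.devel x y) :=
    (leftMul A).hasFDerivAt.add_const _
  have h2 := h1.hasMFDerivAt.comp y
    ((contMDiffAt_devel hy).mdifferentiableAt (by simp)).hasMFDerivAt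
  have h3 : D.devel x' =ᶠ[𝓝 y] (fun w => leftMul A w + (0, q)) ∘ D.devel x := h
  exact (DFunLike.congr_fun h3.mfderiv_eq v).trans (DFunLike.congr_fun h2.mfderiv v)

variable (D) in
/-- The form `A⁻¹ d(A, q)` on `M_β`. -/
def maurerCartan (x : G) (y : D.M) : TangentSpace IG y →L[ℝ] ℍ[ℝ] × ℍ[ℝ] :=
  (leftMul (D.devel x y).1⁻¹).comp (D.dDevel x y)

/-- Changing the section multiplies both `A` and `d(A, q)` on the left by the same constant
quaternion, which cancels in `A⁻¹ d(A, q)`. -/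
theorem maurerCartan_eq {x x' : G} {y : D.M} (hy : y ∈ (localSection D.Γ x).source)
    (hy' : y ∈ (localSection D.Γ x').source) : D.maurerCartan x' y = D.maurerCartan x y := by
  obtain ⟨A, -, q, h⟩ := exists_devel_eq hy hy'
  ext1 v
  have hA : (A : ℍ[ℝ]) ≠ 0 := fun h => by
    have := norm_eq_of_mem_sphere A
    rw [h, norm_zero] at this
    exact zero_ne_one this
  have h1 : (D.devel x' y).1 = A * (D.devel x y).1 := by
    rw [h.self_of_nhds]
    exact add_zero _
  have h2 : leftMul (D.devel x' y).1⁻¹ (D.dDevel x' y v) =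
      leftMul (D.devel x y).1⁻¹ (D.dDevel x y v) := by
    rw [dDevel_eq_of_eventually_eq hy h, leftMul_leftMul, h1, mul_inv_rev, mul_assoc,
      inv_mul_cancel₀ hA, mul_one]
  exact h2

variable (D) in
/-- The coframe of `M_β` induced by the left-invariant coframe. -/
def coframe (a : ℝ) (i : Fin 7) (y : D.M) : TangentSpace IG y →L[ℝ] ℝ :=
  (groupCoframe a i).comp (D.maurerCartan (Quotient.out y) y)

theorem mem_localSection_out (y : D.M) : y ∈ (localSection D.Γ (Quotient.out y)).source := by
  have h := mk_mem_localSection_source (Γ := D.Γ) (Quotient.out y)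
  rwa [Quotient.out_eq] at h

theorem coframe_eq (a : ℝ) (i : Fin 7) {x : G} {y : D.M}
    (hy : y ∈ (localSection D.Γ x).source) :
    D.coframe a i y = (groupCoframe a i).comp (D.maurerCartan x y) := by
  rw [coframe, maurerCartan_eq hy (mem_localSection_out y)]

theorem isInducedCoframe_coframe (a : ℝ) : IsInducedCoframe D a (D.coframe a) := by
  intro i x
  have hx : D.proj x ∈ (localSection D.Γ x).source := mk_mem_localSection_source x
  rw [coframe_eq a i hx]
  ext1 v
  rw [leftCoframe_apply]
  have h1 : (D.devel x (D.proj x)).1 = (x.rot : ℍ[ℝ]) :=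
    congrArg (fun g : G => (g.rot : ℍ[ℝ])) (localSection_mk x)
  have h2 := dDevel_proj (D := D) v
  have h3 : leftMul (D.devel x (D.proj x)).1⁻¹
      (D.dDevel x (D.proj x) (mfderiv IG IG D.proj x v)) =
      leftMul (x.rot : ℍ[ℝ])⁻¹ (mfderiv IG 𝓘(ℝ, ℍ[ℝ] × ℍ[ℝ]) G.coord x v) := by
    rw [h1]
    exact congrArg _ h2
  exact congrArg _ h3

end LatticeData

end MBeta

namespace MBeta

/-! ### The forms expressed by scaling and contraction in `ℍ × ℍ`. -/

section Pointwise

variable {V : Type*} [AddCommGroup V] [Module ℝ V] [TopologicalSpace V]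

/-- The linear vector field `(x, q) ↦ (x, 0)` on `ℍ × ℍ`. -/
def radial : ℍ[ℝ] × ℍ[ℝ] →L[ℝ] ℍ[ℝ] × ℍ[ℝ] := (ContinuousLinearMap.fst ℝ ℍ[ℝ] ℍ[ℝ]).prod 0

/-- The map `(x, q) ↦ (r x, q)` on `ℍ × ℍ`. -/
def scaleFst (r : ℝ) : ℍ[ℝ] × ℍ[ℝ] →L[ℝ] ℍ[ℝ] × ℍ[ℝ] :=
  r • radial + (0 : ℍ[ℝ] × ℍ[ℝ] →L[ℝ] ℍ[ℝ]).prod (ContinuousLinearMap.snd ℝ ℍ[ℝ] ℍ[ℝ])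

theorem scaleFst_apply (r : ℝ) (w : ℍ[ℝ] × ℍ[ℝ]) : scaleFst r w = (r • w.1, w.2) := by
  simp [scaleFst, radial]

theorem hasDerivAt_const_add_smul_add {W : Type*} [NormedAddCommGroup W] [NormedSpace ℝ W]
    (X Y : W) (c t : ℝ) : HasDerivAt (fun s : ℝ => (c + s) • X + Y) X t := by
  simpa using (((hasDerivAt_id t).const_add c).smul_const X).add_const Y

theorem hasDerivAt_scaleFst (c t : ℝ) : HasDerivAt (fun s => scaleFst (c + s)) radial t :=
  hasDerivAt_const_add_smul_add (W := ℍ[ℝ] × ℍ[ℝ] →L[ℝ] ℍ[ℝ] × ℍ[ℝ]) radial _ c t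

theorem leftMul_scaleFst (A : ℍ[ℝ]) (r : ℝ) (w : ℍ[ℝ] × ℍ[ℝ]) :
    leftMul A (scaleFst r w) = scaleFst r (leftMul A w) := by
  simp [scaleFst_apply, leftMul_apply]

/-- The constant comes from `(1 + a t / 2) (2 / a) = 2 / a + t`: scaling the coframe by `u` on the
indices 1, 4, 6 is scaling the first quaternion. -/
theorem scaledCoframe_groupCoframe {a : ℝ} (ha : a ≠ 0) (t : ℝ) (ζ : V →L[ℝ] ℍ[ℝ] × ℍ[ℝ])
    (i : Fin 7) :
    scaledCoframe (1 + a * t / 2) 1 (fun i => (groupCoframe a i).comp ζ) i =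
      (flatCoframe i.castSucc).comp ((scaleFst (2 / a + t)).comp ζ) := by
  have h := fun w => congrFun (flatCoframe_apply w)
  ext v
  fin_cases i <;> simp [scaledCoframe, groupCoframe, scaleFst_apply, h] <;> field_simp

/-- `flatOmega` has one extra term, containing the real part of the first quaternion, and this
vanishes on `ζ`. -/
theorem omegaForm_groupCoframe {a : ℝ} (ha : a ≠ 0) (t : ℝ) {ζ : V →L[ℝ] ℍ[ℝ] × ℍ[ℝ]}
    (hζ : ∀ v, (ζ v).1.re = 0) :
    omegaForm (1 + a * t / 2) 1 (fun i => (groupCoframe a i).comp ζ) =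
      flatOmega.compContinuousLinearMap ((scaleFst (2 / a + t)).comp ζ) := by
  rw [omegaForm_eq]
  simp only [scaledCoframe_groupCoframe ha]
  have h7 : (flatCoframe 7).comp ((scaleFst (2 / a + t)).comp ζ) = 0 := by
    ext v
    have h := congrFun (flatCoframe_apply (scaleFst (2 / a + t) (ζ v))) 7
    simpa [scaleFst_apply, hζ] using h
  ext v
  simp only [flatOmega, ContinuousAlternatingMap.compContinuousLinearMap_apply,
    ContinuousAlternatingMap.add_apply, w2_apply]
  have h7' := fun v => DFunLike.congr_fun h7 v
  simp only [ContinuousLinearMap.comp_apply, zero_apply] at h7'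
  simp [h7']

theorem cForm_psi_groupCoframe {a : ℝ} (ha : a ≠ 0) (t : ℝ) (ζ : V →L[ℝ] ℍ[ℝ] × ℍ[ℝ]) :
    cForm (psiPlus (1 + a * t / 2) 1 (fun i => (groupCoframe a i).comp ζ))
      (psiMinus (1 + a * t / 2) 1 (fun i => (groupCoframe a i).comp ζ)) =
      (w3 (zCoord flatCoframe 0) (zCoord flatCoframe 1)
        (zCoord flatCoframe 2)).compContinuousLinearMap ((scaleFst (2 / a + t)).comp ζ) := by
  rw [cForm_psi_eq, w3_comp]
  simp only [scaledCoframe_groupCoframe ha]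
  rfl

/-- The vector `(1, 0)` has complex coordinates `(0, 0, 0, i)`, so only the term with the fourth
covector in the first slot survives, with sign `-1`. -/
theorem flatPsi_vecCons (v : Fin 3 → ℍ[ℝ] × ℍ[ℝ]) : flatPsi (Matrix.vecCons (1, 0) v) =
    -Complex.I * w3 (zCoord flatCoframe 0) (zCoord flatCoframe 1) (zCoord flatCoframe 2) v := by
  have h := fun j => congrFun (zCoord_flatCoframe (1, 0)) j
  have h0 : (![v 0, v 1, v 2] : Fin 3 → ℍ[ℝ] × ℍ[ℝ]) = v := by
    funext i; fin_cases i <;> rfl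
  rw [flatPsi, w4_apply]
  simp [w3_apply, h]

theorem psiMinus_groupCoframe {a : ℝ} (ha : a ≠ 0) (t : ℝ) (ζ : V →L[ℝ] ℍ[ℝ] × ℍ[ℝ])
    (v : Fin 3 → V) :
    psiMinus (1 + a * t / 2) 1 (fun i => (groupCoframe a i).comp ζ) v =
      (flatPsi (Matrix.vecCons (1, 0) (scaleFst (2 / a + t) ∘ ζ ∘ v))).re := by
  have h := DFunLike.congr_fun (cForm_psi_groupCoframe ha t ζ) v
  rw [cForm_apply] at h
  have h2 := flatPsi_vecCons (scaleFst (2 / a + t) ∘ ζ ∘ v)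
  have h3 := h2.trans (congrArg (fun z => -Complex.I * z) h.symm)
  rw [h3]
  simp

theorem psiPlus_groupCoframe {a : ℝ} (ha : a ≠ 0) (t : ℝ) (ζ : V →L[ℝ] ℍ[ℝ] × ℍ[ℝ])
    (v : Fin 3 → V) :
    psiPlus (1 + a * t / 2) 1 (fun i => (groupCoframe a i).comp ζ) v =
      -(flatPsi (Matrix.vecCons (1, 0) (scaleFst (2 / a + t) ∘ ζ ∘ v))).im := by
  have h := DFunLike.congr_fun (cForm_psi_groupCoframe ha t ζ) v
  rw [cForm_apply] at h
  have h2 := flatPsi_vecCons (scaleFst (2 / a + t) ∘ ζ ∘ v)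
  have h3 := h2.trans (congrArg (fun z => -Complex.I * z) h.symm)
  rw [h3]
  simp

theorem etaForm_groupCoframe {a : ℝ} (t : ℝ) {ζ : V →L[ℝ] ℍ[ℝ] × ℍ[ℝ]} (v : Fin 1 → V) :
    oneForm (etaForm 1 (fun i => (groupCoframe a i).comp ζ)) v =
      -flatOmega (Matrix.vecCons (1, 0) (scaleFst (2 / a + t) ∘ ζ ∘ v)) := by
  have h := fun w => congrFun (flatCoframe_apply w)
  rw [flatOmega_apply, oneForm_apply]
  simp [etaForm, groupCoframe, h, scaleFst_apply]

theorem wedge_cForm_apply {k : ℕ} (α β : V [⋀^Fin k]→L[ℝ] ℝ) (η : V →L[ℝ] ℝ) (v : Fin (k + 1) → V) :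
    wedge (cForm α β) (cCovector η 0) v = wedge α η v + Complex.I * wedge β η v := by
  simp only [wedge_apply, cForm_apply, cCovector_apply]
  push_cast
  rw [Finset.mul_sum, ← Finset.sum_add_distrib]
  refine Finset.sum_congr rfl fun i _ => ?_
  simp
  ring

/-- With vanishing real part in the first quaternion, the fourth complex coordinate becomes the real
covector `η`. -/
theorem flatPsi_comp_apply {a : ℝ} (ha : a ≠ 0) (t : ℝ) {ζ : V →L[ℝ] ℍ[ℝ] × ℍ[ℝ]}
    (hζ : ∀ v, (ζ v).1.re = 0) (v : Fin 4 → V) :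
    flatPsi.compContinuousLinearMap ((scaleFst (2 / a + t)).comp ζ) v =
      wedge (psiPlus (1 + a * t / 2) 1 (fun i => (groupCoframe a i).comp ζ))
        (etaForm 1 (fun i => (groupCoframe a i).comp ζ)) v +
      Complex.I * wedge (psiMinus (1 + a * t / 2) 1 (fun i => (groupCoframe a i).comp ζ))
        (etaForm 1 (fun i => (groupCoframe a i).comp ζ)) v := by
  rw [← wedge_cForm_apply, cForm_psi_groupCoframe ha, flatPsi, w4, wedge_comp]
  congr 2
  ext v
  have h := congrFun (zCoord_flatCoframe (scaleFst (2 / a + t) (ζ v))) 3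
  refine h.trans ?_
  have h6 := congrFun (flatCoframe_apply (ζ v)) 6
  simp only [cCovector_apply, etaForm, groupCoframe]
  simp [scaleFst_apply, hζ, h6]

/-- The radial vector at `w` is `w.1` times `(1, 0)`. Invariance of `β` strips the factor `w.1` from
all arguments, turning a contraction with a moving vector into a left-invariant expression. -/
theorem contraction_radial_scaleFst {A : Type*} [NormedAddCommGroup A] [NormedSpace ℝ A] {k : ℕ}
    {β : (ℍ[ℝ] × ℍ[ℝ]) [⋀^Fin (k + 1)]→L[ℝ] A} {w : ℍ[ℝ] × ℍ[ℝ]} (hw : w.1 ≠ 0)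
    (hβ : β.compContinuousLinearMap (leftMul w.1) = β) (r : ℝ) (v : Fin k → ℍ[ℝ] × ℍ[ℝ]) :
    contraction β radial (scaleFst r) w v =
      β (Matrix.vecCons (1, 0) (scaleFst r ∘ leftMul w.1⁻¹ ∘ v)) := by
  rw [contraction_apply]
  conv_rhs => rw [← hβ, ContinuousAlternatingMap.compContinuousLinearMap_apply]
  congr 1
  funext i
  refine Fin.cases ?_ (fun i => ?_) i
  · simp [leftMul_apply, radial]
  · simp [leftMul_scaleFst, leftMul_leftMul, hw]
    simp [leftMul_apply]

end Pointwise

section LinearIndependence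

theorem linearIndependent_of_joint_kernel {V : Type*} [AddCommGroup V] [Module ℝ V]
    [TopologicalSpace V] [IsTopologicalAddGroup V] [ContinuousConstSMul ℝ V] {n : ℕ}
    (hn : Module.finrank ℝ V = n) (E : Fin n → V →L[ℝ] ℝ)
    (hE : ∀ v, (∀ i, E i v = 0) → v = 0) : LinearIndependent ℝ E := by
  rw [Fintype.linearIndependent_iff]
  intro c hc i
  let T : V →ₗ[ℝ] Fin n → ℝ := LinearMap.pi fun i => (E i : V →ₗ[ℝ] ℝ)
  have hT : Function.Injective T :=
    (injective_iff_map_eq_zero T).2 fun v hv => hE v fun i => congrFun hv i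
  have : FiniteDimensional ℝ V := FiniteDimensional.of_injective T hT
  -- Take a vector whose coordinates are the coefficients of the supposed relation: evaluating the
  -- relation on it gives a sum of squares equal to zero.
  obtain ⟨v, hv⟩ := (LinearMap.injective_iff_surjective_of_finrank_eq_finrank
    (f := T) (by simp [hn])).1 hT c
  have h1 : ∀ i, E i v = c i := fun i => congrFun hv i
  have h2 : ∑ i, c i * c i = 0 := by
    have := DFunLike.congr_fun hc v
    simpa [h1] using this
  exact mul_self_eq_zero.1 ((Finset.sum_eq_zero_iff_of_nonneg fun i _ => mul_self_nonneg _).1 h2 i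
    (Finset.mem_univ i))

end LinearIndependence

end MBeta

/-! ### The forms on `M_β` as pullbacks, and the evolution equations. -/

namespace MBeta

/-- The real part of the standard complex volume form of `ℍ × ℍ`. -/
def flatPsiRe : (ℍ[ℝ] × ℍ[ℝ]) [⋀^Fin 4]→L[ℝ] ℝ :=
  Complex.reCLM.compContinuousAlternatingMap flatPsi

/-- The imaginary part of the standard complex volume form of `ℍ × ℍ`. -/
def flatPsiIm : (ℍ[ℝ] × ℍ[ℝ]) [⋀^Fin 4]→L[ℝ] ℝ :=
  Complex.imCLM.compContinuousAlternatingMap flatPsi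

theorem flatPsiRe_leftMul {A : ℍ[ℝ]} (hA : Quaternion.normSq A = 1) :
    flatPsiRe.compContinuousLinearMap (leftMul A) = flatPsiRe :=
  congrArg Complex.reCLM.compContinuousAlternatingMap (flatPsi_leftMul hA)

theorem flatPsiIm_leftMul {A : ℍ[ℝ]} (hA : Quaternion.normSq A = 1) :
    flatPsiIm.compContinuousLinearMap (leftMul A) = flatPsiIm :=
  congrArg Complex.imCLM.compContinuousAlternatingMap (flatPsi_leftMul hA)

namespace LatticeData

variable {D : LatticeData} {x : G} {y : D.M}

/-- For a unit quaternion, the real part of `A⁻¹ dA` is `⟨A, dA⟩`, which vanishes on the sphere. -/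
theorem re_maurerCartan (hy : y ∈ (localSection D.Γ x).source) (v : TangentSpace IG y) :
    (D.maurerCartan x y v).1.re = 0 := by
  have h1 := inner_devel_dDevel hy v
  have h2 := normSq_devel x y
  have h3 : (D.maurerCartan x y v).1 = (D.devel x y).1⁻¹ * (D.dDevel x y v).1 := rfl
  rw [h3, Quaternion.inv_def, h2, inv_one, one_smul]
  rw [Quaternion.inner_def] at h1
  simp at h1 ⊢
  linarith

theorem maurerCartan_injective (hy : y ∈ (localSection D.Γ x).source) :
    Function.Injective (D.maurerCartan x y) := by
  refine Function.Injective.comp (g := leftMul (D.devel x y).1⁻¹) ?_ (dDevel_injective hy)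
  refine Function.LeftInverse.injective (g := leftMul (D.devel x y).1) fun w => ?_
  rw [leftMul_leftMul, mul_inv_cancel₀ (devel_ne_zero x y)]
  simp [leftMul_apply]

theorem linearIndependent_coframe {a : ℝ} (ha : a ≠ 0) (y : D.M) :
    LinearIndependent ℝ (fun i => D.coframe a i y) := by
  have hy := mem_localSection_out y
  refine linearIndependent_of_joint_kernel (V := EG) ?_ _ fun v hv => ?_
  · rw [Module.finrank_prod, finrank_euclideanSpace_fin, Quaternion.finrank_eq_four]
  · refine maurerCartan_injective hy
      ((?_ : _ = (0 : ℍ[ℝ] × ℍ[ℝ])).trans (map_zero (D.maurerCartan _ y)).symm)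
    have hre := re_maurerCartan hy v
    have hv' : ∀ i, groupCoframe a i (D.maurerCartan (Quotient.out y) y v) = 0 := hv
    generalize D.maurerCartan (Quotient.out y) y v = w at hre hv'
    have h := fun i => congrFun (flatCoframe_apply w) i
    have h0 := hv' 0
    have h1 := hv' 1
    have h2 := hv' 2
    have h3 := hv' 3
    have h4 := hv' 4
    have h5 := hv' 5
    have h6 := hv' 6
    simp [groupCoframe, h, ha] at h0 h1 h2 h3 h4 h5 h6
    exact Prod.ext (Quaternion.ext _ _ hre h5 h3 h0) (Quaternion.ext _ _ h1 h2 h4 h6)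

/-- Invariance of `β` absorbs the factor `A⁻¹`, leaving the pullback of a constant form by a
developing map, whose exterior derivative is zero. -/
theorem compContinuousLinearMap_maurerCartan {A : Type*} [NormedAddCommGroup A] [NormedSpace ℝ A]
    {k : ℕ} {β : (ℍ[ℝ] × ℍ[ℝ]) [⋀^Fin k]→L[ℝ] A}
    (hβ : ∀ q, Quaternion.normSq q = 1 → β.compContinuousLinearMap (leftMul q) = β) (r : ℝ) :
    β.compContinuousLinearMap ((scaleFst r).comp (D.maurerCartan x y)) =
      (β.compContinuousLinearMap (scaleFst r)).compContinuousLinearMap (D.dDevel x y) := by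
  have hA : Quaternion.normSq (D.devel x y).1⁻¹ = 1 := by
    rw [map_inv₀, normSq_devel, inv_one]
  conv_rhs => rw [← hβ _ hA]
  ext v
  simp only [ContinuousAlternatingMap.compContinuousLinearMap_apply]
  congr 1
  funext i
  exact (leftMul_scaleFst _ _ _).symm

theorem contraction_comp_dDevel {A : Type*} [NormedAddCommGroup A] [NormedSpace ℝ A]
    {k : ℕ} {β : (ℍ[ℝ] × ℍ[ℝ]) [⋀^Fin (k + 1)]→L[ℝ] A}
    (hβ : ∀ q, Quaternion.normSq q = 1 → β.compContinuousLinearMap (leftMul q) = β) (r : ℝ)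
    (v : Fin k → TangentSpace IG y) :
    (contraction β radial (scaleFst r) (D.devel x y)).compContinuousLinearMap (D.dDevel x y) v =
      β (Matrix.vecCons (1, 0) (scaleFst r ∘ D.maurerCartan x y ∘ v)) :=
  contraction_radial_scaleFst (devel_ne_zero x y) (hβ _ (normSq_devel x y)) r _

section Families

variable {a : ℝ} {u v : ℝ → ℝ}

theorem omegaFam_eq (ha : a ≠ 0) (hu : ∀ t, u t = 1 + a * t / 2) (hv : ∀ t, v t = 1)
    (hy : y ∈ (localSection D.Γ x).source) (t : ℝ) :
    omegaFam u v (D.coframe a) t y = (flatOmega.compContinuousLinearMap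
      (scaleFst (2 / a + t))).compContinuousLinearMap (D.dDevel x y) := by
  rw [← compContinuousLinearMap_maurerCartan fun q => flatOmega_leftMul, omegaFam, hu, hv]
  simp only [coframe_eq a _ hy]
  exact omegaForm_groupCoframe ha t (re_maurerCartan hy)

/-- Unlike `ω`, the form `η` is the pullback of a form depending linearly on the point, so it is not
closed; the same holds for `ψ±` below. The contracted constant form is the one whose scaled pullback
appears on the other side of the evolution equation. -/
theorem etaFam_eq (hv : ∀ t, v t = 1) (hy : y ∈ (localSection D.Γ x).source) (t : ℝ) :
    oneForm (etaFam v (D.coframe a) t y) = (contraction (-flatOmega) radial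
      (scaleFst (2 / a + t)) (D.devel x y)).compContinuousLinearMap (D.dDevel x y) := by
  ext w
  refine Eq.trans ?_ (contraction_comp_dDevel (fun q hq => ?_) _ w).symm
  · rw [etaFam, hv]
    simp only [coframe_eq a _ hy]
    exact etaForm_groupCoframe t w
  · exact congrArg Neg.neg (flatOmega_leftMul hq)

theorem psiMinusFam_eq (ha : a ≠ 0) (hu : ∀ t, u t = 1 + a * t / 2) (hv : ∀ t, v t = 1)
    (hy : y ∈ (localSection D.Γ x).source) (t : ℝ) :
    psiMinusFam u v (D.coframe a) t y = (contraction flatPsiRe radial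
      (scaleFst (2 / a + t)) (D.devel x y)).compContinuousLinearMap (D.dDevel x y) := by
  ext w
  refine Eq.trans ?_ (contraction_comp_dDevel (fun q hq => flatPsiRe_leftMul hq) _ w).symm
  rw [psiMinusFam, hu, hv]
  simp only [coframe_eq a _ hy]
  exact psiMinus_groupCoframe ha t _ w

theorem psiPlusFam_eq (ha : a ≠ 0) (hu : ∀ t, u t = 1 + a * t / 2) (hv : ∀ t, v t = 1)
    (hy : y ∈ (localSection D.Γ x).source) (t : ℝ) :
    psiPlusFam u v (D.coframe a) t y = (contraction (-flatPsiIm) radial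
      (scaleFst (2 / a + t)) (D.devel x y)).compContinuousLinearMap (D.dDevel x y) := by
  ext w
  refine Eq.trans ?_ (contraction_comp_dDevel (fun q hq => ?_) _ w).symm
  · rw [psiPlusFam, hu, hv]
    simp only [coframe_eq a _ hy]
    exact psiPlus_groupCoframe ha t _ w
  · exact congrArg Neg.neg (flatPsiIm_leftMul hq)

theorem flatPsi_comp_dDevel_apply (ha : a ≠ 0) (hu : ∀ t, u t = 1 + a * t / 2)
    (hv : ∀ t, v t = 1) (hy : y ∈ (localSection D.Γ x).source) (t : ℝ)
    (w : Fin 4 → TangentSpace IG y) :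
    (flatPsi.compContinuousLinearMap (scaleFst (2 / a + t))).compContinuousLinearMap
      (D.dDevel x y) w =
      wedge (psiPlusFam u v (D.coframe a) t y) (etaFam v (D.coframe a) t y) w +
      Complex.I * wedge (psiMinusFam u v (D.coframe a) t y) (etaFam v (D.coframe a) t y) w := by
  rw [← compContinuousLinearMap_maurerCartan fun q => flatPsi_leftMul, psiPlusFam, psiMinusFam,
    etaFam, hu, hv]
  simp only [coframe_eq a _ hy]
  exact flatPsi_comp_apply ha t (re_maurerCartan hy) w

theorem wedge_psiPlusFam_eq (ha : a ≠ 0) (hu : ∀ t, u t = 1 + a * t / 2)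
    (hv : ∀ t, v t = 1) (hy : y ∈ (localSection D.Γ x).source) (t : ℝ) :
    wedge (psiPlusFam u v (D.coframe a) t y) (etaFam v (D.coframe a) t y) =
      (flatPsiRe.compContinuousLinearMap (scaleFst (2 / a + t))).compContinuousLinearMap
        (D.dDevel x y) := by
  ext w
  have h := congrArg Complex.re (flatPsi_comp_dDevel_apply ha hu hv hy t w)
  simp only [Complex.add_re, Complex.ofReal_re, Complex.mul_re, Complex.I_re, zero_mul,
    Complex.ofReal_im, mul_zero, sub_zero, add_zero] at h
  exact h.symm

theorem wedge_psiMinusFam_eq (ha : a ≠ 0) (hu : ∀ t, u t = 1 + a * t / 2)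
    (hv : ∀ t, v t = 1) (hy : y ∈ (localSection D.Γ x).source) (t : ℝ) :
    wedge (psiMinusFam u v (D.coframe a) t y) (etaFam v (D.coframe a) t y) =
      (flatPsiIm.compContinuousLinearMap (scaleFst (2 / a + t))).compContinuousLinearMap
        (D.dDevel x y) := by
  ext w
  have h := congrArg Complex.im (flatPsi_comp_dDevel_apply ha hu hv hy t w)
  simp only [Complex.add_im, Complex.ofReal_re, Complex.mul_im, Complex.I_re,
    Complex.ofReal_im, mul_zero, zero_add, Complex.I_im, one_mul] at h
  exact h.symm

theorem isSmoothForm_of_forall_devel {A : Type*} [NormedAddCommGroup A] [NormedSpace ℝ A] {k : ℕ}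
    {α : (y : D.M) → TangentSpace IG y [⋀^Fin k]→L[ℝ] A}
    {β : ℍ[ℝ] × ℍ[ℝ] → (ℍ[ℝ] × ℍ[ℝ]) [⋀^Fin k]→L[ℝ] A} (hβ : ContDiff ℝ ∞ β)
    (hα : ∀ (x : G) (y : D.M), y ∈ (localSection D.Γ x).source →
      α y = (β (D.devel x y)).compContinuousLinearMap (D.dDevel x y)) : IsSmoothForm IG α :=
  isSmoothForm_of_forall_pullback fun y => ⟨_, (localSection D.Γ (Quotient.out y)).open_source,
    mem_localSection_out y, _, contMDiffOn_devel _, β, hβ, fun z hz => hα _ z hz⟩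

theorem contDiff_contraction {W : Type*} [NormedAddCommGroup W] [NormedSpace ℝ W]
    {A : Type*} [NormedAddCommGroup A] [NormedSpace ℝ A] {k : ℕ}
    (β : W [⋀^Fin (k + 1)]→L[ℝ] A) (X S : W →L[ℝ] W) : ContDiff ℝ ∞ (contraction β X S) :=
  (contraction β X S).contDiff

/-- If `α` is the pullback of `S_t^* ι_X β` and `σ s` the pullback of `S_s^* β`, where
`X = ∂ₜ S_t`, then `∂ₜ σ = dα`. -/
theorem hasDerivAt_of_forall_devel {A : Type*} [NormedAddCommGroup A] [NormedSpace ℝ A] {k : ℕ}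
    {α : (y : D.M) → TangentSpace IG y [⋀^Fin k]→L[ℝ] A}
    {σ : ℝ → (y : D.M) → TangentSpace IG y [⋀^Fin (k + 1)]→L[ℝ] A}
    {β : (ℍ[ℝ] × ℍ[ℝ]) [⋀^Fin (k + 1)]→L[ℝ] A} {c t : ℝ}
    (hα : ∀ (x : G) (y : D.M), y ∈ (localSection D.Γ x).source →
      α y = (contraction β radial (scaleFst (c + t)) (D.devel x y)).compContinuousLinearMap
        (D.dDevel x y))
    (hσ : ∀ (s : ℝ) (x : G) (y : D.M), y ∈ (localSection D.Γ x).source →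
      σ s y = (β.compContinuousLinearMap (scaleFst (c + s))).compContinuousLinearMap
        (D.dDevel x y)) (y : D.M) (w : Fin (k + 1) → TangentSpace IG y) :
    HasDerivAt (fun s => σ s y w) (dForm IG α y w) t := by
  have hy := mem_localSection_out y
  rw [dForm_eq_of_pullback (localSection D.Γ (Quotient.out y)).open_source (contMDiffOn_devel _)
    ((contDiff_contraction β radial (scaleFst (c + t))).differentiable (by simp)) (hα _) hy]
  simp only [fun s => hσ s _ y hy]
  exact hasDerivAt_compContinuousLinearMap β (hasDerivAt_scaleFst c t) _ _

theorem dForm_eq_zero_of_forall_devel {A : Type*} [NormedAddCommGroup A] [NormedSpace ℝ A] {k : ℕ}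
    {α : (y : D.M) → TangentSpace IG y [⋀^Fin k]→L[ℝ] A}
    {β : (ℍ[ℝ] × ℍ[ℝ]) [⋀^Fin k]→L[ℝ] A}
    (hα : ∀ (x : G) (y : D.M), y ∈ (localSection D.Γ x).source →
      α y = β.compContinuousLinearMap (D.dDevel x y)) : dForm IG α = 0 := by
  funext y
  exact dForm_eq_zero_of_pullback_const (localSection D.Γ (Quotient.out y)).open_source
    (contMDiffOn_devel _) (hα _) (mem_localSection_out y)

theorem isSU3Structure (ha : a ≠ 0) (hu : ∀ t, u t = 1 + a * t / 2) (hv : ∀ t, v t = 1) {t : ℝ}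
    (ht : u t ≠ 0) : IsSU3Structure IG (omegaFam u v (D.coframe a) t) (etaFam v (D.coframe a) t)
      (psiPlusFam u v (D.coframe a) t) (psiMinusFam u v (D.coframe a) t) where
  smooth_omega := isSmoothForm_of_forall_devel contDiff_const
    fun _ _ hy => omegaFam_eq ha hu hv hy t
  smooth_eta := isSmoothForm_of_forall_devel (contDiff_contraction _ _ _)
    fun _ _ hy => etaFam_eq hv hy t
  smooth_psiPlus := isSmoothForm_of_forall_devel (contDiff_contraction _ _ _)
    fun _ _ hy => psiPlusFam_eq ha hu hv hy t
  smooth_psiMinus := isSmoothForm_of_forall_devel (contDiff_contraction _ _ _)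
    fun _ _ hy => psiMinusFam_eq ha hu hv hy t
  exists_coframe := fun y => ⟨_, isSU3Coframe_scaledCoframe ht (by simp [hv])
    (linearIndependent_coframe ha y)⟩

theorem isHypo (ha : a ≠ 0) (hu : ∀ t, u t = 1 + a * t / 2) (hv : ∀ t, v t = 1) (t : ℝ) :
    IsHypo IG (omegaFam u v (D.coframe a) t) (etaFam v (D.coframe a) t)
      (psiPlusFam u v (D.coframe a) t) (psiMinusFam u v (D.coframe a) t) where
  d_omega := dForm_eq_zero_of_forall_devel fun _ _ hy => omegaFam_eq ha hu hv hy t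
  d_psiPlus_eta := dForm_eq_zero_of_forall_devel fun _ _ hy => wedge_psiPlusFam_eq ha hu hv hy t
  d_psiMinus_eta := dForm_eq_zero_of_forall_devel fun _ _ hy => wedge_psiMinusFam_eq ha hu hv hy t

theorem solvesEvolution (ha : a ≠ 0) (hu : ∀ t, u t = 1 + a * t / 2) (hv : ∀ t, v t = 1)
    (J : Set ℝ) : SolvesEvolution IG J (omegaFam u v (D.coframe a)) (etaFam v (D.coframe a))
      (psiPlusFam u v (D.coframe a)) (psiMinusFam u v (D.coframe a)) where
  deriv_omega := fun t _ y w => by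
    -- Since `η` is a contraction of `-flatOmega`, the general formula applies to `-ω`; negating
    -- gives the required sign.
    have h := hasDerivAt_of_forall_devel (σ := fun s y => -omegaFam u v (D.coframe a) s y)
      (fun _ _ hy => etaFam_eq (a := a) hv hy t)
      (fun s _ _ hy => congrArg Neg.neg (omegaFam_eq ha hu hv hy s)) y w
    exact h.neg.congr_of_eventuallyEq (Filter.Eventually.of_forall fun s => (neg_neg _).symm)
  deriv_psiPlus_eta := fun t _ y w => hasDerivAt_of_forall_devel
    (σ := fun s y => wedge (psiPlusFam u v (D.coframe a) s y) (etaFam v (D.coframe a) s y))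
    (fun _ _ hy => psiMinusFam_eq ha hu hv hy t)
    (fun s _ _ hy => wedge_psiPlusFam_eq ha hu hv hy s) y w
  deriv_psiMinus_eta := fun t _ y w => by
    have h := hasDerivAt_of_forall_devel
      (σ := fun s y => -wedge (psiMinusFam u v (D.coframe a) s y) (etaFam v (D.coframe a) s y))
      (fun _ _ hy => psiPlusFam_eq ha hu hv hy t)
      (fun s _ _ hy => congrArg Neg.neg (wedge_psiMinusFam_eq ha hu hv hy s)) y w
    exact h.neg.congr_of_eventuallyEq (Filter.Eventually.of_forall fun s => (neg_neg _).symm)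

end Families

end LatticeData

end MBeta

namespace MBeta

/-! ### Tangent vectors of the product with an interval. -/

section OpenSubmanifold

variable {E : Type*} [NormedAddCommGroup E] [NormedSpace ℝ E]
  {H : Type*} [TopologicalSpace H] {I : ModelWithCorners ℝ E H}
  {M : Type*} [TopologicalSpace M] [ChartedSpace H M]

theorem mfderiv_subtype_val_injective {U : TopologicalSpace.Opens M} (x : U) :
    Function.Injective (mfderiv I I (Subtype.val : U → M) x) := by
  classical
  -- A left inverse of the inclusion; its value off `U` is arbitrary, as only smoothness at `x` is
  -- used.
  let ρ : M → U := fun y => if h : y ∈ U then ⟨y, h⟩ else x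
  have hρ : ∀ y : U, ρ y = y := fun y => by simp [ρ]
  have h1 : (Subtype.val ∘ ρ : M → M) =ᶠ[𝓝 (x : M)] id := by
    filter_upwards [U.isOpen.mem_nhds x.2] with y hy
    simp [ρ, show y ∈ U from hy]
  have h2 : ContMDiffAt I I ∞ ρ (x : M) :=
    (ContMDiffAt.subtypeVal_comp_iff _ _ _).1 (contMDiffAt_id.congr_of_eventuallyEq h1)
  have h3 : ρ ∘ (Subtype.val : U → M) = id := funext hρ
  refine Function.LeftInverse.injective (g := fun w => mfderiv I I ρ (x : M) w) fun v => ?_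
  have h4 := mfderiv_comp_apply x (h2.mdifferentiableAt (by simp))
    ((contMDiff_subtype_val (I := I) (n := ∞) x).mdifferentiableAt (by simp)) v
  rw [h3, mfderiv_id] at h4
  exact h4.symm

variable {b c : ℝ}

theorem dpr_apply (p : M × interval b c) (w : TangentSpace (I.prod 𝓘(ℝ, ℝ)) p) :
    dpr I p w = w.1 :=
  DFunLike.congr_fun mfderiv_fst w

theorem dt_apply (p : M × interval b c) (w : TangentSpace (I.prod 𝓘(ℝ, ℝ)) p) :
    dt I p w = mfderiv 𝓘(ℝ, ℝ) 𝓘(ℝ, ℝ) (Subtype.val : interval b c → ℝ) p.2 w.2 := by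
  have h := mfderiv_comp_apply (f := Prod.snd) (g := (Subtype.val : interval b c → ℝ)) p
    ((contMDiff_subtype_val (I := 𝓘(ℝ, ℝ)) (n := ∞) p.2).mdifferentiableAt (by simp))
    (mdifferentiableAt_snd (I := I) (I' := 𝓘(ℝ, ℝ))) w
  refine h.trans (congrArg _ ?_)
  exact DFunLike.congr_fun mfderiv_snd w

theorem eq_zero_of_dpr_of_dt {p : M × interval b c} {w : TangentSpace (I.prod 𝓘(ℝ, ℝ)) p}
    (h1 : dpr I p w = 0) (h2 : dt I p w = 0) : w = 0 := by
  rw [dpr_apply] at h1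
  rw [dt_apply] at h2
  exact Prod.ext h1 (mfderiv_subtype_val_injective p.2 (h2.trans (map_zero _).symm))

end OpenSubmanifold

/-! ### Adapted coframes on the product, and linear automorphisms of `ℍ × ℍ`. -/

section ProductForms

variable {E : Type*} [NormedAddCommGroup E] [NormedSpace ℝ E]
  {H : Type*} [TopologicalSpace H] {I : ModelWithCorners ℝ E H}
  {M : Type*} [TopologicalSpace M] [ChartedSpace H M] {b c : ℝ}

theorem omegaProd_eq (u v : ℝ → ℝ) (e : Fin 7 → (y : M) → TangentSpace I y →L[ℝ] ℝ)
    (p : M × interval b c) : omegaProd u v e p =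
      w2 (prodCoframe I u v e p 0) (prodCoframe I u v e p 1) +
      w2 (prodCoframe I u v e p 2) (prodCoframe I u v e p 3) +
      w2 (prodCoframe I u v e p 4) (prodCoframe I u v e p 5) +
      w2 (prodCoframe I u v e p 6) (prodCoframe I u v e p 7) := by
  have h := congrArg (fun α => α.compContinuousLinearMap (dpr I p))
    (omegaForm_eq (u p.2) (v p.2) (fun i => e i p.1))
  have h' : ∀ α β γ : TangentSpace I p.1 [⋀^Fin 2]→L[ℝ] ℝ,
      (α + β + γ).compContinuousLinearMap (dpr I p) = α.compContinuousLinearMap (dpr I p) +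
        β.compContinuousLinearMap (dpr I p) + γ.compContinuousLinearMap (dpr I p) :=
    fun _ _ _ => rfl
  simp only [h', w2_comp] at h
  exact congrArg (· + _) h

theorem psiProd_eq (u v : ℝ → ℝ) (e : Fin 7 → (y : M) → TangentSpace I y →L[ℝ] ℝ)
    (p : M × interval b c) : psiProd u v e p =
      w4 (zCoord (prodCoframe I u v e p) 0) (zCoord (prodCoframe I u v e p) 1)
        (zCoord (prodCoframe I u v e p) 2) (zCoord (prodCoframe I u v e p) 3) := by
  have h := congrArg (fun α => α.compContinuousLinearMap (dpr I p))
    (cForm_psi_eq (u p.2) (v p.2) (fun i => e i p.1))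
  simp only [w3_comp] at h
  exact congrArg (fun α => wedge α _) h

end ProductForms

theorem flatOmega_comp {V : Type*} [AddCommGroup V] [Module ℝ V] [TopologicalSpace V]
    (T : V →L[ℝ] ℍ[ℝ] × ℍ[ℝ]) : flatOmega.compContinuousLinearMap T =
      w2 ((flatCoframe 0).comp T) ((flatCoframe 1).comp T) +
      w2 ((flatCoframe 2).comp T) ((flatCoframe 3).comp T) +
      w2 ((flatCoframe 4).comp T) ((flatCoframe 5).comp T) +
      w2 ((flatCoframe 6).comp T) ((flatCoframe 7).comp T) := by
  simp only [← w2_comp]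
  rfl

theorem flatPsi_comp {V : Type*} [AddCommGroup V] [Module ℝ V] [TopologicalSpace V]
    (T : V →L[ℝ] ℍ[ℝ] × ℍ[ℝ]) : flatPsi.compContinuousLinearMap T =
      w4 (zCoord (fun i => (flatCoframe i).comp T) 0) (zCoord (fun i => (flatCoframe i).comp T) 1)
        (zCoord (fun i => (flatCoframe i).comp T) 2)
        (zCoord (fun i => (flatCoframe i).comp T) 3) := by
  rw [flatPsi, w4_comp]
  rfl

theorem zCoord_comp {V V' : Type*} [AddCommGroup V] [Module ℝ V] [TopologicalSpace V]
    [AddCommGroup V'] [Module ℝ V'] [TopologicalSpace V'] (E : Fin 8 → V →L[ℝ] ℝ) (T : V' →L[ℝ] V)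
    (j : Fin 4) (v : V') : zCoord (fun i => (E i).comp T) j v = zCoord E j (T v) := by
  fin_cases j <;> rfl

theorem eq_zero_of_flatCoframe {w : ℍ[ℝ] × ℍ[ℝ]} (hw : ∀ i, flatCoframe i w = 0) : w = 0 := by
  have h := fun i => (congrFun (flatCoframe_apply w) i).symm.trans (hw i)
  have h4 : w.2.imJ = 0 := neg_eq_zero.1 (h 4)
  exact Prod.ext (Quaternion.ext _ _ (h 7) (h 5) (h 3) (h 0))
    (Quaternion.ext _ _ (h 1) (h 2) h4 (h 6))

/-- The group of automorphisms of a normed space. -/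
abbrev LinearAut (W : Type*) [NormedAddCommGroup W] [NormedSpace ℝ W] : Type _ := W ≃L[ℝ] W

/-- Left multiplication by a unit quaternion, as an automorphism of `ℍ × ℍ`. -/
def leftMulEquiv : Metric.sphere (0 : ℍ[ℝ]) 1 →* LinearAut (ℍ[ℝ] × ℍ[ℝ]) where
  toFun A := ContinuousLinearEquiv.equivOfInverse (leftMul A)
    (leftMul (A⁻¹ : Metric.sphere (0 : ℍ[ℝ]) 1))
    (fun w => by
      rw [leftMul_leftMul, ← Metric.unitSphere.coe_mul, inv_mul_cancel]
      simp [leftMul_apply])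
    (fun w => by
      rw [leftMul_leftMul, ← Metric.unitSphere.coe_mul, mul_inv_cancel]
      simp [leftMul_apply])
  map_one' := by
    ext1
    funext w
    exact Prod.ext (one_mul _) (one_mul _)
  map_mul' A B := by
    ext1
    funext w
    exact (leftMul_leftMul _ _ _).symm

theorem leftMulEquiv_apply (A : Metric.sphere (0 : ℍ[ℝ]) 1) (w : ℍ[ℝ] × ℍ[ℝ]) :
    leftMulEquiv A w = leftMul A w := rfl

theorem normSq_coe_sphere (A : Metric.sphere (0 : ℍ[ℝ]) 1) : Quaternion.normSq (A : ℍ[ℝ]) = 1 := by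
  rw [Quaternion.normSq_eq_norm_mul_self, norm_eq_of_mem_sphere, one_mul]

theorem exists_hasFDerivAt_scaleFst (k : ℝ) (w : ℍ[ℝ] × ℍ[ℝ]) (t : ℝ) :
    ∃ L : (ℍ[ℝ] × ℍ[ℝ]) × ℝ →L[ℝ] ℍ[ℝ] × ℍ[ℝ],
      HasFDerivAt (fun z : (ℍ[ℝ] × ℍ[ℝ]) × ℝ => scaleFst (k + z.2) z.1) L (w, t) ∧
      ∀ z, L z = scaleFst (k + t) z.1 + z.2 • radial w := by
  have h1 : HasFDerivAt (fun z : (ℍ[ℝ] × ℍ[ℝ]) × ℝ => k + z.2)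
      (ContinuousLinearMap.snd ℝ (ℍ[ℝ] × ℍ[ℝ]) ℝ) (w, t) := hasFDerivAt_snd.const_add k
  have h2 := h1.smul (radial.hasFDerivAt.comp (w, t) hasFDerivAt_fst)
  have h3 := ((0 : ℍ[ℝ] × ℍ[ℝ] →L[ℝ] ℍ[ℝ]).prod
    (ContinuousLinearMap.snd ℝ ℍ[ℝ] ℍ[ℝ])).hasFDerivAt.comp (w, t)
      (hasFDerivAt_fst (𝕜 := ℝ) (E := ℍ[ℝ] × ℍ[ℝ]) (F := ℝ))
  refine ⟨_, h2.add h3, fun z => ?_⟩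
  simp [scaleFst_apply, radial]

theorem contDiff_scaleFst (k : ℝ) :
    ContDiff ℝ ∞ (fun z : (ℍ[ℝ] × ℍ[ℝ]) × ℝ => scaleFst (k + z.2) z.1) := by
  simp only [scaleFst_apply]
  fun_prop

end MBeta

namespace MBeta

namespace LatticeData

/-! ### The flat atlas of `M_β × (b, c)`. -/

section Product

variable (D : LatticeData) {b c : ℝ}

/-- The flat developing map of `M_β × (b, c)`. -/
def prodDevel (a : ℝ) (x : G) (p : D.M × interval b c) : ℍ[ℝ] × ℍ[ℝ] :=
  scaleFst (2 / a + (p.2 : ℝ)) (D.devel x p.1)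

variable {D}

theorem contMDiffAt_prodDevel (a : ℝ) {x : G} {p : D.M × interval b c}
    (hp : p.1 ∈ (localSection D.Γ x).source) :
    ContMDiffAt IN 𝓘(ℝ, ℍ[ℝ] × ℍ[ℝ]) ∞ (D.prodDevel a x) p := by
  have h1 : ContMDiffAt IN 𝓘(ℝ, ℍ[ℝ] × ℍ[ℝ]) ∞
      (fun q : D.M × interval b c => D.devel x q.1) p :=
    (contMDiffAt_devel hp).comp p contMDiffAt_fst
  have h2 : ContMDiffAt IN 𝓘(ℝ, ℝ) ∞ (fun q : D.M × interval b c => (q.2 : ℝ)) p :=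
    (contMDiff_subtype_val (I := 𝓘(ℝ, ℝ)) (n := ∞) p.2).comp p contMDiffAt_snd
  exact (contDiff_scaleFst (2 / a)).contMDiff.contMDiffAt.comp p (h1.prodMk_space h2)

theorem mfderiv_prodDevel (a : ℝ) {x : G} {p : D.M × interval b c}
    (hp : p.1 ∈ (localSection D.Γ x).source) (w : TangentSpace IN p) :
    mfderiv IN 𝓘(ℝ, ℍ[ℝ] × ℍ[ℝ]) (D.prodDevel a x) p w =
      scaleFst (2 / a + (p.2 : ℝ)) (D.dDevel x p.1 (dpr IG p w)) +
        dt IG p w • radial (D.devel x p.1) := by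
  obtain ⟨L, hL, hLw⟩ := exists_hasFDerivAt_scaleFst (2 / a) (D.devel x p.1) (p.2 : ℝ)
  have h1 := ((contMDiffAt_devel hp).mdifferentiableAt (by simp)).hasMFDerivAt.comp p
    (mdifferentiableAt_fst (I := IG) (I' := 𝓘(ℝ, ℝ)) (x := p)).hasMFDerivAt
  have h2 := ((contMDiff_subtype_val (I := 𝓘(ℝ, ℝ)) (n := ∞) p.2).mdifferentiableAt
    (by simp)).comp p (mdifferentiableAt_snd (I := IG) (I' := 𝓘(ℝ, ℝ))) |>.hasMFDerivAt
  have h3 : HasMFDerivAt IN 𝓘(ℝ, (ℍ[ℝ] × ℍ[ℝ]) × ℝ)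
      (fun q : D.M × interval b c => (D.devel x q.1, (q.2 : ℝ))) p
      (((D.dDevel x p.1).comp (dpr IG p) : EG × ℝ →L[ℝ] ℍ[ℝ] × ℍ[ℝ]).prod
        (dt IG p : EG × ℝ →L[ℝ] ℝ)) := ⟨h1.1.prodMk h2.1, h1.2.prodMk h2.2⟩
  have h4 := HasMFDerivAt.comp (f := fun q : D.M × interval b c => (D.devel x q.1, (q.2 : ℝ))) p
    hL.hasMFDerivAt h3
  exact (DFunLike.congr_fun h4.mfderiv w).trans (hLw _)

/-- The parallel form `A⁻¹ d(r A, q)` on `M_β × (b, c)`. -/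
def prodMaurerCartan (a : ℝ) (x : G) (p : D.M × interval b c) :
    TangentSpace IN p →L[ℝ] ℍ[ℝ] × ℍ[ℝ] :=
  (leftMul (D.devel x p.1).1⁻¹).comp (mfderiv IN 𝓘(ℝ, ℍ[ℝ] × ℍ[ℝ]) (D.prodDevel a x) p)

/-- The `t`-derivative of `(r A, q)` is `(A, 0)`, which `A⁻¹` sends to `(1, 0)`; thus `dt` occupies
the real direction left empty by `A⁻¹ dA`. -/
theorem prodMaurerCartan_apply (a : ℝ) {x : G} {p : D.M × interval b c}
    (hp : p.1 ∈ (localSection D.Γ x).source) (w : TangentSpace IN p) :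
    prodMaurerCartan a x p w =
      scaleFst (2 / a + (p.2 : ℝ)) (D.maurerCartan x p.1 (dpr IG p w)) + dt IG p w • (1, 0) := by
  have h1 : prodMaurerCartan a x p w = leftMul (D.devel x p.1).1⁻¹
      (scaleFst (2 / a + (p.2 : ℝ)) (D.dDevel x p.1 (dpr IG p w)) +
        dt IG p w • radial (D.devel x p.1)) :=
    congrArg (leftMul (D.devel x p.1).1⁻¹) (mfderiv_prodDevel a hp w)
  have h2 : leftMul (D.devel x p.1).1⁻¹ (radial (D.devel x p.1)) = (1, 0) := by
    simp [leftMul_apply, radial, devel_ne_zero]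
  rw [h1, map_add, map_smul, h2, leftMul_scaleFst]
  rfl

/-- This identifies the adapted coframe with the standard coframe of `ℍ × ℍ`: seven components come
from `scaledCoframe_groupCoframe`, and the eighth, the real part of the first quaternion, is `dt`.
-/
theorem flatCoframe_prodMaurerCartan {a : ℝ} (ha : a ≠ 0) {u v : ℝ → ℝ}
    (hu : ∀ t, u t = 1 + a * t / 2) (hv : ∀ t, v t = 1) {x : G} {p : D.M × interval b c}
    (hp : p.1 ∈ (localSection D.Γ x).source) :
    prodCoframe IG u v (D.coframe a) p =
      fun i => (flatCoframe i).comp (prodMaurerCartan a x p) := by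
  have h1 : ∀ i : Fin 7, ∀ w, prodCoframe IG u v (D.coframe a) p i.castSucc w =
      flatCoframe i.castSucc
        (scaleFst (2 / a + (p.2 : ℝ)) (D.maurerCartan x p.1 (dpr IG p w))) := by
    intro i w
    have h := DFunLike.congr_fun
      (scaledCoframe_groupCoframe ha (p.2 : ℝ) (D.maurerCartan x p.1) i) (dpr IG p w)
    refine Eq.trans ?_ h
    simp only [← coframe_eq a _ hp]
    rw [← hu, ← hv p.2]
    fin_cases i <;> rfl
  have h2 := fun i => congrFun (flatCoframe_apply ((1 : ℍ[ℝ]), (0 : ℍ[ℝ]))) i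
  funext i
  ext w
  refine Eq.trans ?_ (congrArg (flatCoframe i) (prodMaurerCartan_apply a hp w)).symm
  rw [map_add, map_smul, h2]
  refine Fin.lastCases ?_ (fun i => ?_) i
  · have h3 := congrFun (flatCoframe_apply (scaleFst (2 / a + (p.2 : ℝ))
      (D.maurerCartan x p.1 (dpr IG p w)))) 7
    have h4 := re_maurerCartan hp (dpr IG p w)
    change dt IG p w = flatCoframe 7 _ + _
    rw [h3]
    simp [scaleFst_apply, h4]
  · rw [h1]
    fin_cases i <;> simp

theorem prodMaurerCartan_injective {a : ℝ} {x : G} {p : D.M × interval b c}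
    (hr : 2 / a + (p.2 : ℝ) ≠ 0) (hp : p.1 ∈ (localSection D.Γ x).source)
    {w : TangentSpace IN p} (hw : prodMaurerCartan a x p w = 0) : w = 0 := by
  rw [prodMaurerCartan_apply a hp, scaleFst_apply] at hw
  have h1 := congrArg Prod.fst hw
  have h2 := congrArg Prod.snd hw
  have hre := re_maurerCartan hp (dpr IG p w)
  simp only [Prod.fst_add, Prod.snd_add, Prod.smul_fst, Prod.smul_snd, Prod.fst_zero,
    Prod.snd_zero, smul_zero, add_zero] at h1 h2
  have h3 : dt IG p w = 0 := by
    have := congrArg (fun q : ℍ[ℝ] => q.re) h1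
    simpa [hre] using this
  rw [h3, zero_smul, add_zero] at h1
  have h4 := (smul_eq_zero.1 h1).resolve_left hr
  refine eq_zero_of_dpr_of_dt (maurerCartan_injective hp ?_) h3
  exact (Prod.ext h4 h2 : _ = (0 : ℍ[ℝ] × ℍ[ℝ])).trans (map_zero (D.maurerCartan x p.1)).symm

/-- Both spaces have dimension 8, so injectivity suffices; it needs `r ≠ 0` to recover `A⁻¹ dA` from
`r A⁻¹ dA`. -/
theorem isInvertible_mfderiv_prodDevel {a : ℝ} {x : G} {p : D.M × interval b c}
    (hr : 2 / a + (p.2 : ℝ) ≠ 0) (hp : p.1 ∈ (localSection D.Γ x).source) :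
    (mfderiv IN 𝓘(ℝ, ℍ[ℝ] × ℍ[ℝ]) (D.prodDevel a x) p).IsInvertible := by
  let T : EG × ℝ →L[ℝ] ℍ[ℝ] × ℍ[ℝ] := mfderiv IN 𝓘(ℝ, ℍ[ℝ] × ℍ[ℝ]) (D.prodDevel a x) p
  have hT : Function.Injective T := (injective_iff_map_eq_zero T).2 fun w hw =>
    prodMaurerCartan_injective (w := w) hr hp
      ((congrArg (leftMul (D.devel x p.1).1⁻¹) hw).trans (map_zero _))
  have hd : Module.finrank ℝ (EG × ℝ) = Module.finrank ℝ (ℍ[ℝ] × ℍ[ℝ]) := by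
    simp [Quaternion.finrank_eq_four]
  let e :=
    (LinearEquiv.ofInjectiveOfFinrankEq (T : EG × ℝ →ₗ[ℝ] ℍ[ℝ] × ℍ[ℝ]) hT hd).toContinuousLinearEquiv
  exact ⟨e, rfl⟩

variable (D) in
/-- The group of the linear parts of the transition maps of the flat atlas. -/
def linearHolonomy : Subgroup (LinearAut (ℍ[ℝ] × ℍ[ℝ])) :=
  (Subgroup.zpowers (rotA D.β)).map leftMulEquiv

instance : Finite D.linearHolonomy := by
  have : Finite (Subgroup.zpowers (rotA D.β)) := D.isOfFinOrder_rotA.finite_zpowers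
  exact Finite.Set.finite_image _ _

theorem flatInner_linearHolonomy {k : LinearAut (ℍ[ℝ] × ℍ[ℝ])} (hk : k ∈ D.linearHolonomy)
    (v w : ℍ[ℝ] × ℍ[ℝ]) : flatInner (k v) (k w) = flatInner v w := by
  obtain ⟨A, -, rfl⟩ := hk
  exact flatInner_leftMul (normSq_coe_sphere A) v w

theorem exists_mfderiv_prodDevel_eq (a : ℝ) {x x' : G} {p : D.M × interval b c}
    (hp : p.1 ∈ (localSection D.Γ x).source) (hp' : p.1 ∈ (localSection D.Γ x').source) :
    ∃ k ∈ D.linearHolonomy, ∀ᶠ q in 𝓝 p, ∀ w : TangentSpace IN q,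
      mfderiv IN 𝓘(ℝ, ℍ[ℝ] × ℍ[ℝ]) (D.prodDevel a x') q w =
        k (mfderiv IN 𝓘(ℝ, ℍ[ℝ] × ℍ[ℝ]) (D.prodDevel a x) q w) := by
  obtain ⟨A, hA, l, h⟩ := exists_devel_eq hp hp'
  refine ⟨leftMulEquiv A, ⟨A, hA, rfl⟩, ?_⟩
  filter_upwards [continuous_fst.continuousAt.eventually h.eventually_nhds,
    continuous_fst.continuousAt.eventually (eventually_mem_localSection_source hp),
    continuous_fst.continuousAt.eventually (eventually_mem_localSection_source hp')]
    with q hq hx hx' w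
  rw [mfderiv_prodDevel a hx, mfderiv_prodDevel a hx', dDevel_eq_of_eventually_eq hx hq,
    hq.self_of_nhds, leftMulEquiv_apply, map_add (leftMul _), map_smul (leftMul _),
    leftMul_scaleFst]
  -- The translation `(0, l)` lies in the second factor and is killed by `radial`, so only the
  -- linear part remains.
  congr 2
  simp [radial, leftMul_apply]

variable (D) in
/-- The flat atlas of `M_β × (b, c)`. -/
def flatAtlas {a : ℝ} (hr : ∀ t : interval b c, 2 / a + (t : ℝ) ≠ 0) :
    FlatAtlas IN (D.M × interval b c) D.linearHolonomy where
  dom p := Prod.fst ⁻¹' (localSection D.Γ (Quotient.out p.1)).source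
  dev p := D.prodDevel a (Quotient.out p.1)
  isOpen_dom p := (localSection D.Γ (Quotient.out p.1)).open_source.preimage continuous_fst
  mem_dom p := mem_localSection_out p.1
  contMDiffOn_dev _ _ hq := (contMDiffAt_prodDevel a hq).contMDiffWithinAt
  isInvertible_mfderiv _ q hq := isInvertible_mfderiv_prodDevel (hr q.2) hq
  transition _ _ _ hq hq' := exists_mfderiv_prodDevel_eq a hq hq'

variable (D) in
/-- The flat metric of `M_β × (b, c)`. -/
def flatMetric {a : ℝ} (hr : ∀ t : interval b c, 2 / a + (t : ℝ) ≠ 0) :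
    Bundle.ContMDiffRiemannianMetric IN ∞ (EG × ℝ)
      (TangentSpace IN : D.M × interval b c → Type) :=
  (D.flatAtlas hr).metric flatInner flatInner_comm norm_sq_le_flatInner
    fun _ hk => flatInner_linearHolonomy hk

/-! ### The `SU(4)`-structure and its holonomy. -/

section Structure

variable {a : ℝ} {u v : ℝ → ℝ}

/-- The adapted coframe comes from `A⁻¹ dF`; invariance under left multiplication replaces it by
`dF`. The form is thus the pullback of a constant form, hence smooth and closed. -/
theorem omegaProd_coframe (ha : a ≠ 0) (hu : ∀ t, u t = 1 + a * t / 2) (hv : ∀ t, v t = 1)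
    {x : G} {p : D.M × interval b c} (hp : p.1 ∈ (localSection D.Γ x).source) :
    omegaProd u v (D.coframe a) p = flatOmega.compContinuousLinearMap
      (mfderiv IN 𝓘(ℝ, ℍ[ℝ] × ℍ[ℝ]) (D.prodDevel a x) p) := by
  have hA : Quaternion.normSq (D.devel x p.1).1⁻¹ = 1 := by rw [map_inv₀, normSq_devel, inv_one]
  rw [omegaProd_eq, flatCoframe_prodMaurerCartan ha hu hv hp, ← flatOmega_comp]
  conv_rhs => rw [← flatOmega_leftMul hA]
  rfl

theorem psiProd_coframe (ha : a ≠ 0) (hu : ∀ t, u t = 1 + a * t / 2) (hv : ∀ t, v t = 1)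
    {x : G} {p : D.M × interval b c} (hp : p.1 ∈ (localSection D.Γ x).source) :
    psiProd u v (D.coframe a) p = flatPsi.compContinuousLinearMap
      (mfderiv IN 𝓘(ℝ, ℍ[ℝ] × ℍ[ℝ]) (D.prodDevel a x) p) := by
  have hA : Quaternion.normSq (D.devel x p.1).1⁻¹ = 1 := by rw [map_inv₀, normSq_devel, inv_one]
  rw [psiProd_eq, flatCoframe_prodMaurerCartan ha hu hv hp, ← flatPsi_comp]
  conv_rhs => rw [← flatPsi_leftMul hA]
  rfl

theorem isSmoothForm_of_forall_prodDevel {A : Type*} [NormedAddCommGroup A] [NormedSpace ℝ A]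
    {k : ℕ} {α : (p : D.M × interval b c) → TangentSpace IN p [⋀^Fin k]→L[ℝ] A}
    {β : (ℍ[ℝ] × ℍ[ℝ]) [⋀^Fin k]→L[ℝ] A}
    (hα : ∀ (x : G) (p : D.M × interval b c), p.1 ∈ (localSection D.Γ x).source →
      α p = β.compContinuousLinearMap (mfderiv IN 𝓘(ℝ, ℍ[ℝ] × ℍ[ℝ]) (D.prodDevel a x) p)) :
    IsSmoothForm IN α :=
  isSmoothForm_of_forall_pullback fun p =>
    ⟨Prod.fst ⁻¹' (localSection D.Γ (Quotient.out p.1)).source,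
    (localSection D.Γ (Quotient.out p.1)).open_source.preimage continuous_fst,
    mem_localSection_out p.1, D.prodDevel a (Quotient.out p.1),
    fun _ hq => (contMDiffAt_prodDevel a hq).contMDiffWithinAt, fun _ => β, contDiff_const,
    fun q hq => hα _ q hq⟩

theorem dForm_eq_zero_of_forall_prodDevel {A : Type*} [NormedAddCommGroup A] [NormedSpace ℝ A]
    {k : ℕ} {α : (p : D.M × interval b c) → TangentSpace IN p [⋀^Fin k]→L[ℝ] A}
    {β : (ℍ[ℝ] × ℍ[ℝ]) [⋀^Fin k]→L[ℝ] A}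
    (hα : ∀ (x : G) (p : D.M × interval b c), p.1 ∈ (localSection D.Γ x).source →
      α p = β.compContinuousLinearMap (mfderiv IN 𝓘(ℝ, ℍ[ℝ] × ℍ[ℝ]) (D.prodDevel a x) p)) :
    dForm IN α = 0 := by
  funext p
  exact dForm_eq_zero_of_pullback_const
    ((localSection D.Γ (Quotient.out p.1)).open_source.preimage continuous_fst)
    (fun _ hq => (contMDiffAt_prodDevel a hq).contMDiffWithinAt) (hα _) (mem_localSection_out p.1)

theorem isSU4Coframe_prodCoframe (ha : a ≠ 0) (hu : ∀ t, u t = 1 + a * t / 2)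
    (hv : ∀ t, v t = 1) (hr : ∀ t : interval b c, 2 / a + (t : ℝ) ≠ 0)
    (p : D.M × interval b c) :
    IsSU4Coframe ((D.flatMetric hr).inner p) (omegaProd u v (D.coframe a) p)
      (psiProd u v (D.coframe a) p) (prodCoframe IG u v (D.coframe a) p) where
  linearIndependent := by
    have hp := mem_localSection_out p.1
    refine linearIndependent_of_joint_kernel (V := EG × ℝ) ?_ _ fun w hw => ?_
    · simp [Quaternion.finrank_eq_four]
    · rw [flatCoframe_prodMaurerCartan ha hu hv hp] at hw
      exact prodMaurerCartan_injective (hr p.2) hp (eq_zero_of_flatCoframe hw)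
  orthonormal w w' := by
    have hp := mem_localSection_out p.1
    have hA : Quaternion.normSq (D.devel (Quotient.out p.1) p.1).1⁻¹ = 1 := by
      rw [map_inv₀, normSq_devel, inv_one]
    rw [flatCoframe_prodMaurerCartan ha hu hv hp]
    exact (flatInner_leftMul hA _ _).symm.trans (flatInner_eq_sum _ _)
  omega_eq := omegaProd_eq u v (D.coframe a) p
  psi_eq := psiProd_eq u v (D.coframe a) p

theorem isSU4Structure_flatMetric (ha : a ≠ 0) (hu : ∀ t, u t = 1 + a * t / 2)
    (hv : ∀ t, v t = 1) (hr : ∀ t : interval b c, 2 / a + (t : ℝ) ≠ 0) :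
    IsSU4Structure IN (D.flatMetric hr) (omegaProd u v (D.coframe a))
      (psiProd u v (D.coframe a)) where
  smooth_omega := isSmoothForm_of_forall_prodDevel fun _ _ hp => omegaProd_coframe ha hu hv hp
  smooth_psi := isSmoothForm_of_forall_prodDevel fun _ _ hp => psiProd_coframe ha hu hv hp
  exists_coframe p := ⟨_, isSU4Coframe_prodCoframe ha hu hv hr p⟩

theorem actsBySU4_of_mem_holonomy (ha : a ≠ 0) (hu : ∀ t, u t = 1 + a * t / 2)
    (hv : ∀ t, v t = 1) (hr : ∀ t : interval b c, 2 / a + (t : ℝ) ≠ 0)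
    {p : D.M × interval b c} {P : (TangentSpace IN p →L[ℝ] TangentSpace IN p)ˣ}
    (hP : P ∈ holonomy (D.flatAtlas hr).cov p) :
    ActsBySU4 (prodCoframe IG u v (D.coframe a) p)
      (P : TangentSpace IN p →L[ℝ] TangentSpace IN p) := by
  obtain ⟨_, ⟨A, -, rfl⟩, hk⟩ := FlatAtlas.exists_dDev_eq_of_mem_holonomy hP
  have hp := mem_localSection_out p.1
  set B := (D.devel (Quotient.out p.1) p.1).1 with hB
  have hB0 : B ≠ 0 := devel_ne_zero _ _
  have hn : Quaternion.normSq (B⁻¹ * (A : ℍ[ℝ]) * B) = 1 := by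
    rw [map_mul, map_mul, map_inv₀, normSq_coe_sphere, hB, normSq_devel]
    norm_num
  -- The holonomy element is left multiplication by `A` in the developing map. The adapted coframe
  -- is that map's differential twisted by `B⁻¹`, so in this coframe `A` is replaced by its
  -- conjugate, still a unit quaternion.
  refine ⟨leftMulMatrix (B⁻¹ * (A : ℍ[ℝ]) * B), leftMulMatrix_mem_specialUnitaryGroup hn,
    fun w j => ?_⟩
  rw [flatCoframe_prodMaurerCartan ha hu hv hp]
  simp only [zCoord_comp]
  rw [← zCoord_leftMul]
  congr 1
  have h1 : prodMaurerCartan a (Quotient.out p.1) p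
      ((P : TangentSpace IN p →L[ℝ] TangentSpace IN p) w) =
      leftMul B⁻¹ (leftMul (A : ℍ[ℝ])
        (mfderiv IN 𝓘(ℝ, ℍ[ℝ] × ℍ[ℝ]) (D.prodDevel a (Quotient.out p.1)) p w)) :=
    congrArg (leftMul B⁻¹) (hk w)
  have h2 : prodMaurerCartan a (Quotient.out p.1) p w =
      leftMul B⁻¹ (mfderiv IN 𝓘(ℝ, ℍ[ℝ] × ℍ[ℝ]) (D.prodDevel a (Quotient.out p.1)) p w) := rfl
  have h3 (x : ℍ[ℝ] × ℍ[ℝ]) : leftMul B⁻¹ (leftMul (A : ℍ[ℝ]) x) =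
      leftMul (B⁻¹ * (A : ℍ[ℝ]) * B) (leftMul B⁻¹ x) := by
    rw [leftMul_leftMul, leftMul_leftMul, mul_assoc _ B, mul_inv_cancel₀ hB0, mul_one]
  rw [h1, h2]
  exact h3 _

end Structure

end Product

end LatticeData

end MBeta

end

theorem theorem4p1 (D : MBeta.LatticeData) (a : ℝ) (ha : a ≠ 0) (u v : ℝ → ℝ)
    (hu : ∀ t, u t = 1 + a * t / 2) (hv : ∀ t, v t = 1) :
    ∃ e : Fin 7 → (y : D.M) → TangentSpace MBeta.IG y →L[ℝ] ℝ,
      MBeta.IsInducedCoframe D a e ∧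
      ∃ b c : ℝ, b < 0 ∧ 0 < c ∧
        -- a family of hypo-type `SU(3)`-structures on `M_β` solving the evolution equations
        (∀ t ∈ Set.Ioo b c,
          MBeta.IsSU3Structure MBeta.IG (MBeta.omegaFam u v e t) (MBeta.etaFam v e t)
            (MBeta.psiPlusFam u v e t) (MBeta.psiMinusFam u v e t) ∧
          MBeta.IsHypo MBeta.IG (MBeta.omegaFam u v e t) (MBeta.etaFam v e t)
            (MBeta.psiPlusFam u v e t) (MBeta.psiMinusFam u v e t)) ∧
        MBeta.SolvesEvolution MBeta.IG (Set.Ioo b c) (MBeta.omegaFam u v e) (MBeta.etaFam v e)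
          (MBeta.psiPlusFam u v e) (MBeta.psiMinusFam u v e) ∧
        -- the metric on `M_β × (b, c)` and its integrable `SU(4)`-structure
        ∃ g : Bundle.ContMDiffRiemannianMetric MBeta.IN ∞ (MBeta.EG × ℝ)
            (TangentSpace MBeta.IN : D.M × MBeta.interval b c → Type),
          MBeta.IsSU4Structure MBeta.IN g (MBeta.omegaProd u v e) (MBeta.psiProd u v e) ∧
          (∀ x, MBeta.IsSU4Coframe (g.inner x) (MBeta.omegaProd u v e x) (MBeta.psiProd u v e x)
            (MBeta.prodCoframe MBeta.IG u v e x)) ∧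
          MBeta.dForm MBeta.IN
            (MBeta.omegaProd u v e : (p : D.M × MBeta.interval b c) → _) = 0 ∧
          MBeta.dForm MBeta.IN
            (MBeta.psiProd u v e : (p : D.M × MBeta.interval b c) → _) = 0 ∧
          -- its Levi-Civita connection is flat, with discrete holonomy contained in `SU(4)`
          ∃ cov : CovariantDerivative MBeta.IN (MBeta.EG × ℝ)
              (TangentSpace MBeta.IN : D.M × MBeta.interval b c → Type),
            MBeta.IsLeviCivita g cov ∧ MBeta.IsFlat cov ∧
            ∀ x, (∀ P ∈ MBeta.holonomy cov x,
                MBeta.ActsBySU4 (MBeta.prodCoframe MBeta.IG u v e x)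
                  (P : TangentSpace MBeta.IN x →L[ℝ] TangentSpace MBeta.IN x)) ∧
              DiscreteTopology (MBeta.holonomy cov x) ∧
              MBeta.holonomyAlgebra cov x = {0} := by
  -- The developing map degenerates only at `t = -2/a`; the bound `1/|a|` keeps `t` away from it.
  have hr : ∀ t : MBeta.interval (-(1 / |a|)) (1 / |a|), 2 / a + (t : ℝ) ≠ 0 := by
    rintro ⟨t, ht1, ht2⟩ h
    have h1 : |t| < 1 / |a| := abs_lt.2 ⟨ht1, ht2⟩
    have h2 : t = -(2 / a) := by linarith
    rw [h2, abs_neg, abs_div, abs_two] at h1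
    have h3 : (1 : ℝ) / |a| ≤ 2 / |a| := by gcongr; norm_num
    linarith
  have ha' : 0 < 1 / |a| := one_div_pos.2 (abs_pos.2 ha)
  refine ⟨D.coframe a, MBeta.LatticeData.isInducedCoframe_coframe a, -(1 / |a|), 1 / |a|,
    neg_lt_zero.2 ha', ha', fun t ht => ⟨?_, MBeta.LatticeData.isHypo ha hu hv t⟩,
    MBeta.LatticeData.solvesEvolution ha hu hv _, D.flatMetric hr,
    MBeta.LatticeData.isSU4Structure_flatMetric ha hu hv hr,
    MBeta.LatticeData.isSU4Coframe_prodCoframe ha hu hv hr,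
    MBeta.LatticeData.dForm_eq_zero_of_forall_prodDevel
      fun _ _ hp => MBeta.LatticeData.omegaProd_coframe ha hu hv hp,
    MBeta.LatticeData.dForm_eq_zero_of_forall_prodDevel
      fun _ _ hp => MBeta.LatticeData.psiProd_coframe ha hu hv hp,
    (D.flatAtlas hr).cov,
    MBeta.FlatAtlas.isLeviCivita_cov (fun _ hk => MBeta.LatticeData.flatInner_linearHolonomy hk)
      (fun _ _ _ => rfl), MBeta.FlatAtlas.isFlat_cov, fun p => ⟨fun P hP =>
        MBeta.LatticeData.actsBySU4_of_mem_holonomy ha hu hv hr hP,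
      MBeta.FlatAtlas.discreteTopology_holonomy p, MBeta.FlatAtlas.holonomyAlgebra_eq p⟩⟩
  refine MBeta.LatticeData.isSU3Structure ha hu hv ?_
  have h := hr ⟨t, ht⟩
  -- Thus `u` vanishes exactly where the radius `2/a + t` does, and the same interval serves the
  -- `SU(3)`-structures.
  have h1 : u t = a / 2 * (2 / a + t) := by
    rw [hu]
    field_simp
  rw [h1]
  exact mul_ne_zero (div_ne_zero ha two_ne_zero) h
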